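/- **Setting.** Fix $p_1\in\mathbb C\setminus\{0\}$. Write $x=x_1\in\mathbb R$ for the continuous variable, $n_1,n\in\mathbb Z$ for the discrete variables, a tilde for the shift $n_1\mapsto n_1+1$, $\partial_1=\partial/\partial x_1$, and $$\rho_n(k)=e^{kx_1}\Big(\tfrac{p_1+k}{p_1-k}\Big)^{n_1}k^n,\qquad \sigma_n(k')=e^{k'x_1}\Big(\tfrac{p_1+k'}{p_1-k'}\Big)^{n_1}(-k')^{-n},\qquad \Omega(k,k')=\frac1{k+k'} .$$ For $\mathcal N\ge 2$ let $\omega$ run over the primitive $\mathcal N$th roots of unity, and let $d\lambda_\omega$ be finite complex measures carried by compact sets $S_\omega\subset\mathbb C$. Consider the integration measures $$\text{(A)}\ \ d\zeta(k,k')=\sum_\omega\frac1{2\pi i}\frac{d\lambda_\omega(k)\,dk'}{k'+\omega k},\qquad \text{(B)}\ \ d\zeta(k,k')=k\sum_\omega\frac1{2\pi i}\Big(\frac{d\lambda_\omega(k)\,dk'}{k'+\omega k}-\frac{dk\,d\lambda_\omega(k')}{k+\omega k'}\Big),$$ $$\text{(C)}\ \ d\zeta(k,k')=\sum_\omega\frac1{2\pi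 i}\Big(\frac{d\lambda_\omega(k)\,dk'}{k'+\omega k}+\frac{dk\,d\lambda_\omega(k')}{k+\omega k'}\Big),$$ where $dk'$ (resp. $dk$) is integrated along the positively oriented circle of a fixed radius $\delta>0$ around the pole $-\omega k$ (resp. $-\omega k'$). Let $L$ and $R$ be the sets of all values of $k$ and of $k'$ in the integration domain, the contours being replaced by the closed discs they bound; assume that $0,\pm p_1\notin L\cup R$ and that $k+k'\ne0$ for all $k\in L$, $k'\in R$. Put $$\tau_n=\sum_{j\ge0}\frac1{j!}\int\!\!\cdots\!\!\int\det\big[\rho_n(k_a)\sigma_n(k'_a)\Omega(k_b,k'_a)\big]_{a,b=1}^{j}\prod_{a=1}^{j}d\zeta(k_a,k_a').$$ Fix $n_1$ and an open interval $J\subset\mathbb R$ such that $\tau_n\neq0$ and $\tilde\tau_n\neq0$ on $J$ for all $n$. For all $n$, at $n_1$ and at $n_1+1$, and for all $x_1\in J$, let $u_n(k)=(u_n^{(i)}(k))_{i\in\mathbb Z}$ and $v_n(k')=(v_n^{(i)}(k'))_{i\in\mathbb Z}$ be arbitrary (componentwise continuous) solutions of $$u_n^{(i)}(k)+\iint d\zeta(l,l')\,\rho_n(k)\Omega(k,l')\sigma_n(l')\,u_n^{(i)}(l)=\rho_n(k)k^i,\qquad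 v_n^{(i)}(k')+\iint d\zeta(l,l')\,\rho_n(l)\Omega(l,k')\sigma_n(k')\,v_n^{(i)}(l')=k'^i\sigma_n(k')$$ for all $k\ne0,\pm p_1$ with $-k\notin R$, resp. all $k'\neq0,\pm p_1$ with $-k'\notin L$. Put $u_n=\iint d\zeta(k,k')\,u_n^{(0)}(k)\sigma_n(k')$, $\phi_n=u_n^{(0)}(k)$, $\psi_n=v_n^{(0)}(k')$. **1. Reductions.** Let $r\ge1$. In all cases $\tau_{n+\mathcal N}=\tau_n$, $u_{n+\mathcal N}=u_n$, $\phi_{n+\mathcal N}=k^{\mathcal N}\phi_n$, and $\psi_{n+\mathcal N}=k^{-\mathcal N}\psi_n$ where $k^{\mathcal N}=(-k')^{\mathcal N}$, $k'$ being the spectral parameter of $\psi_n$. This is the reduction of type $A_r^{(1)}$ for measure (A) with $\mathcal N=r+1$. Moreover: * measure (B): $\tau_{-1-n}=\tau_n$ and $u_{-1-n}=u_n$, for $\mathcal N=2r+1$ (type $A_{2r}^{(2)}$) and for $\mathcal N=2r+2$ (type $D_{r+1}^{(2)}$); * measure (C): $\tau_{-n}=\tau_n$ and $u_{-n}=u_n$,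 for $\mathcal N=2r$ (type $C_r^{(1)}$) and for $\mathcal N=2r+1$; in the last case $n\mapsto n+r+1$ turns these symmetries into those of type $A_{2r}^{(2)}$. **2. Reduced equations and constraints.** In each of these cases there are primitives $\partial_1^{-1}u_n$ and $\partial_1^{-1}\tilde u_n$ on $J$ with $\exp(\partial_1^{-1}u_n)=\tau_n$ and $\exp(\partial_1^{-1}\tilde u_n)=\tilde\tau_n$. For any such choice put $e_{a,b}=1+\exp[\partial_1^{-1}(u_a-\tilde u_a)-\partial_1^{-1}(u_b-\tilde u_b)]$ and $q_n=2p_1+u_n-\tilde u_n$. Then on $J$ $$\partial_1\sum_{n=0}^{\mathcal N-1}u_n=\sum_{n=0}^{\mathcal N-1}(u_{n+1}-u_n)u_n,$$ and at every point of $J$ at which no $e_{n+1,n}$ vanishes, $q_n\ne0$ and $$\prod_{n=0}^{\mathcal N-1}\frac{q_{n+1}}{e_{n+1,n}}=p_1^{\mathcal N},\qquad \partial_1\ln q_n=u_{n+1}-2u_n+u_{n-1}+q_n-\frac{q_{n+1}}{e_{n+1,n}}-\frac{q_{n-1}}{e_{n-1,n}}\quad(n\in\mathbb Z).$$ There the vector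 $\Phi={}^t(\phi_0,\dots,\phi_{\mathcal N-1})$ satisfies, for every admissible $k$, $\partial_1\Phi=P\Phi$ and $Q_1\tilde\Phi=Q_2\Phi$ with $$P=\mathrm{diag}(u_{i+1}-u_i)+\Delta,\quad Q_1=\mathrm{diag}\Big(\frac{q_{i+1}}{e_{i,i+1}}\Big)-\Delta,\quad Q_2=\mathrm{diag}\Big(\frac{q_{i+1}}{e_{i+1,i}}\Big)+\Delta\qquad(0\le i\le\mathcal N-1),$$ $\Delta$ having ones on the superdiagonal, $k^{\mathcal N}$ in the lower left corner and zeros elsewhere. **3. Explicit systems.** At every point of $J$ at which $e_{1,0}\neq0$ (and $e_{2,1}\ne0$ in the three-component cases), the solutions of 1 satisfy the following systems and constraints, and $\Phi$ satisfies $\partial_1\Phi=P\Phi$, $Q_1\tilde\Phi=Q_2\Phi$ with matrices $P=\mathrm{diag}(d_i)+\Delta$, $Q_1=\mathrm{diag}(a_i)-\Delta$, $Q_2=\mathrm{diag}(b_i)+\Delta$ as listed. * $A_1^{(1)}$ (measure (A), $\mathcal N=2$): $\partial_1\ln q_0=2u_1-2u_0+q_0-\frac{2q_1}{e_{1,0}}$,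 $\ \partial_1\ln q_1=2u_0-2u_1+q_1-\frac{2q_0}{e_{0,1}}$; $\ \partial_1(u_0+u_1)=-(u_0-u_1)^2$, $\ \frac{q_1q_0}{e_{0,1}e_{1,0}}=p_1^2$; $\ d=(u_1-u_0,\,u_0-u_1)$, $a=(\frac{q_1}{e_{0,1}},\frac{q_0}{e_{1,0}})$, $b=(\frac{q_1}{e_{1,0}},\frac{q_0}{e_{0,1}})$. * $A_2^{(2)}$ (measure (B), $\mathcal N=3$): $2\partial_1\ln q_0=2u_1-2u_0+q_0-\frac{2q_1}{e_{1,0}}$, $\ \partial_1\ln q_1=2u_0-2u_1+q_1-\frac{2q_0}{e_{0,1}}$; $\ \partial_1(2u_0+u_1)=-(u_0-u_1)^2$, $\ \frac{q_1q_0^2}{2e_{0,1}e_{1,0}}=p_1^3$; $\ d=(u_1-u_0,\,u_0-u_1,\,0)$, $a=(\frac{q_1}{e_{0,1}},\frac{q_0}{e_{1,0}},\frac{q_0}2)$, $b=(\frac{q_1}{e_{1,0}},\frac{q_0}{e_{0,1}},\frac{q_0}2)$. * $C_2^{(1)}$ (measure (C), $\mathcal N=4$): $\partial_1\ln q_0=2u_1-2u_0+q_0-\frac{2q_1}{e_{1,0}}$,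 $\ \partial_1\ln q_1=u_2-2u_1+u_0+q_1-\frac{q_2}{e_{2,1}}-\frac{q_0}{e_{0,1}}$, $\ \partial_1\ln q_2=2u_1-2u_2+q_2-\frac{2q_1}{e_{1,2}}$; $\ \partial_1(u_0+2u_1+u_2)=-(u_0-u_1)^2-(u_1-u_2)^2$, $\ \frac{q_2q_1^2q_0}{e_{0,1}e_{1,2}e_{2,1}e_{1,0}}=p_1^4$; $\ d=(u_1-u_0,\,u_2-u_1,\,u_1-u_2,\,u_0-u_1)$, $a=(\frac{q_1}{e_{0,1}},\frac{q_2}{e_{1,2}},\frac{q_1}{e_{2,1}},\frac{q_0}{e_{1,0}})$, $b=(\frac{q_1}{e_{1,0}},\frac{q_2}{e_{2,1}},\frac{q_1}{e_{1,2}},\frac{q_0}{e_{0,1}})$. * $D_3^{(2)}$ (measure (B), $\mathcal N=6$): $2\partial_1\ln q_0=2u_1-2u_0+q_0-\frac{2q_1}{e_{1,0}}$, $\ \partial_1\ln q_1=u_2-2u_1+u_0+q_1-\frac{q_2}{e_{2,1}}-\frac{q_0}{e_{0,1}}$, $\ 2\partial_1\ln q_2=2u_1-2u_2+q_2-\frac{2q_1}{e_{1,2}}$;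 $\ 2\partial_1(u_0+u_1+u_2)=-(u_0-u_1)^2-(u_1-u_2)^2$, $\ \frac{q_2^2q_1^2q_0^2}{4e_{0,1}e_{1,2}e_{2,1}e_{1,0}}=p_1^6$; $\ d=(u_1-u_0,\,u_2-u_1,\,0,\,u_1-u_2,\,u_0-u_1,\,0)$, $a=(\frac{q_1}{e_{0,1}},\frac{q_2}{e_{1,2}},\frac{q_2}2,\frac{q_1}{e_{2,1}},\frac{q_0}{e_{1,0}},\frac{q_0}2)$, $b=(\frac{q_1}{e_{1,0}},\frac{q_2}{e_{2,1}},\frac{q_2}2,\frac{q_1}{e_{1,2}},\frac{q_0}{e_{0,1}},\frac{q_0}2)$. **4. Graded Lax pairs.** In each of the four cases of 3, $P$, $Q_1$, $Q_2$ are $\mathbb Z_{\mathcal N}$-graded: conjugated by $\mathrm{diag}(1,k,\dots,k^{\mathcal N-1})$ they become $E_0+kE_1$ with $E_0,E_1$ independent of $k$ and of degrees $0,1$, where the $(i,j)$ matrix unit has degree $j-i \bmod \mathcal N$. Moreover, for arbitrary functions $u_n,\tilde u_n$ (the components occurring in the system) differentiable at a point $x_1$, with primitives $\partial_1^{-1}u_n,\partial_1^{-1}\tilde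 u_n$, such that at $x_1$ all $q_n\ne0$ and $e_{1,0}\neq0$ (and $e_{2,1}\ne0$ in the three-component cases), the system holds at $x_1$ if and only if for every $k\in\mathbb C$ the equations $\partial_1\Phi=P\Phi$, $\partial_1\tilde\Phi=\tilde P\tilde\Phi$, $Q_1\tilde\Phi=Q_2\Phi$ are compatible at $x_1$, i.e. for all vectors $X,Y$ with $Q_1X=Q_2Y$ one has $(\partial_1Q_1+Q_1\tilde P)X=(\partial_1Q_2+Q_2P)Y$. -/

import Mathlib

open Complex MeasureTheory Set

noncomputable section

namespace SemiDS

/-! ### Integration measures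

A double integral `∬_D dζ(k,k') F(k,k')` is represented by the functional `F ↦ ∬_D dζ(k,k') F(k,k')`. -/

/-- Spectral data: for every root of unity `ω` a complex measure `dλ_ω(k) = dens ω k · dμ_ω(k)`
carried by the set `supp ω`, and the radius `rad` of the contours around the poles. -/
structure Spectral where
  mu : ℂ → Measure ℂ
  dens : ℂ → ℂ → ℂ
  supp : ℂ → Set ℂ
  rad : ℝ

/-- `∫ f(k) dλ_ω(k)`. -/
def Spectral.lamInt (S : Spectral) (ω : ℂ) (f : ℂ → ℂ) : ℂ :=
  ∫ k, f k * S.dens ω k ∂(S.mu ω)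

/-- The three families of special measures. -/
inductive Kind
  | A
  | B
  | C

/-- `dζ(k,k') = ∑_ω (1/2πi) dλ_ω(k) dk' / (k' + ω k)`, `ω` running over the primitive `N`th roots of
unity, the `k'`-integration being along the circle of radius `rad` around the pole `-ω k`. -/
def zetaA (N : ℕ) (S : Spectral) (F : ℂ → ℂ → ℂ) : ℂ :=
  ∑ ω ∈ primitiveRoots N ℂ,
    S.lamInt ω (fun k => (2 * Real.pi * I)⁻¹ *
      ∮ k' in C(-(ω * k), S.rad), F k k' / (k' + ω * k))

/-- `dζ(k,k') = k ∑_ω (1/2πi) (dλ_ω(k) dk' / (k' + ω k) - dk dλ_ω(k') / (k + ω k'))`. -/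
def zetaB (N : ℕ) (S : Spectral) (F : ℂ → ℂ → ℂ) : ℂ :=
  ∑ ω ∈ primitiveRoots N ℂ,
    (S.lamInt ω (fun k => (2 * Real.pi * I)⁻¹ *
        ∮ k' in C(-(ω * k), S.rad), k * F k k' / (k' + ω * k)) -
      S.lamInt ω (fun k' => (2 * Real.pi * I)⁻¹ *
        ∮ k in C(-(ω * k'), S.rad), k * F k k' / (k + ω * k')))

/-- `dζ(k,k') = ∑_ω (1/2πi) (dλ_ω(k) dk' / (k' + ω k) + dk dλ_ω(k') / (k + ω k'))`. -/
def zetaC (N : ℕ) (S : Spectral) (F : ℂ → ℂ → ℂ) : ℂ :=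
  ∑ ω ∈ primitiveRoots N ℂ,
    (S.lamInt ω (fun k => (2 * Real.pi * I)⁻¹ *
        ∮ k' in C(-(ω * k), S.rad), F k k' / (k' + ω * k)) +
      S.lamInt ω (fun k' => (2 * Real.pi * I)⁻¹ *
        ∮ k in C(-(ω * k'), S.rad), F k k' / (k + ω * k')))

def Kind.zeta (κ : Kind) (N : ℕ) (S : Spectral) : (ℂ → ℂ → ℂ) → ℂ :=
  match κ with
  | .A => zetaA N S
  | .B => zetaB N S
  | .C => zetaC N S

/-- The points carrying the measures `dλ_ω`. -/
def Spectral.base (S : Spectral) (N : ℕ) : Set ℂ :=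
  {z | ∃ ω ∈ primitiveRoots N ℂ, z ∈ S.supp ω}

/-- The closed discs bounded by the contours. -/
def Spectral.discs (S : Spectral) (N : ℕ) : Set ℂ :=
  {z | ∃ ω ∈ primitiveRoots N ℂ, ∃ k ∈ S.supp ω, z ∈ Metric.closedBall (-(ω * k)) S.rad}

/-- The projection of the integration domain (contours filled in) to the `k`-plane. -/
def Kind.left (κ : Kind) (N : ℕ) (S : Spectral) : Set ℂ :=
  match κ with
  | .A => S.base N
  | .B => S.base N ∪ S.discs N
  | .C => S.base N ∪ S.discs N

/-- The projection of the integration domain (contours filled in) to the `k'`-plane. -/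
def Kind.right (κ : Kind) (N : ℕ) (S : Spectral) : Set ℂ :=
  match κ with
  | .A => S.discs N
  | .B => S.base N ∪ S.discs N
  | .C => S.base N ∪ S.discs N

/-- The spectral data make all integrals meaningful: finite complex measures with compact support,
the domain avoiding the singularities of the plane wave factors and of the Cauchy kernel, and the
contours enclosing no singularity but the pole they surround. -/
structure Kind.Admissible (κ : Kind) (N : ℕ) (p : ℂ) (S : Spectral) : Prop where
  rad_pos : 0 < S.rad
  compact : ∀ ω ∈ primitiveRoots N ℂ, IsCompact (S.supp ω)
  finite : ∀ ω ∈ primitiveRoots N ℂ, IsFiniteMeasure (S.mu ω)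
  carried : ∀ ω ∈ primitiveRoots N ℂ, S.mu ω (S.supp ω)ᶜ = 0
  integrable : ∀ ω ∈ primitiveRoots N ℂ, Integrable (S.dens ω) (S.mu ω)
  avoid : ∀ k ∈ κ.left N S ∪ κ.right N S, k ≠ 0 ∧ k ≠ p ∧ k ≠ -p
  kernel : ∀ k ∈ κ.left N S, ∀ k' ∈ κ.right N S, k + k' ≠ 0

/-! ### Direct linearisation

Throughout `n` is the discrete index, `m` the discrete variable `n₁`, `x` the continuous variable
`x₁`, and `p` the lattice parameter `p₁`. -/

/-- The plane wave factor `ρ_n(k)`. -/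
def rho (p : ℂ) (n m : ℤ) (x : ℝ) (k : ℂ) : ℂ :=
  exp (k * x) * ((p + k) / (p - k)) ^ m * k ^ n

/-- The plane wave factor `σ_n(k')`. -/
def sigma (p : ℂ) (n m : ℤ) (x : ℝ) (k' : ℂ) : ℂ :=
  exp (k' * x) * ((p + k') / (p - k')) ^ m * (-k') ^ (-n)

/-- The Cauchy kernel `Ω(k,k')`. -/
def cauchyKernel (k k' : ℂ) : ℂ := 1 / (k + k')

/-- The `j`-fold integral `∬⋯∬ dζ(k_1,k_1') ⋯ dζ(k_j,k_j') F`. -/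
def multiInt (Z : (ℂ → ℂ → ℂ) → ℂ) : (j : ℕ) → ((Fin j → ℂ × ℂ) → ℂ) → ℂ
  | 0, F => F Fin.elim0
  | j + 1, F => Z fun k k' => multiInt Z j fun z => F (Fin.cons (k, k') z)

/-- `τ_n = det(1 + Ω C_n)`, through its expansion; the sum of the principal `j × j` minors of `Ω C_n`
is `(1/j!) ∬⋯∬ det[ρ(k_a) σ(k_a') Ω(k_b,k_a')]`. -/
def tau (Z : (ℂ → ℂ → ℂ) → ℂ) (p : ℂ) (n m : ℤ) (x : ℝ) : ℂ :=
  ∑' j : ℕ, (1 / (j.factorial : ℂ)) * multiInt Z j fun z =>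
    Matrix.det (Matrix.of fun a b : Fin j =>
      rho p n m x (z a).1 * sigma p n m x (z a).2 * cauchyKernel (z b).1 (z a).2)

/-- The values of a spectral parameter `k` (resp. `k'`) for which the linear integral equation
(resp. its adjoint) makes sense, `T` being the range of the integration variable `l'` (resp. `l`). -/
def paramDomain (p : ℂ) (T : Set ℂ) : Set ℂ :=
  {k | k ≠ 0 ∧ k ≠ p ∧ k ≠ -p ∧ -k ∉ T}

/-- `u(k)`, with components `u k i`, solves the linear integral equation
`u(k) + ∬ dζ(l,l') ρ_n(k) Ω(k,l') σ_n(l') u(l) = ρ_n(k) c(k)`. -/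
def IsWave (Z : (ℂ → ℂ → ℂ) → ℂ) (R : Set ℂ) (p : ℂ) (n m : ℤ) (x : ℝ)
    (u : ℂ → ℤ → ℂ) : Prop :=
  ∀ i : ℤ, ContinuousOn (fun k => u k i) (paramDomain p R) ∧
    ∀ k ∈ paramDomain p R,
      u k i + Z (fun l l' => rho p n m x k * cauchyKernel k l' * sigma p n m x l' * u l i) =
        rho p n m x k * k ^ i

/-- `v(k')`, with components `v k' i`, solves the adjoint linear integral equation
`v(k') + ∬ dζ(l,l') ρ_n(l) Ω(l,k') σ_n(k') v(l') = c(k') σ_n(k')`. -/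
def IsAdjointWave (Z : (ℂ → ℂ → ℂ) → ℂ) (L : Set ℂ) (p : ℂ) (n m : ℤ) (x : ℝ)
    (v : ℂ → ℤ → ℂ) : Prop :=
  ∀ i : ℤ, ContinuousOn (fun k' => v k' i) (paramDomain p L) ∧
    ∀ k' ∈ paramDomain p L,
      v k' i + Z (fun l l' => rho p n m x l * cauchyKernel l k' * sigma p n m x k' * v l' i) =
        k' ^ i * sigma p n m x k'

/-- The entry `U_n^{(i,j)}` of the potential matrix `U_n = ∬ dζ(k,k') u_n(k) c(k') σ_n(k')`. -/
def potentialMatrix (Z : (ℂ → ℂ → ℂ) → ℂ) (p : ℂ) (n m : ℤ) (x : ℝ) (u : ℂ → ℤ → ℂ)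
    (i j : ℤ) : ℂ :=
  Z fun k k' => u k i * k' ^ j * sigma p n m x k'

/-- A family `u n m x` of wave functions and `v n m x` of adjoint wave functions. -/
abbrev WaveFamily := ℤ → ℤ → ℝ → ℂ → ℤ → ℂ

/-- The potential `u_n = U_n^{(0,0)}`. -/
def pot (Z : (ℂ → ℂ → ℂ) → ℂ) (p : ℂ) (u : WaveFamily) (n m : ℤ) (x : ℝ) : ℂ :=
  potentialMatrix Z p n m x (u n m x) 0 0

/-- The scalar wave function: the `0`th component (`φ_n` from `u_n(k)`, `ψ_n` from `v_n(k')`). -/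
def scalarWave (u : WaveFamily) (k : ℂ) (n m : ℤ) (x : ℝ) : ℂ := u n m x k 0

/-- The setting, for `n₁ ∈ {m, m+1}` and `x₁ ∈ J`: admissible spectral data, nonvanishing tau
functions, arbitrary solutions of the linear integral equations. -/
structure IsDLSolution (κ : Kind) (N : ℕ) (p : ℂ) (S : Spectral) (m : ℤ) (J : Set ℝ)
    (u v : WaveFamily) : Prop where
  admissible : κ.Admissible N p S
  tau_ne : ∀ n : ℤ, ∀ l ∈ ({m, m + 1} : Set ℤ), ∀ x ∈ J, tau (κ.zeta N S) p n l x ≠ 0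
  wave : ∀ n : ℤ, ∀ l ∈ ({m, m + 1} : Set ℤ), ∀ x ∈ J,
    IsWave (κ.zeta N S) (κ.right N S) p n l x (u n l x)
  adjoint : ∀ n : ℤ, ∀ l ∈ ({m, m + 1} : Set ℤ), ∀ x ∈ J,
    IsAdjointWave (κ.zeta N S) (κ.left N S) p n l x (v n l x)

/-! ### Reductions -/

/-- `τ_{n+N} = τ_n`, `u_{n+N} = u_n`, `φ_{n+N} = k^N φ_n`, `ψ_{n+N} = k^{-N} ψ_n`; in the last relation
`ψ_n` is taken at a spectral parameter `k'` tied to `k` by `k^N = (-k')^N`. -/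
structure PeriodicReduction (κ : Kind) (N : ℕ) (p : ℂ) (S : Spectral) (m : ℤ) (J : Set ℝ)
    (u v : WaveFamily) : Prop where
  tau_eq : ∀ (n l : ℤ) (x : ℝ), tau (κ.zeta N S) p (n + N) l x = tau (κ.zeta N S) p n l x
  pot_eq : ∀ n : ℤ, ∀ l ∈ ({m, m + 1} : Set ℤ), ∀ x ∈ J,
    pot (κ.zeta N S) p u (n + N) l x = pot (κ.zeta N S) p u n l x
  phi_eq : ∀ n : ℤ, ∀ l ∈ ({m, m + 1} : Set ℤ), ∀ x ∈ J, ∀ k ∈ paramDomain p (κ.right N S),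
    scalarWave u k (n + N) l x = k ^ N * scalarWave u k n l x
  psi_eq : ∀ n : ℤ, ∀ l ∈ ({m, m + 1} : Set ℤ), ∀ x ∈ J, ∀ k' ∈ paramDomain p (κ.left N S),
    ∀ k : ℂ, k ^ N = (-k') ^ N →
      scalarWave v k' (n + N) l x = (k ^ N)⁻¹ * scalarWave v k' n l x

/-- `τ_{c-n} = τ_n` and `u_{c-n} = u_n`. -/
structure SymmetricReduction (κ : Kind) (N : ℕ) (c : ℤ) (p : ℂ) (S : Spectral) (m : ℤ)
    (J : Set ℝ) (u : WaveFamily) : Prop where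
  tau_eq : ∀ (n l : ℤ) (x : ℝ), tau (κ.zeta N S) p (c - n) l x = tau (κ.zeta N S) p n l x
  pot_eq : ∀ n : ℤ, ∀ l ∈ ({m, m + 1} : Set ℤ), ∀ x ∈ J,
    pot (κ.zeta N S) p u (c - n) l x = pot (κ.zeta N S) p u n l x

/-! ### The semi-discrete systems -/

/-- Potentials `u_n`, their shifts `ut n = ũ_n`, and primitives `s n = ∂₁⁻¹ u_n`, `st n = ∂₁⁻¹ ũ_n`. -/
structure Fields where
  u : ℤ → ℝ → ℂ
  ut : ℤ → ℝ → ℂ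
  s : ℤ → ℝ → ℂ
  st : ℤ → ℝ → ℂ

namespace Fields

variable (F : Fields) (p : ℂ)

/-- `2 p₁ + u_n - ũ_n`. -/
def q (n : ℤ) (x : ℝ) : ℂ := 2 * p + F.u n x - F.ut n x

/-- `e_{a,b} = 1 + exp[∂₁⁻¹(u_a - ũ_a) - ∂₁⁻¹(u_b - ũ_b)]`. -/
def e (a b : ℤ) (x : ℝ) : ℂ := 1 + exp ((F.s a x - F.st a x) - (F.s b x - F.st b x))

/-- `∂₁ ∂₁⁻¹ u_n = u_n` and `∂₁ ∂₁⁻¹ ũ_n = ũ_n` at `x`. -/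
def IsPrimitiveAt (n : ℤ) (x : ℝ) : Prop :=
  HasDerivAt (F.s n) (F.u n x) x ∧ HasDerivAt (F.st n) (F.ut n x) x

end Fields

/-- `c · ∂₁ ln f = L` at `x`, where `f x ≠ 0` and `f` is differentiable. -/
def LogDerivEq (c : ℂ) (f : ℝ → ℂ) (L : ℂ) (x : ℝ) : Prop :=
  f x ≠ 0 ∧ ∃ f' : ℂ, HasDerivAt f f' x ∧ c * (f' / f x) = L

/-- The semi-discrete equation for `u_n`. -/
def SemiDiscreteEq (F : Fields) (p : ℂ) (n : ℤ) (x : ℝ) : Prop :=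
  LogDerivEq 1 (F.q p n)
    (F.u (n + 1) x - 2 * F.u n x + F.u (n - 1) x + F.q p n x
      - F.q p (n + 1) x / F.e (n + 1) n x - F.q p (n - 1) x / F.e (n - 1) n x) x

/-- `∂₁ ∑ u_n = ∑ (u_{n+1} - u_n) u_n`. -/
def FirstConstraint (F : Fields) (N : ℕ) (x : ℝ) : Prop :=
  HasDerivAt (fun y => ∑ n ∈ Finset.range N, F.u n y)
    (∑ n ∈ Finset.range N, (F.u (n + 1) x - F.u n x) * F.u n x) x

/-- `∏ (2p₁ + u_{n+1} - ũ_{n+1}) / e_{n+1,n} = p₁^N`. -/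
def SecondConstraint (F : Fields) (p : ℂ) (N : ℕ) (x : ℝ) : Prop :=
  ∏ n ∈ Finset.range N, F.q p (n + 1) x / F.e (n + 1) n x = p ^ N

/-- `F` consists of the potentials of the given solution, with the primitive `∂₁⁻¹ u_n = ln τ_n`. -/
structure IsFieldsOf (κ : Kind) (N : ℕ) (p : ℂ) (S : Spectral) (m : ℤ) (J : Set ℝ)
    (u : WaveFamily) (F : Fields) : Prop where
  u_eq : ∀ n : ℤ, ∀ x ∈ J, F.u n x = pot (κ.zeta N S) p u n m x
  ut_eq : ∀ n : ℤ, ∀ x ∈ J, F.ut n x = pot (κ.zeta N S) p u n (m + 1) x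
  exp_s : ∀ n : ℤ, ∀ x ∈ J, exp (F.s n x) = tau (κ.zeta N S) p n m x
  exp_st : ∀ n : ℤ, ∀ x ∈ J, exp (F.st n x) = tau (κ.zeta N S) p n (m + 1) x
  prim : ∀ n : ℤ, ∀ x ∈ J, F.IsPrimitiveAt n x

/-! ### Lax pairs -/

/-- `(φ_0, …, φ_{N-1})` at the spectral parameter `k`. -/
def Phi (N : ℕ) (u : WaveFamily) (k : ℂ) (m : ℤ) (x : ℝ) : Fin N → ℂ :=
  fun i => scalarWave u k ((i : ℕ) : ℤ) m x

/-- `∂₁Φ = P Φ` and `Q₁ Φ̃ = Q₂ Φ` at `x`. -/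
def LaxPairHolds {N : ℕ} (P Q₁ Q₂ : Matrix (Fin N) (Fin N) ℂ) (Φ Φt : ℝ → Fin N → ℂ)
    (x : ℝ) : Prop :=
  HasDerivAt Φ (P.mulVec (Φ x)) x ∧ Q₁.mulVec (Φt x) = Q₂.mulVec (Φ x)

/-- Compatibility at `x` of `∂₁Φ = P Φ` (with its shift `∂₁Φ̃ = P̃ Φ̃`) and `Q₁ Φ̃ = Q₂ Φ`: for all
values `X` of `Φ̃` and `Y` of `Φ` with `Q₁ X = Q₂ Y`, the two sides have equal derivatives. -/
def LaxCompatible {N : ℕ} (P Pt Q₁ Q₂ : ℝ → Matrix (Fin N) (Fin N) ℂ) (x : ℝ) : Prop :=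
  ∃ D₁ D₂ : Matrix (Fin N) (Fin N) ℂ,
    (∀ i j, HasDerivAt (fun y => Q₁ y i j) (D₁ i j) x) ∧
    (∀ i j, HasDerivAt (fun y => Q₂ y i j) (D₂ i j) x) ∧
    ∀ X Y : Fin N → ℂ, (Q₁ x).mulVec X = (Q₂ x).mulVec Y →
      (D₁ + Q₁ x * Pt x).mulVec X = (D₂ + Q₂ x * P x).mulVec Y

/-- `M(k)` is a `ℤ_N`-graded matrix: after conjugation by `diag(1, k, …, k^{N-1})` it is
`E₀ + k E₁` with `E₀` of degree `0` and `E₁` of degree `1` in the `ℤ_N`-grading of matrices in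
which the `(i,j)` matrix unit has degree `j - i`. -/
def IsZGraded {N : ℕ} (M : ℂ → Matrix (Fin N) (Fin N) ℂ) : Prop :=
  ∃ E₀ E₁ : Matrix (Fin N) (Fin N) ℂ,
    (∀ i j : Fin N, E₀ i j ≠ 0 → (j : ℕ) ≡ (i : ℕ) [MOD N]) ∧
    (∀ i j : Fin N, E₁ i j ≠ 0 → (j : ℕ) ≡ (i : ℕ) + 1 [MOD N]) ∧
    ∀ (k : ℂ) (i j : Fin N),
      k ^ (j : ℕ) * M k i j = k ^ (i : ℕ) * (E₀ i j + k * E₁ i j)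

/-- The matrix with ones above the diagonal and `k^N` in the lower left corner. -/
def cyc (N : ℕ) (k : ℂ) : Matrix (Fin N) (Fin N) ℂ :=
  Matrix.of fun i j => (if (j : ℕ) = (i : ℕ) + 1 then 1 else 0) +
    (if (i : ℕ) + 1 = N ∧ (j : ℕ) = 0 then k ^ N else 0)

def genP (N : ℕ) (u : ℤ → ℝ → ℂ) (k : ℂ) (x : ℝ) : Matrix (Fin N) (Fin N) ℂ :=
  Matrix.diagonal (fun i : Fin N => u ((i : ℕ) + 1) x - u (i : ℕ) x) + cyc N k

def genQ₁ (N : ℕ) (F : Fields) (p k : ℂ) (x : ℝ) : Matrix (Fin N) (Fin N) ℂ :=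
  Matrix.diagonal (fun i : Fin N => F.q p ((i : ℕ) + 1) x / F.e (i : ℕ) ((i : ℕ) + 1) x) - cyc N k

def genQ₂ (N : ℕ) (F : Fields) (p k : ℂ) (x : ℝ) : Matrix (Fin N) (Fin N) ℂ :=
  Matrix.diagonal (fun i : Fin N => F.q p ((i : ℕ) + 1) x / F.e ((i : ℕ) + 1) (i : ℕ) x) + cyc N k

/-- The reduced integrable system of period `N`: there are fields `F` of the solution, and any such
fields satisfy the two constraints, the semi-discrete equations and the linear system, wherever the
denominators do not vanish. -/
def ReducedSystem (κ : Kind) (N : ℕ) (p : ℂ) (S : Spectral) (m : ℤ) (J : Set ℝ)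
    (u : WaveFamily) : Prop :=
  (∃ F : Fields, IsFieldsOf κ N p S m J u F) ∧
  ∀ F : Fields, IsFieldsOf κ N p S m J u F → ∀ x ∈ J,
    FirstConstraint F N x ∧
    ((∀ n : ℤ, F.e (n + 1) n x ≠ 0) →
      SecondConstraint F p N x ∧
      (∀ n : ℤ, SemiDiscreteEq F p n x) ∧
      ∀ k ∈ paramDomain p (κ.right N S),
        LaxPairHolds (genP N F.u k x) (genQ₁ N F p k x) (genQ₂ N F p k x)
          (Phi N u k m) (Phi N u k (m + 1)) x)

/-! ### The system of type `A_1^{(1)}` -/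

def A11System (F : Fields) (p : ℂ) (x : ℝ) : Prop :=
  LogDerivEq 1 (F.q p 0)
    (2 * F.u 1 x - 2 * F.u 0 x + F.q p 0 x - 2 * F.q p 1 x / F.e 1 0 x) x ∧
  LogDerivEq 1 (F.q p 1)
    (2 * F.u 0 x - 2 * F.u 1 x + F.q p 1 x - 2 * F.q p 0 x / F.e 0 1 x) x

def A11P (u : ℤ → ℝ → ℂ) (k : ℂ) (x : ℝ) : Matrix (Fin 2) (Fin 2) ℂ :=
  !![u 1 x - u 0 x, 1;
     k ^ 2, u 0 x - u 1 x]

def A11Q₁ (F : Fields) (p k : ℂ) (x : ℝ) : Matrix (Fin 2) (Fin 2) ℂ :=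
  !![F.q p 1 x / F.e 0 1 x, -1;
     -k ^ 2, F.q p 0 x / F.e 1 0 x]

def A11Q₂ (F : Fields) (p k : ℂ) (x : ℝ) : Matrix (Fin 2) (Fin 2) ℂ :=
  !![F.q p 1 x / F.e 1 0 x, 1;
     k ^ 2, F.q p 0 x / F.e 0 1 x]

def A11Constraints (F : Fields) (p : ℂ) (x : ℝ) : Prop :=
  HasDerivAt (fun y => F.u 0 y + F.u 1 y) (-(F.u 0 x - F.u 1 x) ^ 2) x ∧
  F.q p 1 x * F.q p 0 x / (F.e 0 1 x * F.e 1 0 x) = p ^ 2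

/-! ### The system of type `A_2^{(2)}` -/

def A22System (F : Fields) (p : ℂ) (x : ℝ) : Prop :=
  LogDerivEq 2 (F.q p 0)
    (2 * F.u 1 x - 2 * F.u 0 x + F.q p 0 x - 2 * F.q p 1 x / F.e 1 0 x) x ∧
  LogDerivEq 1 (F.q p 1)
    (2 * F.u 0 x - 2 * F.u 1 x + F.q p 1 x - 2 * F.q p 0 x / F.e 0 1 x) x

def A22P (u : ℤ → ℝ → ℂ) (k : ℂ) (x : ℝ) : Matrix (Fin 3) (Fin 3) ℂ :=
  !![u 1 x - u 0 x, 1, 0;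
     0, u 0 x - u 1 x, 1;
     k ^ 3, 0, 0]

def A22Q₁ (F : Fields) (p k : ℂ) (x : ℝ) : Matrix (Fin 3) (Fin 3) ℂ :=
  !![F.q p 1 x / F.e 0 1 x, -1, 0;
     0, F.q p 0 x / F.e 1 0 x, -1;
     -k ^ 3, 0, F.q p 0 x / 2]

def A22Q₂ (F : Fields) (p k : ℂ) (x : ℝ) : Matrix (Fin 3) (Fin 3) ℂ :=
  !![F.q p 1 x / F.e 1 0 x, 1, 0;
     0, F.q p 0 x / F.e 0 1 x, 1;
     k ^ 3, 0, F.q p 0 x / 2]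

def A22Constraints (F : Fields) (p : ℂ) (x : ℝ) : Prop :=
  HasDerivAt (fun y => 2 * F.u 0 y + F.u 1 y) (-(F.u 0 x - F.u 1 x) ^ 2) x ∧
  F.q p 1 x * F.q p 0 x ^ 2 / (2 * F.e 0 1 x * F.e 1 0 x) = p ^ 3

/-! ### The system of type `C_2^{(1)}` -/

def C21System (F : Fields) (p : ℂ) (x : ℝ) : Prop :=
  LogDerivEq 1 (F.q p 0)
    (2 * F.u 1 x - 2 * F.u 0 x + F.q p 0 x - 2 * F.q p 1 x / F.e 1 0 x) x ∧
  LogDerivEq 1 (F.q p 1)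
    (F.u 2 x - 2 * F.u 1 x + F.u 0 x + F.q p 1 x
      - F.q p 2 x / F.e 2 1 x - F.q p 0 x / F.e 0 1 x) x ∧
  LogDerivEq 1 (F.q p 2)
    (2 * F.u 1 x - 2 * F.u 2 x + F.q p 2 x - 2 * F.q p 1 x / F.e 1 2 x) x

def C21P (u : ℤ → ℝ → ℂ) (k : ℂ) (x : ℝ) : Matrix (Fin 4) (Fin 4) ℂ :=
  !![u 1 x - u 0 x, 1, 0, 0;
     0, u 2 x - u 1 x, 1, 0;
     0, 0, u 1 x - u 2 x, 1;
     k ^ 4, 0, 0, u 0 x - u 1 x]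

def C21Q₁ (F : Fields) (p k : ℂ) (x : ℝ) : Matrix (Fin 4) (Fin 4) ℂ :=
  !![F.q p 1 x / F.e 0 1 x, -1, 0, 0;
     0, F.q p 2 x / F.e 1 2 x, -1, 0;
     0, 0, F.q p 1 x / F.e 2 1 x, -1;
     -k ^ 4, 0, 0, F.q p 0 x / F.e 1 0 x]

def C21Q₂ (F : Fields) (p k : ℂ) (x : ℝ) : Matrix (Fin 4) (Fin 4) ℂ :=
  !![F.q p 1 x / F.e 1 0 x, 1, 0, 0;
     0, F.q p 2 x / F.e 2 1 x, 1, 0;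
     0, 0, F.q p 1 x / F.e 1 2 x, 1;
     k ^ 4, 0, 0, F.q p 0 x / F.e 0 1 x]

def C21Constraints (F : Fields) (p : ℂ) (x : ℝ) : Prop :=
  HasDerivAt (fun y => F.u 0 y + 2 * F.u 1 y + F.u 2 y)
    (-(F.u 0 x - F.u 1 x) ^ 2 - (F.u 1 x - F.u 2 x) ^ 2) x ∧
  F.q p 2 x * F.q p 1 x ^ 2 * F.q p 0 x /
    (F.e 0 1 x * F.e 1 2 x * F.e 2 1 x * F.e 1 0 x) = p ^ 4

/-! ### The system of type `D_3^{(2)}` -/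

def D32System (F : Fields) (p : ℂ) (x : ℝ) : Prop :=
  LogDerivEq 2 (F.q p 0)
    (2 * F.u 1 x - 2 * F.u 0 x + F.q p 0 x - 2 * F.q p 1 x / F.e 1 0 x) x ∧
  LogDerivEq 1 (F.q p 1)
    (F.u 2 x - 2 * F.u 1 x + F.u 0 x + F.q p 1 x
      - F.q p 2 x / F.e 2 1 x - F.q p 0 x / F.e 0 1 x) x ∧
  LogDerivEq 2 (F.q p 2)
    (2 * F.u 1 x - 2 * F.u 2 x + F.q p 2 x - 2 * F.q p 1 x / F.e 1 2 x) x

def D32P (u : ℤ → ℝ → ℂ) (k : ℂ) (x : ℝ) : Matrix (Fin 6) (Fin 6) ℂ :=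
  !![u 1 x - u 0 x, 1, 0, 0, 0, 0;
     0, u 2 x - u 1 x, 1, 0, 0, 0;
     0, 0, 0, 1, 0, 0;
     0, 0, 0, u 1 x - u 2 x, 1, 0;
     0, 0, 0, 0, u 0 x - u 1 x, 1;
     k ^ 6, 0, 0, 0, 0, 0]

def D32Q₁ (F : Fields) (p k : ℂ) (x : ℝ) : Matrix (Fin 6) (Fin 6) ℂ :=
  !![F.q p 1 x / F.e 0 1 x, -1, 0, 0, 0, 0;
     0, F.q p 2 x / F.e 1 2 x, -1, 0, 0, 0;
     0, 0, F.q p 2 x / 2, -1, 0, 0;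
     0, 0, 0, F.q p 1 x / F.e 2 1 x, -1, 0;
     0, 0, 0, 0, F.q p 0 x / F.e 1 0 x, -1;
     -k ^ 6, 0, 0, 0, 0, F.q p 0 x / 2]

def D32Q₂ (F : Fields) (p k : ℂ) (x : ℝ) : Matrix (Fin 6) (Fin 6) ℂ :=
  !![F.q p 1 x / F.e 1 0 x, 1, 0, 0, 0, 0;
     0, F.q p 2 x / F.e 2 1 x, 1, 0, 0, 0;
     0, 0, F.q p 2 x / 2, 1, 0, 0;
     0, 0, 0, F.q p 1 x / F.e 1 2 x, 1, 0;
     0, 0, 0, 0, F.q p 0 x / F.e 0 1 x, 1;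
     k ^ 6, 0, 0, 0, 0, F.q p 0 x / 2]

def D32Constraints (F : Fields) (p : ℂ) (x : ℝ) : Prop :=
  HasDerivAt (fun y => 2 * (F.u 0 y + F.u 1 y + F.u 2 y))
    (-(F.u 0 x - F.u 1 x) ^ 2 - (F.u 1 x - F.u 2 x) ^ 2) x ∧
  F.q p 2 x ^ 2 * F.q p 1 x ^ 2 * F.q p 0 x ^ 2 /
    (4 * F.e 0 1 x * F.e 1 2 x * F.e 2 1 x * F.e 1 0 x) = p ^ 6

/-! ### What is claimed about each explicit system -/

/-- Fields of the solution satisfy the system `Sys`, the constraints `Con` and the linear problem with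
the matrices `P`, `Q₁`, `Q₂` at every point where `e_{b+1,b} ≠ 0` for the listed `b`. -/
def ExplicitSystem (κ : Kind) (N : ℕ) (p : ℂ) (S : Spectral) (m : ℤ) (J : Set ℝ)
    (u : WaveFamily) (idx : Set ℤ) (Sys Con : Fields → ℂ → ℝ → Prop)
    (P : (ℤ → ℝ → ℂ) → ℂ → ℝ → Matrix (Fin N) (Fin N) ℂ)
    (Q₁ Q₂ : Fields → ℂ → ℂ → ℝ → Matrix (Fin N) (Fin N) ℂ) : Prop :=
  ∀ F : Fields, IsFieldsOf κ N p S m J u F → ∀ x ∈ J, (∀ b ∈ idx, F.e (b + 1) b x ≠ 0) →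
    Sys F p x ∧ Con F p x ∧
      ∀ k ∈ paramDomain p (κ.right N S),
        LaxPairHolds (P F.u k x) (Q₁ F p k x) (Q₂ F p k x) (Phi N u k m) (Phi N u k (m + 1)) x

/-- For arbitrary fields, the system `Sys` in the components `u_n`, `n ∈ comp`, is the compatibility
condition of the linear problem with the matrices `P`, `Q₁`, `Q₂`, which are `ℤ_N`-graded. -/
def HasGradedLaxPair (N : ℕ) (comp idx : Set ℤ) (Sys : Fields → ℂ → ℝ → Prop)
    (P : (ℤ → ℝ → ℂ) → ℂ → ℝ → Matrix (Fin N) (Fin N) ℂ)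
    (Q₁ Q₂ : Fields → ℂ → ℂ → ℝ → Matrix (Fin N) (Fin N) ℂ) : Prop :=
  ∀ (F : Fields) (p : ℂ) (x : ℝ),
    IsZGraded (fun k => P F.u k x) ∧ IsZGraded (fun k => Q₁ F p k x) ∧
    IsZGraded (fun k => Q₂ F p k x) ∧
    ((∀ n ∈ comp, DifferentiableAt ℝ (F.u n) x ∧ DifferentiableAt ℝ (F.ut n) x ∧
        F.IsPrimitiveAt n x ∧ F.q p n x ≠ 0) →
      (∀ b ∈ idx, F.e (b + 1) b x ≠ 0) →
      (Sys F p x ↔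
        ∀ k : ℂ, LaxCompatible (P F.u k) (P F.ut k) (Q₁ F p k) (Q₂ F p k) x))

end SemiDS

end

noncomputable section

namespace SemiDS

/-! ### Hadamard's inequality -/

/-! Integration against dζ is a continuous linear functional `I` on C(L × R), and τ_n is the
Fredholm determinant of 1 + Ω r_n, where Ω is the integral operator with kernel 1/(k + l') and r_n =
ρ_n σ_n acts by multiplication. Hadamard's inequality makes the determinant converge and makes it
Lipschitz on bounded sets of kernels. Approximation by degenerate kernels then yields the two facts
behind everything else (`fred_ne_zero`): a nonzero determinant makes 1 + Ω r_n invertible, and a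
rank one perturbation multiplies the determinant by an explicit factor. Invertibility gives
uniqueness, so arbitrary solutions of the integral equation satisfy φ_n = ρ_n w_n with w_n = (1 + Ω
r_n)⁻¹ 1 (`wave_eq`).

The algebra rests on the displacement identity k Ω f + Ω(k' f) = I(f) 1 (`a_mul_om`), together with
the laws r_{n+1} k' = -k r_n, r̃ (p - k)(p - k') = (p + k)(p + k') r and ∂r = (k + k') r. Up to
diagonal conjugation, the step n → n + 1 and the x-derivative change the kernel of τ by a rank one
term, whence τ_{n+1}/τ_n = Y_n (`det_shift`) and ∂τ_n = τ_n u_n (`hasDerivAt_det`). With the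
auxiliary quantities `V` (at n₁) and `Vs` (at n₁ + 1) one finds q_n = 2p V_n Vs_n and e_{n+1,n} = 2
V_n Vs_{n+1} (`u_sub_u`, `V_mul_Vs`), so q_{n+1}/e_{n+1,n} = p V_{n+1}/V_n. The product over a
period telescopes to p^N; the linear equations for ∂V and ∂Vs give ∂ ln q_n; the first constraint
telescopes because ∂u_n is a difference of fluxes plus (u_{n+1} - u_n) u_n.

For the reductions, the contour integral of a holomorphic function collapses to the pole k' = -ωk
(or k = -ωk'), where (k/(-k'))^N = 1. The factor r_{n+N}/r_n is therefore invisible to the measure.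
Measures (B) and (C) are moreover invariant under k ↔ k', (B) up to the weight -k'/k, and
interchanging the variables amounts to transposing and conjugating the kernel. To apply this inside
τ and to the wave functions, iterated integrals and wave functions must be shown to be holomorphic
(`multiInt_congr_of_analyticAt`, `differentiableAt_wave`).

The period and the reflection fold the discrete index onto finitely many values, and the explicit
systems are the general one for the folded fields, with e_{a,a} = 2. Compatibility of the Lax pair
comes from factorizations Q₁' + Q₁ P̃ = (C + Δ) Q₁ + diag(a η) and Q₂' + Q₂ P = (C + Δ) Q₂ + diag(b
η) with the same diagonal C, where η is the defect of the semi-discrete equation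
(`laxCompatible_iff`). -/

theorem prod_le_pow_of_sum_le {n : ℕ} (l : Fin n → ℝ) (hl : ∀ i, 0 ≤ l i) (c : ℝ)
    (hs : ∑ i, l i ≤ n * c) : ∏ i, l i ≤ c ^ n := by
  rcases Nat.eq_zero_or_pos n with rfl | hn
  · simp
  have hn' : (0 : ℝ) < n := by exact_mod_cast hn
  have h := Real.geom_mean_le_arith_mean_weighted Finset.univ (fun _ : Fin n => (1 / n : ℝ)) l
    (fun _ _ => by positivity) (by simp [hn'.ne']) (fun i _ => hl i)
  rw [← Finset.mul_sum, Real.finsetProd_rpow _ _ (fun i _ => hl i)] at h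
  have h0 : 0 ≤ ∏ i, l i := Finset.prod_nonneg fun i _ => hl i
  have h2 : (∏ i, l i) ^ (1 / n : ℝ) ≤ c := h.trans (by
    rw [div_mul_eq_mul_div, one_mul, div_le_iff₀ hn']; linarith)
  calc ∏ i, l i = ((∏ i, l i) ^ (1 / n : ℝ)) ^ n := by
        rw [← Real.rpow_natCast, ← Real.rpow_mul h0]; simp [hn'.ne']
    _ ≤ c ^ n := by gcongr

-- |det A|² is the product of the eigenvalues of A*A, and their sum is the trace ∑ |A_ij|² ≤ n ·
-- nR²; the inequality of arithmetic and geometric means finishes.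
open scoped ComplexOrder in
theorem norm_det_sq_le {n : ℕ} (A : Matrix (Fin n) (Fin n) ℂ) (R : ℝ)
    (h : ∀ i j, ‖A i j‖ ≤ R) : ‖A.det‖ ^ 2 ≤ (n * R ^ 2) ^ n := by
  have hH : (A.conjTranspose * A).PosSemidef := Matrix.posSemidef_conjTranspose_mul_self A
  have hdet : ((‖A.det‖ ^ 2 : ℝ) : ℂ) = ((∏ i, hH.1.eigenvalues i : ℝ) : ℂ) := by
    have h1 := hH.1.det_eq_prod_eigenvalues
    rw [Matrix.det_mul, Matrix.det_conjTranspose] at h1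
    rw [ofReal_prod]
    refine Eq.trans ?_ h1
    rw [ofReal_pow, ← Complex.conj_mul' A.det]; rfl
  have htr : ((∑ i, ∑ j, ‖A i j‖ ^ 2 : ℝ) : ℂ) = ((∑ i, hH.1.eigenvalues i : ℝ) : ℂ) := by
    have h1 := hH.1.trace_eq_sum_eigenvalues
    rw [ofReal_sum (f := hH.1.eigenvalues)]
    refine Eq.trans ?_ h1
    simp only [Matrix.trace, Matrix.diag, Matrix.mul_apply, Matrix.conjTranspose_apply]
    rw [Finset.sum_comm]
    push_cast
    refine Finset.sum_congr rfl fun i _ => Finset.sum_congr rfl fun j _ => ?_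
    rw [← Complex.conj_mul']; rfl
  have hdet' := ofReal_injective hdet
  have htr' := ofReal_injective htr
  rw [hdet']
  refine prod_le_pow_of_sum_le _ hH.eigenvalues_nonneg _ ?_
  rw [← htr']
  calc ∑ i, ∑ j, ‖A i j‖ ^ 2 ≤ ∑ i : Fin n, ∑ j : Fin n, R ^ 2 := by
        gcongr with i _ j _; exact h i j
    _ = n * (n * R ^ 2) := by simp

/-- The constant in Hadamard's inequality. -/
def hadamardConst (n : ℕ) : ℝ := Real.sqrt ((n : ℝ) ^ n)

/-- Multilinearity reduces to rows of sup norm one. A bound by the product of the row norms, rather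
than by a common entry bound, is what yields a Lipschitz estimate for the determinant as a
multilinear map. -/
theorem norm_detRowAlternating_le {n : ℕ} (v : Fin n → Fin n → ℂ) :
    ‖(Matrix.detRowAlternating (R := ℂ)).toMultilinearMap v‖ ≤ hadamardConst n * ∏ i, ‖v i‖ := by
  by_cases hz : ∃ i, v i = 0
  · obtain ⟨i, hi⟩ := hz
    rw [MultilinearMap.map_coord_zero _ i hi, norm_zero]
    unfold hadamardConst; positivity
  push Not at hz
  have hv : ∀ i, (‖v i‖ : ℂ) ≠ 0 := fun i => by simpa using hz i
  have e : v = fun i => (‖v i‖ : ℂ) • ((‖v i‖ : ℂ)⁻¹ • v i) := by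
    funext i; rw [smul_smul, mul_inv_cancel₀ (hv i), one_smul]
  conv_lhs => rw [e]
  rw [MultilinearMap.map_smul_univ, norm_smul, mul_comm]
  have e2 : ‖∏ i, (‖v i‖ : ℂ)‖ = ∏ i, ‖v i‖ := by simp
  rw [e2]
  gcongr
  refine Real.le_sqrt_of_sq_le ?_
  have := norm_det_sq_le (Matrix.of fun i => (‖v i‖ : ℂ)⁻¹ • v i) 1 (fun i j => by
    simp only [Matrix.of_apply, Pi.smul_apply, norm_smul, norm_inv, norm_real, norm_norm]
    rw [inv_mul_le_iff₀ (by simpa using hz i), mul_one]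
    exact norm_le_pi_norm (v i) j)
  simp only [one_pow, mul_one] at this
  exact this

theorem norm_det_le {n : ℕ} (A : Matrix (Fin n) (Fin n) ℂ) {R : ℝ} (hR : 0 ≤ R)
    (h : ∀ i j, ‖A i j‖ ≤ R) : ‖A.det‖ ≤ hadamardConst n * R ^ n := by
  refine (norm_detRowAlternating_le A).trans ?_
  unfold hadamardConst
  gcongr
  calc ∏ i, ‖A i‖ ≤ ∏ _i : Fin n, R := by
        gcongr with i; exact (pi_norm_le_iff_of_nonneg hR).2 (h i)
    _ = R ^ n := by simp

theorem norm_det_sub_det_le {n : ℕ} (A B : Matrix (Fin n) (Fin n) ℂ) {R ε : ℝ} (hR : 0 ≤ R)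
    (hε : 0 ≤ ε) (hA : ∀ i j, ‖A i j‖ ≤ R) (hB : ∀ i j, ‖B i j‖ ≤ R)
    (h : ∀ i j, ‖A i j - B i j‖ ≤ ε) :
    ‖A.det - B.det‖ ≤ hadamardConst n * n * R ^ (n - 1) * ε := by
  have h1 := MultilinearMap.norm_image_sub_le_of_bound
    (Matrix.detRowAlternating (R := ℂ) (n := Fin n)).toMultilinearMap
    (C := hadamardConst n) (Real.sqrt_nonneg _) norm_detRowAlternating_le A B
  refine h1.trans ?_
  have nm : ∀ {M : Fin n → Fin n → ℂ} {c : ℝ}, 0 ≤ c → (∀ i j, ‖M i j‖ ≤ c) →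
      ‖M‖ ≤ c := fun hc hM =>
    (pi_norm_le_iff_of_nonneg hc).2 fun i => (pi_norm_le_iff_of_nonneg hc).2 (hM i)
  rw [Fintype.card_fin]
  have := Real.sqrt_nonneg ((n : ℝ) ^ n)
  unfold hadamardConst
  gcongr
  · exact le_max_of_le_left (norm_nonneg (E := Fin n → Fin n → ℂ) A)
  · exact max_le (nm hR hA) (nm hR hB)
  · exact nm hε h

/-- The factorial beats n^{n/2}: since n^n/n! ≤ e^n, the square of the term is at most (e c²)^n/n!.
-/
theorem summable_hadamard (c : ℝ) (hc : 0 ≤ c) :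
    Summable fun n : ℕ => hadamardConst n * c ^ n / n.factorial := by
  have key : ∀ n : ℕ, hadamardConst n * c ^ n / n.factorial ≤
      (4 * Real.exp 1 * c ^ 2) ^ n / n.factorial + (1 / 4) ^ n := by
    intro n
    have hf : (0 : ℝ) < n.factorial := by positivity
    have h1 : ((n : ℝ) ^ n) / n.factorial ≤ Real.exp 1 ^ n := by
      rw [← Real.exp_nat_mul, mul_one]
      exact Real.pow_div_factorial_le_exp _ (by positivity) n
    -- The inserted factor 4 · (1/4) writes the bound as a product of two summable sequences; a
    -- nonnegative number whose square is at most ab is at most a + b.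
    have h2 : (hadamardConst n * c ^ n / n.factorial) ^ 2 ≤
        ((4 * Real.exp 1 * c ^ 2) ^ n / n.factorial) * (1 / 4) ^ n := by
      have : (hadamardConst n * c ^ n / n.factorial) ^ 2 =
          (n : ℝ) ^ n / n.factorial * ((c ^ 2) ^ n / n.factorial) := by
        unfold hadamardConst
        rw [div_pow, mul_pow, Real.sq_sqrt (by positivity)]; ring
      rw [this]
      calc _ ≤ Real.exp 1 ^ n * ((c ^ 2) ^ n / n.factorial) := by gcongr
        _ = (4 * (1/4)) ^ n * (Real.exp 1 ^ n * ((c ^ 2) ^ n / n.factorial)) := by norm_num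
        _ = _ := by simp only [mul_pow]; ring
    have ha : 0 ≤ (4 * Real.exp 1 * c ^ 2) ^ n / n.factorial := by positivity
    have hb : (0 : ℝ) ≤ (1 / 4) ^ n := by positivity
    refine abs_le_of_sq_le_sq' ?_ (by positivity) |>.2
    nlinarith
  refine Summable.of_nonneg_of_le (fun n => ?_) key ?_
  · unfold hadamardConst; positivity
  · exact (Real.summable_pow_div_factorial _).add
      (summable_geometric_of_lt_one (by norm_num) (by norm_num))

/-! ### Fredholm determinants over a compact space -/

section Fredholm

variable {T : Type*} [TopologicalSpace T] [CompactSpace T]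

/-- Prepending a variable. -/
def consMap (T : Type*) [TopologicalSpace T] (j : ℕ) : C(T × (Fin j → T), Fin (j + 1) → T) where
  toFun q := Fin.cons q.1 q.2
  continuous_toFun := by
    refine continuous_pi fun i => ?_
    refine Fin.cases ?_ (fun i => ?_) i
    · simpa using continuous_fst
    · simp only [Fin.cons_succ]; fun_prop

/-- Currying the first of `j + 1` variables. -/
def curryCons (T : Type*) [TopologicalSpace T] [CompactSpace T] (j : ℕ) :
    C(Fin (j + 1) → T, ℂ) →L[ℂ] C(T, C(Fin j → T, ℂ)) :=
  LinearMap.mkContinuous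
    { toFun := fun F => (F.comp (consMap T j)).curry
      map_add' := fun _ _ => rfl
      map_smul' := fun _ _ => rfl } 1 fun F => by
    rw [one_mul, ContinuousMap.norm_le _ (norm_nonneg _)]
    intro t
    rw [ContinuousMap.norm_le _ (norm_nonneg _)]
    intro z
    exact F.norm_coe_le_norm _

@[simp] theorem curryCons_apply (j : ℕ) (F : C(Fin (j + 1) → T, ℂ)) (t : T) (z : Fin j → T) :
    curryCons T j F t z = F (Fin.cons t z) := rfl

/-- The `j`-fold iterate of a functional. -/
def multiFun (I : C(T, ℂ) →L[ℂ] ℂ) : (j : ℕ) → C(Fin j → T, ℂ) →L[ℂ] ℂ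
  | 0 => ContinuousMap.evalCLM ℂ Fin.elim0
  | j + 1 => I ∘L (multiFun I j).compLeftContinuous ℂ T ∘L curryCons T j

@[simp] theorem multiFun_zero (I : C(T, ℂ) →L[ℂ] ℂ) (F : C(Fin 0 → T, ℂ)) :
    multiFun I 0 F = F Fin.elim0 := rfl

theorem multiFun_succ (I : C(T, ℂ) →L[ℂ] ℂ) (j : ℕ) (F : C(Fin (j + 1) → T, ℂ)) (f : C(T, ℂ))
    (h : ∀ t, f t = multiFun I j (curryCons T j F t)) : multiFun I (j + 1) F = I f := by
  have : f = (multiFun I j).compLeftContinuous ℂ T (curryCons T j F) := by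
    ext t; exact h t
  rw [this]; rfl

theorem norm_multiFun_le (I : C(T, ℂ) →L[ℂ] ℂ) (j : ℕ) (F : C(Fin j → T, ℂ)) (c : ℝ) (hc : 0 ≤ c)
    (h : ∀ z, ‖F z‖ ≤ c) : ‖multiFun I j F‖ ≤ ‖I‖ ^ j * c := by
  induction j with
  | zero => simpa using h Fin.elim0
  | succ j ih =>
    refine (I.le_opNorm _).trans ?_
    rw [pow_succ', mul_assoc]
    gcongr
    rw [ContinuousMap.norm_le _ (by positivity)]
    intro t
    exact ih _ fun z => h _

/-- Variables separate, so the iterated functional factorizes. Every term of the determinant of a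
degenerate kernel has this shape. -/
theorem multiFun_prod (I : C(T, ℂ) →L[ℂ] ℂ) (j : ℕ) (F : C(Fin j → T, ℂ)) (f : Fin j → C(T, ℂ))
    (h : ∀ z, F z = ∏ a, f a (z a)) : multiFun I j F = ∏ a, I (f a) := by
  induction j with
  | zero => simpa using h Fin.elim0
  | succ j ih =>
    rw [multiFun_succ I j F ((∏ a : Fin j, I (f a.succ)) • f 0)]
    · rw [map_smul, Fin.prod_univ_succ, smul_eq_mul, mul_comm]
    · intro t
      have : curryCons T j F t = f 0 t • (∏ a : Fin j, (f a.succ).comp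
          (⟨fun z : Fin j → T => z a, continuous_apply a⟩ : C(Fin j → T, T))) := by
        ext z
        simp [h, Fin.prod_univ_succ]
      rw [this, map_smul, ih _ (fun a => f a.succ) (fun z => by simp)]
      simp [mul_comm]

/-- `z ↦ det[κ(z_a, z_b)]`. -/
def detKer (κ : C(T × T, ℂ)) (j : ℕ) : C(Fin j → T, ℂ) :=
  ⟨fun z => (Matrix.of fun a b : Fin j => κ (z a, z b)).det,
    Continuous.matrix_det (by
      refine continuous_pi fun a => continuous_pi fun b => ?_
      exact κ.continuous.comp (by fun_prop))⟩

/-- The Fredholm determinant `det(1 + κ)`. -/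
def fred (I : C(T, ℂ) →L[ℂ] ℂ) (κ : C(T × T, ℂ)) : ℂ :=
  ∑' j : ℕ, (1 / (j.factorial : ℂ)) * multiFun I j (detKer κ j)

theorem norm_fred_term_le (I : C(T, ℂ) →L[ℂ] ℂ) (κ : C(T × T, ℂ)) (j : ℕ) :
    ‖(1 / (j.factorial : ℂ)) * multiFun I j (detKer κ j)‖ ≤
      hadamardConst j * (‖I‖ * ‖κ‖) ^ j / j.factorial := by
  have h := norm_multiFun_le I j (detKer κ j) (hadamardConst j * ‖κ‖ ^ j)
    (by unfold hadamardConst; positivity)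
    (fun z => norm_det_le _ (norm_nonneg κ) fun a b => κ.norm_coe_le_norm _)
  rw [norm_mul, norm_div, norm_one, norm_natCast, one_div, mul_pow, div_eq_inv_mul]
  gcongr
  linarith

theorem summable_fred (I : C(T, ℂ) →L[ℂ] ℂ) (κ : C(T × T, ℂ)) :
    Summable fun j : ℕ => (1 / (j.factorial : ℂ)) * multiFun I j (detKer κ j) :=
  Summable.of_norm_bounded (summable_hadamard _ (by positivity)) (norm_fred_term_le I κ)

/-- The difference of two j × j determinants costs a factor j R^(j-1), which 2^j (R+1)^j absorbs
without harming convergence. The Lipschitz form, beyond mere continuity, is what bounds resolvents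
uniformly in `fred_ne_zero` and controls the remainder in `hasDerivAt_fred`. -/
theorem exists_lipschitz_fred (I : C(T, ℂ) →L[ℂ] ℂ) (R : ℝ) (hR : 0 ≤ R) :
    ∃ K : ℝ, ∀ κ κ' : C(T × T, ℂ), ‖κ‖ ≤ R → ‖κ'‖ ≤ R →
      ‖fred I κ - fred I κ'‖ ≤ K * ‖κ - κ'‖ := by
  have hs : Summable fun j : ℕ => hadamardConst j * (2 * (‖I‖ * (R + 1))) ^ j / j.factorial :=
    summable_hadamard _ (by positivity)
  refine ⟨∑' j : ℕ, hadamardConst j * (2 * (‖I‖ * (R + 1))) ^ j / j.factorial,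
    fun κ κ' h h' => ?_⟩
  unfold fred
  rw [← (summable_fred I κ).tsum_sub (summable_fred I κ'), ← tsum_mul_right]
  refine tsum_of_norm_bounded (hs.mul_right _).hasSum fun j => ?_
  rw [← mul_sub, ← map_sub]
  have hj : (j : ℝ) ≤ 2 ^ j := by exact_mod_cast Nat.lt_two_pow_self.le
  have hp : R ^ (j - 1) ≤ (R + 1) ^ j :=
    (pow_le_pow_left₀ hR (by linarith) _).trans (pow_le_pow_right₀ (by linarith) (by omega))
  have hc : 0 ≤ hadamardConst j := Real.sqrt_nonneg _
  have h1 := norm_multiFun_le I j (detKer κ j - detKer κ' j)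
    (hadamardConst j * j * R ^ (j - 1) * ‖κ - κ'‖) (by positivity)
    (fun z => norm_det_sub_det_le _ _ hR (norm_nonneg _)
      (fun a b => (κ.norm_coe_le_norm _).trans h) (fun a b => (κ'.norm_coe_le_norm _).trans h')
      (fun a b => (κ - κ').norm_coe_le_norm (z a, z b)))
  rw [norm_mul, norm_div, norm_one, norm_natCast, one_div]
  calc _ ≤ (j.factorial : ℝ)⁻¹ * (‖I‖ ^ j * (hadamardConst j * j * R ^ (j - 1) * ‖κ - κ'‖)) := by
        gcongr
    _ ≤ (j.factorial : ℝ)⁻¹ * (‖I‖ ^ j * (hadamardConst j * 2 ^ j * (R + 1) ^ j * ‖κ - κ'‖)) := by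
        gcongr
    _ = _ := by simp only [mul_pow]; ring

theorem continuous_fred (I : C(T, ℂ) →L[ℂ] ℂ) : Continuous (fred I) := by
  refine continuous_iff_continuousAt.2 fun κ => ?_
  obtain ⟨K, hK⟩ := exists_lipschitz_fred I (‖κ‖ + 1) (by positivity)
  refine tendsto_iff_norm_sub_tendsto_zero.2 ?_
  have h0 : Filter.Tendsto (fun κ' => K * ‖κ' - κ‖) (nhds κ) (nhds 0) := by
    have : Continuous fun κ' : C(T × T, ℂ) => K * ‖κ' - κ‖ := by fun_prop
    simpa using this.tendsto κ
  refine squeeze_zero' (Filter.Eventually.of_forall fun _ => norm_nonneg _) ?_ h0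
  filter_upwards [Metric.ball_mem_nhds κ one_pos] with κ' hκ'
  refine hK κ' κ ?_ (by linarith)
  rw [Metric.mem_ball, dist_eq_norm] at hκ'
  have := norm_le_norm_add_norm_sub' κ' κ
  linarith

/-- The rank one kernel `f(t) g(s)`. -/
def tens (f g : C(T, ℂ)) : C(T × T, ℂ) := ⟨fun q => f q.1 * g q.2, by fun_prop⟩

omit [CompactSpace T] in
@[simp] theorem tens_apply (f g : C(T, ℂ)) (q : T × T) : tens f g q = f q.1 * g q.2 := rfl

/-- The integral operator `f ↦ ∫ κ(t,s) f(s)`. -/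
def op (I : C(T, ℂ) →L[ℂ] ℂ) : C(T × T, ℂ) →L[ℂ] (C(T, ℂ) →L[ℂ] C(T, ℂ)) :=
  LinearMap.mkContinuous₂
    (LinearMap.mk₂ ℂ (fun κ f => (⟨fun t => I (κ.curry t * f), by fun_prop⟩ : C(T, ℂ)))
      (fun κ κ' f => by
        ext t; change I ((κ.curry t + κ'.curry t) * f) = _; rw [add_mul, map_add]; rfl)
      (fun c κ f => by
        ext t; change I ((c • κ.curry t) * f) = _; rw [smul_mul_assoc, map_smul]; rfl)
      (fun κ f f' => by
        ext t; change I (κ.curry t * (f + f')) = _; rw [mul_add, map_add]; rfl)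
      (fun c κ f => by
        ext t; change I (κ.curry t * (c • f)) = _; rw [mul_smul_comm, map_smul]; rfl))
    ‖I‖ fun κ f => by
      rw [ContinuousMap.norm_le _ (by positivity)]
      intro t
      refine (I.le_opNorm _).trans ?_
      rw [mul_assoc]
      gcongr
      refine (norm_mul_le _ _).trans ?_
      gcongr
      rw [ContinuousMap.norm_le _ (norm_nonneg _)]
      exact fun s => κ.norm_coe_le_norm _

theorem op_apply (I : C(T, ℂ) →L[ℂ] ℂ) (κ : C(T × T, ℂ)) (f : C(T, ℂ)) (t : T) :
    op I κ f t = I (κ.curry t * f) := rfl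

theorem op_tens (I : C(T, ℂ) →L[ℂ] ℂ) (f g h : C(T, ℂ)) : op I (tens f g) h = I (g * h) • f := by
  ext t
  rw [op_apply]
  have : (tens f g).curry t * h = f t • (g * h) := by ext s; simp [mul_assoc]
  rw [this, map_smul]; simp [mul_comm]

end Fredholm

/-! ### Principal minors and det(1 + X). -/

theorem det_one_add_eq_sum_minors {ι : Type*} [Fintype ι] [DecidableEq ι] (X : Matrix ι ι ℂ) :
    (1 + X).det = ∑ s : Finset ι, (X.submatrix (Subtype.val : s → ι) Subtype.val).det := by
  rw [add_comm]
  change Matrix.detRowAlternating (fun i => X i + (1 : Matrix ι ι ℂ) i) = _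
  rw [show (fun i => X i + (1 : Matrix ι ι ℂ) i) =
    (fun i => X i) + (fun i => (1 : Matrix ι ι ℂ) i) from rfl, AlternatingMap.map_add_univ]
  exact Finset.sum_congr rfl fun s _ => Matrix.det_piecewise_one_eq_submatrix_det X s

/-- A non-injective choice repeats a row and contributes zero. There are j! injective choices with a
given image s, and each gives the principal minor of s because rows and columns are permuted
simultaneously. This is what the 1/j! of the Fredholm series cancels. -/
theorem sum_det_submatrix {ι : Type*} [Fintype ι] [DecidableEq ι] (X : Matrix ι ι ℂ) (j : ℕ) :
    ∑ c : Fin j → ι, (X.submatrix c c).det =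
      j.factorial * ∑ s ∈ Finset.univ.powersetCard j,
        (X.submatrix (Subtype.val : s → ι) Subtype.val).det := by
  have h1 : ∑ c : Fin j → ι, (X.submatrix c c).det =
      ∑ c : Fin j → ι with Function.Injective c, (X.submatrix c c).det := by
    symm
    refine Finset.sum_subset (Finset.filter_subset _ _) fun c _ hc => ?_
    have hc' : ¬ Function.Injective c := fun h => hc (by simp [h])
    simp only [Function.Injective] at hc'
    push Not at hc'
    obtain ⟨a, b, hab, hne⟩ := hc'
    exact Matrix.det_zero_of_row_eq hne (by ext k; simp [hab])
  rw [h1, Finset.mul_sum, ← Finset.sum_fiberwise_of_maps_to (g := fun c => Finset.univ.image c)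
    (t := Finset.univ.powersetCard j)]
  · refine Finset.sum_congr rfl fun s hs => ?_
    have hcard : s.card = j := (Finset.mem_powersetCard.1 hs).2
    have : ∀ c ∈ (Finset.univ.filter fun c : Fin j → ι => Function.Injective c).filter
        (fun c => Finset.univ.image c = s), (X.submatrix c c).det =
          (X.submatrix (Subtype.val : s → ι) Subtype.val).det := by
      intro c hc
      simp only [Finset.mem_filter, Finset.mem_univ, true_and] at hc
      obtain ⟨hinj, himg⟩ := hc
      have hmem : ∀ a, c a ∈ s := fun a => himg ▸ Finset.mem_image_of_mem c (Finset.mem_univ a)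
      let e : Fin j ≃ s := Equiv.ofBijective (fun a => ⟨c a, hmem a⟩)
        ⟨fun a b h => hinj (Subtype.ext_iff.1 h), fun x => by
          obtain ⟨a, _, ha⟩ := Finset.mem_image.1 (himg.symm ▸ x.2 : (x : ι) ∈ Finset.univ.image c)
          exact ⟨a, Subtype.ext ha⟩⟩
      rw [← Matrix.det_submatrix_equiv_self e]
      rfl
    rw [Finset.sum_congr rfl this, Finset.sum_const, nsmul_eq_mul]
    congr 2
    have hj : Fintype.card (Fin j) = Fintype.card s := by
      rw [Fintype.card_coe, hcard, Fintype.card_fin]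
    have hf := Fintype.card_equiv (Fintype.equivOfCardEq hj)
    rw [Fintype.card_fin] at hf
    rw [← hf, ← Finset.card_univ]
    symm
    refine Finset.card_bij (fun e _ a => (e a : ι)) ?_ ?_ ?_
    · intro e _
      simp only [Finset.mem_filter, Finset.mem_univ, true_and]
      refine ⟨Subtype.val_injective.comp e.injective, ?_⟩
      ext x
      simp only [Finset.mem_image, Finset.mem_univ, true_and]
      exact ⟨fun ⟨a, ha⟩ => ha ▸ (e a).2, fun hx => ⟨e.symm ⟨x, hx⟩, by simp⟩⟩
    · intro e _ e' _ h
      ext a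
      exact congrFun h a
    · intro c hc
      simp only [Finset.mem_filter, Finset.mem_univ, true_and] at hc
      obtain ⟨hinj, himg⟩ := hc
      have hmem : ∀ a, c a ∈ s := fun a => by
        have := Finset.mem_image_of_mem c (Finset.mem_univ a)
        rwa [himg] at this
      refine ⟨Equiv.ofBijective (fun a => ⟨c a, hmem a⟩)
        ⟨fun a b h => hinj (Subtype.ext_iff.1 h), fun x => ?_⟩, Finset.mem_univ _, rfl⟩
      obtain ⟨a, _, ha⟩ := Finset.mem_image.1 (himg.symm ▸ x.2 : (x : ι) ∈ Finset.univ.image c)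
      exact ⟨a, Subtype.ext ha⟩
  · intro c hc
    simp only [Finset.mem_filter, Finset.mem_univ, true_and] at hc
    rw [Finset.mem_powersetCard]
    exact ⟨Finset.subset_univ _, by rw [Finset.card_image_of_injective _ hc]; simp⟩

/-! ### Determinant and resolvent of kernels of finite rank. -/

section Degenerate

variable {T : Type*} [TopologicalSpace T] [CompactSpace T]

/-- The kernel `∑ f_i(t) g_i(s)`. -/
def degKer {ι : Type*} [Fintype ι] (f g : ι → C(T, ℂ)) : C(T × T, ℂ) := ∑ i, tens (f i) (g i)

/-- Expand by rows (a choice c of one summand per point) and over permutations π. The point z_b then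
enters only through f_{c(b)} g_{c(π b)}, so the integral factorizes into entries of the matrix of
pairings. -/
theorem multiFun_detKer_degKer (I : C(T, ℂ) →L[ℂ] ℂ) {ι : Type*} [Fintype ι]
    (f g : ι → C(T, ℂ)) (j : ℕ) :
    multiFun I j (detKer (degKer f g) j) =
      ∑ c : Fin j → ι, ((Matrix.of fun i k => I (g i * f k)).submatrix c c).det := by
  classical
  let P : (Fin j → ι) → Equiv.Perm (Fin j) → C(Fin j → T, ℂ) := fun c π =>
    ∏ b, ((f (c b) * g (c (π b))).comp
      (⟨fun z : Fin j → T => z b, continuous_apply b⟩ : C(Fin j → T, T)))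
  have h : detKer (degKer f g) j = ∑ c, ∑ π, ((Equiv.Perm.sign π : ℤ) : ℂ) • P c π := by
    ext z
    have h1 : detKer (degKer f g) j z = Matrix.detRowAlternating
        (fun a => ∑ i, f i (z a) • (fun b => g i (z b))) := by
      simp only [detKer, degKer, ContinuousMap.coe_mk]
      change Matrix.det _ = Matrix.det _
      congr 1
      ext a b
      simp [Finset.sum_apply]
    rw [h1]
    rw [← AlternatingMap.coe_multilinearMap, MultilinearMap.map_sum]
    simp only [ContinuousMap.coe_sum, Finset.sum_apply]
    refine Finset.sum_congr rfl fun c _ => ?_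
    rw [MultilinearMap.map_smul_univ, AlternatingMap.coe_multilinearMap]
    change _ • Matrix.det (Matrix.of fun i b => g (c i) (z b)) = _
    rw [Matrix.det_apply', smul_eq_mul, Finset.mul_sum]
    refine Finset.sum_congr rfl fun π _ => ?_
    simp only [P, ContinuousMap.smul_apply, ContinuousMap.coe_prod, Finset.prod_apply,
      ContinuousMap.comp_apply, ContinuousMap.mul_apply, ContinuousMap.coe_mk, smul_eq_mul,
      Finset.prod_mul_distrib, Matrix.of_apply]
    ring
  rw [h, map_sum]
  refine Finset.sum_congr rfl fun c _ => ?_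
  rw [map_sum, Matrix.det_apply']
  refine Finset.sum_congr rfl fun π _ => ?_
  rw [map_smul, smul_eq_mul, multiFun_prod I j (P c π) (fun b => f (c b) * g (c (π b)))
    (fun z => by simp [P])]
  simp [mul_comm]

theorem fred_degKer (I : C(T, ℂ) →L[ℂ] ℂ) {ι : Type*} [Fintype ι] [DecidableEq ι]
    (f g : ι → C(T, ℂ)) :
    fred I (degKer f g) = (1 + Matrix.of fun i k => I (g i * f k)).det := by
  rw [det_one_add_eq_sum_minors, ← Finset.powerset_univ, Finset.sum_powerset]
  unfold fred
  have hterm : ∀ j : ℕ, (1 / (j.factorial : ℂ)) * multiFun I j (detKer (degKer f g) j) =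
      ∑ s ∈ Finset.univ.powersetCard j, ((Matrix.of fun i k => I (g i * f k)).submatrix
        (Subtype.val : s → ι) Subtype.val).det := by
    intro j
    rw [multiFun_detKer_degKer, sum_det_submatrix, ← mul_assoc, one_div,
      inv_mul_cancel₀ (by exact_mod_cast j.factorial_ne_zero), one_mul]
  simp only [hterm]
  rw [tsum_eq_sum (s := Finset.range ((Finset.univ : Finset ι).card + 1))]
  intro j hj
  rw [Finset.powersetCard_eq_empty.2 (by simpa [Nat.lt_succ_iff] using hj), Finset.sum_empty]

theorem op_degKer (I : C(T, ℂ) →L[ℂ] ℂ) {ι : Type*} [Fintype ι] (f g : ι → C(T, ℂ))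
    (h : C(T, ℂ)) : op I (degKer f g) h = ∑ i, I (g i * h) • f i := by
  unfold degKer
  rw [map_sum, sum_apply]
  exact Finset.sum_congr rfl fun i _ => op_tens _ _ _ _

/-- For a degenerate kernel a nonzero determinant means invertibility, and it governs rank one
perturbations. -/
theorem degKer_inverse (I : C(T, ℂ) →L[ℂ] ℂ) {ι : Type*} [Fintype ι] [DecidableEq ι]
    (f g : ι → C(T, ℂ)) (h0 : fred I (degKer f g) ≠ 0) :
    ∃ G : C(T, ℂ) →L[ℂ] C(T, ℂ), (∀ h, G h + op I (degKer f g) (G h) = h) ∧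
      (∀ h, G (h + op I (degKer f g) h) = h) ∧
      ∀ f' g', fred I (degKer f g + tens f' g') = fred I (degKer f g) * (1 + I (g' * G f')) := by
  set X : Matrix ι ι ℂ := Matrix.of fun i k => I (g i * f k) with hX
  rw [fred_degKer, ← hX] at h0
  have hu : IsUnit (1 + X).det := isUnit_iff_ne_zero.2 h0
  set Y := (1 + X)⁻¹ with hY
  have hXY : (1 + X) * Y = 1 := Matrix.mul_nonsing_inv _ hu
  have hYX : Y * (1 + X) = 1 := Matrix.nonsing_inv_mul _ hu
  let L : ι → (C(T, ℂ) →L[ℂ] ℂ) := fun i => I ∘L ContinuousLinearMap.mul ℂ C(T, ℂ) (g i)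
  -- Pairing y + ∑ I(g_i y) f_i = h with each g_k gives the linear system (1 + X) v = I(g h) for v_k
  -- = I(g_k y), hence y = h - ∑ (Y I(g h))_i f_i.
  let G : C(T, ℂ) →L[ℂ] C(T, ℂ) := ContinuousLinearMap.id ℂ _ -
    ∑ i, ∑ k, Y i k • (L k).smulRight (f i)
  have hG : ∀ h, G h = h - ∑ i, (Y.mulVec fun k => I (g k * h)) i • f i := by
    intro h
    simp only [G, L, sub_apply, ContinuousLinearMap.id_apply,
      sum_apply, smul_apply,
      ContinuousLinearMap.smulRight_apply, ContinuousLinearMap.comp_apply,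
      ContinuousLinearMap.mul_apply', Matrix.mulVec, dotProduct, Finset.sum_smul, smul_smul]
  have hI : ∀ (v : ι → ℂ) (h : C(T, ℂ)), (fun k => I (g k * (h - ∑ i, v i • f i))) =
      (fun k => I (g k * h)) - X.mulVec v := by
    intro v h
    funext k
    simp only [mul_sub, map_sub, Finset.mul_sum, map_sum, mul_smul_comm, map_smul, Pi.sub_apply,
      Matrix.mulVec, dotProduct, hX, Matrix.of_apply, smul_eq_mul, mul_comm (v _)]
  refine ⟨G, fun h => ?_, fun h => ?_, fun f' g' => ?_⟩
  · rw [op_degKer, hG]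
    have e := hI (Y.mulVec fun k => I (g k * h)) h
    have e2 : (fun k => I (g k * h)) - X.mulVec (Y.mulVec fun k => I (g k * h)) =
        Y.mulVec fun k => I (g k * h) := by
      have := congrArg (fun M => M.mulVec fun k => I (g k * h)) hXY
      simp only [← Matrix.mulVec_mulVec, Matrix.add_mulVec, Matrix.one_mulVec] at this
      rw [sub_eq_iff_eq_add, this]
    rw [e2] at e
    simp only [fun i => congrFun e i]
    abel
  · rw [hG, op_degKer]
    have e := hI (-fun k => I (g k * h)) h
    have e0 : h - ∑ i, (-fun k => I (g k * h)) i • f i = h + ∑ i, I (g i * h) • f i := by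
      simp
    rw [e0] at e
    rw [e, Matrix.mulVec_neg, sub_neg_eq_add]
    have := congrArg (fun M => M.mulVec fun k => I (g k * h)) hYX
    simp only [← Matrix.mulVec_mulVec, Matrix.add_mulVec, Matrix.one_mulVec] at this
    rw [this]
    abel
  -- A rank one term borders 1 + X by one row and one column, and the Schur complement of 1 + X in
  -- the bordered matrix is 1 + I(g' G f').
  · have e1 : degKer f g + tens f' g' =
        degKer (Sum.elim f fun _ : Unit => f') (Sum.elim g fun _ : Unit => g') := by
      simp [degKer]
    have e2 : (1 + Matrix.of fun i k => I (Sum.elim g (fun _ : Unit => g') i *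
        Sum.elim f (fun _ : Unit => f') k)) =
        Matrix.fromBlocks (1 + X) (Matrix.of fun i _ => I (g i * f'))
          (Matrix.of fun _ k => I (g' * f k)) (Matrix.of fun _ _ => 1 + I (g' * f')) := by
      ext (i | i) (k | k) <;> simp [X, Matrix.one_apply]
    let _ : Invertible (1 + X) := Matrix.invertibleOfIsUnitDet _ hu
    rw [e1, fred_degKer, e2, Matrix.det_fromBlocks₁₁, fred_degKer, ← hX]
    congr 1
    rw [Matrix.det_unique, Matrix.invOf_eq_nonsing_inv, ← hY, hG]
    simp only [Matrix.sub_apply, Matrix.of_apply, mul_sub, map_sub, Finset.mul_sum, map_sum,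
      mul_smul_comm, map_smul, Matrix.mul_assoc, Matrix.mul_apply (M := Matrix.of _), smul_eq_mul]
    rw [add_sub_assoc]
    congr 2
    refine Finset.sum_congr rfl fun i _ => ?_
    rw [mul_comm]
    rfl

end Degenerate

/-- A quantitative form of openness of the units: invertibility passes to a limit as long as the
inverses stay bounded along the sequence. -/
theorem isUnit_of_near_unit {A : Type*} [NormedRing A] [CompleteSpace A] {a b : A} {B : ℝ}
    (ha : IsUnit a) (hB : ‖Ring.inverse a‖ ≤ B) (hab : ‖b - a‖ < B⁻¹) : IsUnit b := by
  obtain ⟨U, rfl⟩ := ha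
  rcases subsingleton_or_nontrivial A with hs | hs
  · exact isUnit_of_subsingleton _
  rw [Ring.inverse_unit] at hB
  exact (Units.ofNearby U b (hab.trans_le (inv_anti₀ (Units.norm_pos U⁻¹) hB))).isUnit

theorem continuousAt_inverse_of_isUnit {A : Type*} [NormedRing A] [CompleteSpace A] {a : A}
    (ha : IsUnit a) : ContinuousAt Ring.inverse a := by
  obtain ⟨U, rfl⟩ := ha
  exact NormedRing.inverse_continuousAt U

/-! ### Nonzero determinants: invertibility, rank one perturbations, derivatives. -/

section Fredholm

variable {T : Type*} [TopologicalSpace T] [CompactSpace T]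

/-- Kernels that are finite sums of products. -/
def IsDegenerate (κ : C(T × T, ℂ)) : Prop :=
  ∃ (ι : Type) (_ : Fintype ι) (f g : ι → C(T, ℂ)), κ = degKer f g

/-- The degenerate kernels form a star subalgebra. -/
def degenerateAlgebra (T : Type*) [TopologicalSpace T] [CompactSpace T] :
    StarSubalgebra ℂ C(T × T, ℂ) where
  carrier := {κ | IsDegenerate κ}
  add_mem' := by
    rintro _ _ ⟨ι, _, f, g, rfl⟩ ⟨ι', _, f', g', rfl⟩
    exact ⟨ι ⊕ ι', inferInstance, Sum.elim f f', Sum.elim g g', by simp [degKer]⟩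
  mul_mem' := by
    rintro _ _ ⟨ι, _, f, g, rfl⟩ ⟨ι', _, f', g', rfl⟩
    refine ⟨ι × ι', inferInstance, fun q => f q.1 * f' q.2, fun q => g q.1 * g' q.2, ?_⟩
    simp only [degKer, Finset.sum_mul_sum, Fintype.sum_prod_type]
    refine Finset.sum_congr rfl fun i _ => Finset.sum_congr rfl fun k _ => ?_
    ext q
    simp only [ContinuousMap.mul_apply, tens_apply]
    ring
  algebraMap_mem' := fun c => ⟨Unit, inferInstance, fun _ => algebraMap ℂ _ c, fun _ => 1, by
    ext q; simp [degKer]⟩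
  star_mem' := by
    rintro _ ⟨ι, _, f, g, rfl⟩
    refine ⟨ι, inferInstance, fun i => star (f i), fun i => star (g i), ?_⟩
    simp only [degKer, star_sum]
    refine Finset.sum_congr rfl fun i _ => ?_
    ext q
    simp

/-- Stone–Weierstrass: degenerate kernels form a star subalgebra, and they separate points of T × T
because continuous functions separate points of the compact Hausdorff space T. -/
theorem exists_seq_degenerate [T2Space T] (κ : C(T × T, ℂ)) :
    ∃ κs : ℕ → C(T × T, ℂ), (∀ n, IsDegenerate (κs n)) ∧
      Filter.Tendsto κs Filter.atTop (nhds κ) := by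
  have h : (degenerateAlgebra T).topologicalClosure = ⊤ := by
    refine ContinuousMap.starSubalgebra_topologicalClosure_eq_top_of_separatesPoints _ ?_
    have sep : ∀ t s : T, t ≠ s → ∃ f : C(T, ℂ), f t ≠ f s := by
      intro t s hts
      obtain ⟨f, hf0, hf1, -⟩ := exists_continuous_zero_one_of_isClosed
        (isClosed_singleton (x := t)) (isClosed_singleton (x := s)) (by simpa using hts)
      refine ⟨⟨fun y => (f y : ℂ), by fun_prop⟩, ?_⟩
      have e0 : f t = 0 := hf0 rfl
      have e1 : f s = 1 := hf1 rfl
      simp [e0, e1]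
    rintro ⟨t, s⟩ ⟨t', s'⟩ hne
    by_cases ht : t = t'
    · have hs : s ≠ s' := fun hs => hne (by rw [ht, hs])
      obtain ⟨f, hf⟩ := sep s s' hs
      exact ⟨tens 1 f, ⟨tens 1 f, ⟨Unit, inferInstance, fun _ => 1, fun _ => f, by simp [degKer]⟩,
        rfl⟩, by simpa using hf⟩
    · obtain ⟨f, hf⟩ := sep t t' ht
      exact ⟨tens f 1, ⟨tens f 1, ⟨Unit, inferInstance, fun _ => f, fun _ => 1, by simp [degKer]⟩,
        rfl⟩, by simpa using hf⟩
  have hκ : κ ∈ closure ((degenerateAlgebra T : Set C(T × T, ℂ))) := by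
    have : κ ∈ (degenerateAlgebra T).topologicalClosure := h ▸ StarSubalgebra.mem_top
    exact this
  obtain ⟨κs, h1, h2⟩ := mem_closure_iff_seq_limit.1 hκ
  exact ⟨κs, h1, h2⟩

theorem norm_tens_le (f g : C(T, ℂ)) : ‖tens f g‖ ≤ ‖f‖ * ‖g‖ := by
  rw [ContinuousMap.norm_le _ (by positivity)]
  intro q
  rw [tens_apply, norm_mul]
  gcongr
  · exact f.norm_coe_le_norm _
  · exact g.norm_coe_le_norm _

theorem norm_curry_le (κ : C(T × T, ℂ)) (t : T) : ‖κ.curry t‖ ≤ ‖κ‖ := by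
  rw [ContinuousMap.norm_le _ (norm_nonneg _)]
  exact fun s => κ.norm_coe_le_norm _

/-- The inverse of `1 + κ`. -/
def resolv (I : C(T, ℂ) →L[ℂ] ℂ) (κ : C(T × T, ℂ)) : C(T, ℂ) →L[ℂ] C(T, ℂ) :=
  Ring.inverse (1 + op I κ)

theorem IsDegenerate.inverse {I : C(T, ℂ) →L[ℂ] ℂ} {κ : C(T × T, ℂ)} (hκ : IsDegenerate κ)
    (h0 : fred I κ ≠ 0) : IsUnit (1 + op I κ) ∧
      ∀ f g, fred I (κ + tens f g) = fred I κ * (1 + I (g * resolv I κ f)) := by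
  classical
  obtain ⟨ι, _, f, g, rfl⟩ := hκ
  obtain ⟨G, h1, h2, h3⟩ := degKer_inverse I f g h0
  let U : (C(T, ℂ) →L[ℂ] C(T, ℂ))ˣ := ⟨1 + op I (degKer f g), G,
    ContinuousLinearMap.ext fun h => h1 h, ContinuousLinearMap.ext fun h => h2 h⟩
  have hU : resolv I (degKer f g) = G := Ring.inverse_unit U
  exact ⟨⟨U, rfl⟩, fun f' g' => by rw [h3, hU]⟩

theorem add_op_resolv {I : C(T, ℂ) →L[ℂ] ℂ} {κ : C(T × T, ℂ)} (h : IsUnit (1 + op I κ))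
    (f : C(T, ℂ)) : resolv I κ f + op I κ (resolv I κ f) = f :=
  congrArg (fun A : C(T, ℂ) →L[ℂ] C(T, ℂ) => A f) (Ring.mul_inverse_cancel _ h)

theorem eq_resolv {I : C(T, ℂ) →L[ℂ] ℂ} {κ : C(T × T, ℂ)} (h : IsUnit (1 + op I κ))
    {f y : C(T, ℂ)} (hy : y + op I κ y = f) : y = resolv I κ f := by
  rw [← hy]
  exact (congrArg (fun A : C(T, ℂ) →L[ℂ] C(T, ℂ) => A y) (Ring.inverse_mul_cancel _ h)).symm

-- Both assertions are finite-dimensional for degenerate kernels and pass to the limit, provided the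
-- resolvents of the approximating kernels stay bounded. The rank one formula for those kernels
-- supplies the bound.
set_option maxHeartbeats 800000 in
theorem fred_ne_zero [T2Space T] (I : C(T, ℂ) →L[ℂ] ℂ) (κ : C(T × T, ℂ)) (h0 : fred I κ ≠ 0) :
    IsUnit (1 + op I κ) ∧
      ∀ f g, fred I (κ + tens f g) = fred I κ * (1 + I (g * resolv I κ f)) := by
  obtain ⟨κs, hdeg, hlim⟩ := exists_seq_degenerate κ
  have hfl : Filter.Tendsto (fun n => fred I (κs n)) Filter.atTop (nhds (fred I κ)) :=
    ((continuous_fred I).tendsto κ).comp hlim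
  have hpos : 0 < ‖fred I κ‖ := norm_pos_iff.2 h0
  have hbig : ∀ᶠ n in Filter.atTop, ‖fred I κ‖ / 2 < ‖fred I (κs n)‖ :=
    hfl.norm.eventually (lt_mem_nhds (by linarith))
  set R := ‖κ‖ + 1 with hR
  have hR1 : 0 ≤ R := by positivity
  have hbd : ∀ᶠ n in Filter.atTop, ‖κs n‖ < R := hlim.norm.eventually (gt_mem_nhds (by linarith))
  obtain ⟨K, hK⟩ := exists_lipschitz_fred I (R + R) (by positivity)
  set B := 1 + |K| * R / (‖fred I κ‖ / 2) with hB
  have hB0 : 0 < B := by positivity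
  have hG : ∀ᶠ n in Filter.atTop, ‖resolv I (κs n)‖ ≤ B := by
    filter_upwards [hbig, hbd] with n hn hRn
    have hne : fred I (κs n) ≠ 0 := norm_pos_iff.1 (lt_trans (by linarith) hn)
    obtain ⟨hu, hr⟩ := (hdeg n).inverse hne
    refine ContinuousLinearMap.opNorm_le_of_unit_norm hB0.le fun f hf => ?_
    rw [ContinuousMap.norm_le _ hB0.le]
    intro t
    -- The perturbation f ⊗ κ_n(t, ·) is chosen so that its factor contains exactly the term that
    -- determines the resolvent at t. The change of the determinant is at most |K| R, and dividing
    -- by the determinant, kept away from zero, bounds that term uniformly in n and t.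
    have e : resolv I (κs n) f t = f t - I ((κs n).curry t * resolv I (κs n) f) := by
      have := congrArg (fun y : C(T, ℂ) => y t) (add_op_resolv hu f)
      simp only [ContinuousMap.add_apply, op_apply] at this
      rw [← this]; ring
    have ht : ‖tens f ((κs n).curry t)‖ ≤ R :=
      (norm_tens_le _ _).trans (by
        rw [hf, one_mul]; exact (norm_curry_le _ _).trans hRn.le)
    have hI : fred I (κs n) * I ((κs n).curry t * resolv I (κs n) f) =
        fred I (κs n + tens f ((κs n).curry t)) - fred I (κs n) := by
      rw [hr]; ring
    have hb := hK (κs n + tens f ((κs n).curry t)) (κs n)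
      ((norm_add_le _ _).trans (by linarith)) (by linarith)
    rw [← hI, add_sub_cancel_left, norm_mul] at hb
    have hb2 : ‖I ((κs n).curry t * resolv I (κs n) f)‖ ≤ |K| * R / (‖fred I κ‖ / 2) := by
      rw [le_div_iff₀ (by linarith)]
      have h1 : K * ‖tens f ((κs n).curry t)‖ ≤ |K| * R :=
        mul_le_mul (le_abs_self K) ht (norm_nonneg _) (abs_nonneg K)
      have h2 := mul_le_mul_of_nonneg_right hn.le
        (norm_nonneg (I ((κs n).curry t * resolv I (κs n) f)))
      linarith
    have hft : ‖f t‖ ≤ 1 := hf ▸ f.norm_coe_le_norm t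
    rw [e]
    exact (norm_sub_le _ _).trans (by rw [hB]; linarith)
  have hUlim : Filter.Tendsto (fun n => 1 + op I (κs n)) Filter.atTop (nhds (1 + op I κ)) :=
    (((op I).continuous.tendsto κ).comp hlim).const_add 1
  have hunit : IsUnit (1 + op I κ) := by
    have hclose : ∀ᶠ n in Filter.atTop, ‖(1 + op I κ) - (1 + op I (κs n))‖ < B⁻¹ := by
      have := (tendsto_iff_norm_sub_tendsto_zero.1 hUlim)
      filter_upwards [this.eventually (gt_mem_nhds (inv_pos.2 hB0))] with n hn
      rwa [norm_sub_rev]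
    obtain ⟨n, h1, h2, h3⟩ := (hG.and (hbig.and hclose)).exists
    have hne : fred I (κs n) ≠ 0 := norm_pos_iff.1 (lt_trans (by linarith) h2)
    exact isUnit_of_near_unit (A := C(T, ℂ) →L[ℂ] C(T, ℂ)) ((hdeg n).inverse hne).1 h1 h3
  refine ⟨hunit, fun f g => ?_⟩
  have hinvlim : Filter.Tendsto (fun n => resolv I (κs n)) Filter.atTop (nhds (resolv I κ)) :=
    (continuousAt_inverse_of_isUnit (A := C(T, ℂ) →L[ℂ] C(T, ℂ)) hunit).tendsto.comp hUlim
  have l1 : Filter.Tendsto (fun n => fred I (κs n + tens f g)) Filter.atTop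
      (nhds (fred I (κ + tens f g))) :=
    ((continuous_fred I).tendsto _).comp (hlim.add_const _)
  have l2 : Filter.Tendsto (fun n => fred I (κs n) * (1 + I (g * resolv I (κs n) f)))
      Filter.atTop (nhds (fred I κ * (1 + I (g * resolv I κ f)))) := by
    refine hfl.mul (Filter.Tendsto.const_add _ ?_)
    have hc : Continuous fun A : C(T, ℂ) →L[ℂ] C(T, ℂ) => I (g * A f) := by fun_prop
    exact (hc.tendsto _).comp hinvlim
  refine tendsto_nhds_unique_of_eventuallyEq l1 l2 ?_
  filter_upwards [hbig] with n hn
  have hne : fred I (κs n) ≠ 0 := norm_pos_iff.1 (lt_trans (by linarith) hn)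
  exact ((hdeg n).inverse hne).2 f g

/-- Along κ(x) + c f ⊗ g the determinant is exactly affine in c, by the rank one formula. The
distance from κ(y) to this line is o(y - x), and the Lipschitz bound carries it over to the
determinant. -/
theorem hasDerivAt_fred [T2Space T] (I : C(T, ℂ) →L[ℂ] ℂ) (κ : ℝ → C(T × T, ℂ)) (x : ℝ)
    (f g : C(T, ℂ)) (hκ : HasDerivAt κ (tens f g) x) (h0 : fred I (κ x) ≠ 0) :
    HasDerivAt (fun y => fred I (κ y)) (fred I (κ x) * I (g * resolv I (κ x) f)) x := by
  obtain ⟨K, hK⟩ := exists_lipschitz_fred I (‖κ x‖ + 1) (by positivity)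
  rw [hasDerivAt_iff_isLittleO] at hκ ⊢
  refine Asymptotics.IsBigO.trans_isLittleO ?_ hκ
  have hr := (fred_ne_zero I (κ x) h0).2
  have hlin : ∀ c : ℝ, fred I (κ x + c • tens f g) =
      fred I (κ x) + c • (fred I (κ x) * I (g * resolv I (κ x) f)) := by
    intro c
    have e : c • tens f g = tens ((c : ℂ) • f) g := by
      ext q; simp [mul_assoc]
    rw [e, hr, map_smul, mul_smul_comm, map_smul, smul_eq_mul, real_smul]; ring
  have hc : ContinuousAt κ x := by
    have : HasDerivAt κ (tens f g) x := hasDerivAt_iff_isLittleO.2 hκ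
    exact this.continuousAt
  refine Asymptotics.IsBigO.of_bound K ?_
  have e1 : ∀ᶠ y in nhds x, ‖κ y‖ < ‖κ x‖ + 1 :=
    hc.norm.eventually (gt_mem_nhds (by linarith))
  have e2 : ∀ᶠ y in nhds x, ‖κ x + (y - x) • tens f g‖ < ‖κ x‖ + 1 := by
    have : Continuous fun y : ℝ => ‖κ x + (y - x) • tens f g‖ := by fun_prop
    exact this.continuousAt.eventually (gt_mem_nhds (by simp))
  filter_upwards [e1, e2] with y h1 h2
  have := hK _ _ h1.le h2.le
  rw [hlin] at this
  rw [← sub_sub, ← sub_sub] at this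
  exact this

theorem fred_congr {I : C(T, ℂ) →L[ℂ] ℂ} {κ κ' : C(T × T, ℂ)}
    (h : ∀ (j : ℕ) (z : Fin j → T), (Matrix.of fun a b => κ (z a, z b)).det =
      (Matrix.of fun a b => κ' (z a, z b)).det) : fred I κ = fred I κ' := by
  unfold fred
  refine tsum_congr fun j => ?_
  congr 2
  ext z
  exact h j z

theorem fred_transpose (I : C(T, ℂ) →L[ℂ] ℂ) {κ κ' : C(T × T, ℂ)}
    (h : ∀ t s, κ' (t, s) = κ (s, t)) : fred I κ' = fred I κ :=
  fred_congr fun j z => by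
    rw [← Matrix.det_transpose]
    congr 1
    ext a b
    exact h _ _

theorem det_diag_conj {j : ℕ} (c : Fin j → ℂ) (hc : ∀ a, c a ≠ 0) (M M' : Matrix (Fin j) (Fin j) ℂ)
    (h : ∀ a b, M' a b * c b = c a * M a b) : M'.det = M.det := by
  have h1 := Matrix.det_mul_row c M'
  have h2 := Matrix.det_mul_column c M
  have h3 : (Matrix.of fun i j => c j * M' i j) = Matrix.of fun i j => c i * M i j := by
    ext a b; simp [← h a b, mul_comm]
  rw [h3, h2] at h1
  exact (mul_left_cancel₀ (Finset.prod_ne_zero_iff.2 fun a _ => hc a) h1).symm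

/-- Diagonal conjugation leaves each finite determinant unchanged; no continuity of `c` is needed.
It serves to bring two kernels into a form where they differ by rank one. -/
theorem fred_conj (I : C(T, ℂ) →L[ℂ] ℂ) {κ κ' : C(T × T, ℂ)} (c : T → ℂ) (hc : ∀ t, c t ≠ 0)
    (h : ∀ t s, κ' (t, s) * c s = c t * κ (t, s)) : fred I κ' = fred I κ :=
  fred_congr fun _ z => det_diag_conj (fun a => c (z a)) (fun _ => hc _) _ _ fun _ _ => h _ _

end Fredholm

/-! ### Resolvents of the Cauchy kernel and the step n → n + 1. -/

/-- A functional on `C(T)` with two spectral functions for which the Cauchy kernel is regular. -/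
structure CauchyData (T : Type*) [TopologicalSpace T] [CompactSpace T] where
  I : C(T, ℂ) →L[ℂ] ℂ
  a : C(T, ℂ)
  b : C(T, ℂ)
  add_ne : ∀ t s, a t + b s ≠ 0

namespace CauchyData

variable {T : Type*} [TopologicalSpace T] [CompactSpace T] (D : CauchyData T)

/-- The kernel `1 / (a(t) + b(s))`. -/
def cauchy : C(T × T, ℂ) :=
  ⟨fun q => (D.a q.1 + D.b q.2)⁻¹, by
    have := D.add_ne
    exact Continuous.inv₀ (by fun_prop) fun q => this _ _⟩

/-- The kernel `r(s) / (a(t) + b(s))`, as a function of `r`. -/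
def ker : C(T, ℂ) →L[ℂ] C(T × T, ℂ) :=
  LinearMap.mkContinuous
    { toFun := fun r => D.cauchy * r.comp ⟨Prod.snd, continuous_snd⟩
      map_add' := fun f g => by ext q; simp [mul_add]
      map_smul' := fun c f => by ext q; simp } ‖D.cauchy‖ fun f => by
    refine (norm_mul_le _ _).trans ?_
    gcongr
    rw [ContinuousMap.norm_le _ (norm_nonneg _)]
    exact fun q => f.norm_coe_le_norm _

theorem ker_apply (r : C(T, ℂ)) (q : T × T) : D.ker r q = (D.a q.1 + D.b q.2)⁻¹ * r q.2 := rfl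

/-- The operator with the Cauchy kernel. -/
def om : C(T, ℂ) →L[ℂ] C(T, ℂ) := op D.I D.cauchy

theorem op_ker (r f : C(T, ℂ)) : op D.I (D.ker r) f = D.om (r * f) := by
  ext t
  unfold om
  rw [op_apply, op_apply]
  congr 1
  ext s
  simp only [ContinuousMap.mul_apply, ContinuousMap.curry_apply, ker_apply]
  exact mul_assoc _ _ _

/-- The displacement identity a(t)/(a(t) + b(s)) = 1 - b(s)/(a(t) + b(s)): multiplication by a on
the left and by -b on the right differ by a rank one operator. All relations between resolvents
below rest on it. -/
theorem a_mul_om (f : C(T, ℂ)) : D.a * D.om f = D.I f • (1 : C(T, ℂ)) - D.om (D.b * f) := by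
  ext t
  have h : D.a t • (D.cauchy.curry t * f) = f - D.cauchy.curry t * (D.b * f) := by
    ext s
    have := D.add_ne t s
    simp only [ContinuousMap.smul_apply, ContinuousMap.mul_apply, ContinuousMap.sub_apply,
      ContinuousMap.curry_apply, cauchy, ContinuousMap.coe_mk, smul_eq_mul]
    field_simp
    ring
  have h2 := congrArg D.I h
  rw [map_smul, map_sub] at h2
  simpa [om, op_apply] using h2

/-- The Fredholm determinant of `1 + Ω r`. -/
def det (r : C(T, ℂ)) : ℂ := fred D.I (D.ker r)

/-- The inverse of `1 + Ω r`. -/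
def G (r : C(T, ℂ)) : C(T, ℂ) →L[ℂ] C(T, ℂ) := resolv D.I (D.ker r)

variable [T2Space T]

theorem isUnit {r : C(T, ℂ)} (h : D.det r ≠ 0) : IsUnit (1 + op D.I (D.ker r)) :=
  (fred_ne_zero _ _ h).1

theorem om_G {r : C(T, ℂ)} (h : D.det r ≠ 0) (f : C(T, ℂ)) :
    D.om (r * D.G r f) = f - D.G r f := by
  rw [← op_ker, eq_sub_iff_add_eq, add_comm]
  exact add_op_resolv (D.isUnit h) f

theorem eq_G {r : C(T, ℂ)} (h : D.det r ≠ 0) {y f : C(T, ℂ)} (hy : y + D.om (r * y) = f) :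
    D.G r f = y := by
  rw [← op_ker] at hy
  exact (eq_resolv (D.isUnit h) hy).symm

/-- The wave function `(1 + Ω r)⁻¹ 1`. -/
def w (r : C(T, ℂ)) : C(T, ℂ) := D.G r 1

/-- The potential. -/
def u (r : C(T, ℂ)) : ℂ := D.I (r * D.w r)

/-- The hypothesis on r and r' is the law of the step n → n + 1. It turns Ω(r a g) into -Ω(b r' g),
which the displacement identity evaluates, so the right-hand side solves the equation that
characterizes the left-hand side. -/
theorem G_a_mul {r r' : C(T, ℂ)} (h : D.det r ≠ 0) (h' : D.det r' ≠ 0)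
    (hr : r' * D.b = -(D.a * r)) (f : C(T, ℂ)) :
    D.G r (D.a * f) = D.a * D.G r' f + D.I (r' * D.G r' f) • D.w r := by
  refine D.eq_G h ?_
  set g := D.G r' f
  have e1 : r * (D.a * g + D.I (r' * g) • D.w r) =
      -(D.b * (r' * g)) + D.I (r' * g) • (r * D.w r) := by
    rw [mul_add, mul_smul_comm]
    congr 1
    rw [show r * (D.a * g) = (D.a * r) * g by ring, ← neg_eq_iff_eq_neg.2 hr]; ring
  have e2 := D.a_mul_om (r' * g)
  have e3 : D.om (D.b * (r' * g)) = D.I (r' * g) • (1 : C(T, ℂ)) - D.a * (f - g) := by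
    rw [← D.om_G h' f, e2, sub_sub_cancel]
  rw [e1, map_add, map_smul, map_neg, e3, w, D.om_G h, smul_sub, mul_sub]
  abel

/-- Since 1/(a + b) - 1/b = -a/(b(a + b)), the kernel of r', conjugated by 1/a, is the kernel of r
minus the rank one kernel r(s)/b(s). -/
theorem det_shift {r r' : C(T, ℂ)} (h : D.det r ≠ 0) (ha : ∀ t, D.a t ≠ 0) (ib : C(T, ℂ))
    (hb : ∀ t, D.b t * ib t = 1) (hr : r' * D.b = -(D.a * r)) :
    D.det r' = D.det r * (1 - D.I (r * ib * D.w r)) := by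
  have h1 := (fred_ne_zero D.I (D.ker r) h).2 (-1) (r * ib)
  rw [map_neg, mul_neg, map_neg, ← sub_eq_add_neg] at h1
  refine Eq.trans ?_ h1
  refine fred_conj D.I (fun t => (D.a t)⁻¹) (fun t => inv_ne_zero (ha t)) fun t s => ?_
  have e := congrArg (fun f : C(T, ℂ) => f s) hr
  simp only [ContinuousMap.mul_apply, ContinuousMap.neg_apply] at e
  have hbs : D.b s ≠ 0 := left_ne_zero_of_mul_eq_one (hb s)
  have e' : r' s = -(D.a s * r s) / D.b s := by rw [eq_div_iff hbs, e]
  have e2 : ib s = (D.b s)⁻¹ := eq_inv_of_mul_eq_one_right (hb s)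
  have h3 := D.add_ne t s
  have h4 := ha t
  have h5 := ha s
  simp only [ContinuousMap.add_apply, ker_apply, tens_apply, ContinuousMap.mul_apply,
    ContinuousMap.neg_apply, ContinuousMap.one_apply, e', e2]
  field_simp
  ring

end CauchyData

/-! ### The shift in the lattice variable n₁. -/

/-- A regular lattice parameter. -/
structure CauchyData.Lattice {T : Type*} [TopologicalSpace T] [CompactSpace T] (D : CauchyData T)
    (p : ℂ) where
  ib : C(T, ℂ)
  ipa : C(T, ℂ)
  ipb : C(T, ℂ)
  ilam : C(T, ℂ)
  b_ib : ∀ t, D.b t * ib t = 1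
  ipa_eq : ∀ t, (p + D.a t) * ipa t = 1
  ipb_eq : ∀ t, (p - D.b t) * ipb t = 1
  ilam_eq : ∀ t, (p + D.a t) * ilam t = p - D.a t
  a_ne : ∀ t, D.a t ≠ 0
  pa_ne : ∀ t, p - D.a t ≠ 0

namespace CauchyData

variable {T : Type*} [TopologicalSpace T] [CompactSpace T] [T2Space T] {D : CauchyData T} {p : ℂ}
  (Λ : D.Lattice p)

/-- `rt` is the shift of `r` in the discrete variable. -/
def IsTilde (D : CauchyData T) (p : ℂ) (r rt : C(T, ℂ)) : Prop :=
  ∀ t, rt t * ((p - D.a t) * (p - D.b t)) = (p + D.a t) * (p + D.b t) * r t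

namespace Lattice

omit [T2Space T] in
theorem ilam_eq_ipa : Λ.ilam = (2 * p) • Λ.ipa - 1 := by
  ext t
  have h1 := Λ.ipa_eq t
  have h2 := Λ.ilam_eq t
  have h3 : p + D.a t ≠ 0 := left_ne_zero_of_mul_eq_one h1
  refine mul_left_cancel₀ h3 ?_
  simp only [ContinuousMap.sub_apply, ContinuousMap.smul_apply, ContinuousMap.one_apply,
    smul_eq_mul]
  rw [h2]; linear_combination (-2 * p) * h1

/-- `r (p - b)⁻¹` paired with the resolvent. -/
def s (r f : C(T, ℂ)) : ℂ := D.I (r * Λ.ipb * D.G r f)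

/-- Both q_n and e_{n+1,n} factor into `V` at n₁ and `Vs` at n₁ + 1 (`u_sub_u`, `V_mul_Vs`). -/
def V (r : C(T, ℂ)) : ℂ := 1 + Λ.s r 1

def g (rt : C(T, ℂ)) : C(T, ℂ) := D.G rt Λ.ipa

def Vs (rt : C(T, ℂ)) : ℂ := 1 - D.I (rt * Λ.g rt)

/-- By `det_shift` this is the ratio τ_{n+1}/τ_n. -/
def Y (r : C(T, ℂ)) : ℂ := 1 - D.I (r * Λ.ib * D.w r)

/-- The intertwining of the resolvents at neighbouring lattice points. -/
theorem G_tilde {r rt : C(T, ℂ)} (h : D.det r ≠ 0) (ht : D.det rt ≠ 0) (hr : D.IsTilde p r rt)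
    (f : C(T, ℂ)) :
    D.G rt (Λ.ilam * f) = Λ.ilam * D.G r f - (2 * p * Λ.s r f) • Λ.g rt := by
  -- With y = G_r f and z = r y/(p - b), the law of the tilde gives r̃ Λ⁻¹ y = (p + b) z and r y =
  -- (p - b) z, where Λ⁻¹ = (p - a)/(p + a). Multiplied by p + a, the claim is a combination of the
  -- resolvent equation of y and the displacement identity of z.
  have key : Λ.ilam * D.G r f + D.om (rt * (Λ.ilam * D.G r f)) =
      Λ.ilam * f + (2 * p * Λ.s r f) • Λ.ipa := by
    set y := D.G r f
    set z := r * Λ.ipb * y with hz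
    have e1 : rt * (Λ.ilam * y) = p • z + D.b * z := by
      ext t
      have h1 := hr t
      have h2 := Λ.ilam_eq t
      have h3 := Λ.ipb_eq t
      have h4 : p - D.b t ≠ 0 := left_ne_zero_of_mul_eq_one h3
      have h5 : p + D.a t ≠ 0 := left_ne_zero_of_mul_eq_one (Λ.ipa_eq t)
      have h6 := Λ.pa_ne t
      have e3 : rt t = (p + D.a t) * (p + D.b t) * r t / ((p - D.a t) * (p - D.b t)) := by
        rw [eq_div_iff (mul_ne_zero h6 h4), h1]
      have e2 : Λ.ilam t = (p - D.a t) / (p + D.a t) := by rw [eq_div_iff h5, ← h2, mul_comm]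
      have e4 : Λ.ipb t = (p - D.b t)⁻¹ := eq_inv_of_mul_eq_one_right h3
      simp only [hz, ContinuousMap.mul_apply, ContinuousMap.add_apply, ContinuousMap.smul_apply,
        smul_eq_mul, e2, e3, e4]
      field_simp
    have e2 : r * y = p • z - D.b * z := by
      ext t
      have h3 := Λ.ipb_eq t
      simp only [hz, ContinuousMap.mul_apply, ContinuousMap.sub_apply, ContinuousMap.smul_apply,
        smul_eq_mul]
      linear_combination (-(r t * y t)) * h3
    have e3 := D.om_G h f
    change D.om (r * y) = f - y at e3
    rw [e2, map_sub, map_smul] at e3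
    have e4 := D.a_mul_om z
    have hs : Λ.s r f = D.I z := rfl
    rw [e1, map_add, map_smul, hs]
    ext t
    have e3' := congrArg (fun f : C(T, ℂ) => f t) e3
    have e4' := congrArg (fun f : C(T, ℂ) => f t) e4
    have h1 := Λ.ipa_eq t
    have h2 := Λ.ilam_eq t
    have h5 : p + D.a t ≠ 0 := left_ne_zero_of_mul_eq_one h1
    refine mul_left_cancel₀ h5 ?_
    simp only [ContinuousMap.mul_apply, ContinuousMap.add_apply, ContinuousMap.smul_apply,
      ContinuousMap.sub_apply, ContinuousMap.one_apply, smul_eq_mul] at e3' e4' ⊢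
    linear_combination (-(2 * p * D.I z)) * h1 + (y t - f t) * h2 + (p - D.a t) * e3' +
      (2 * p) * e4'
  have := D.eq_G ht key
  rw [map_add, map_smul] at this
  rw [← this, g, add_sub_cancel_right]

/-- The case f = 1 of `G_tilde`, with Λ⁻¹ = 2p/(p + a) - 1. -/
theorem w_tilde {r rt : C(T, ℂ)} (h : D.det r ≠ 0) (ht : D.det rt ≠ 0) (hr : D.IsTilde p r rt) :
    D.w rt + Λ.ilam * D.w r = (2 * p * Λ.V r) • Λ.g rt := by
  have h1 := Λ.G_tilde h ht hr 1
  rw [mul_one, Λ.ilam_eq_ipa, map_sub, map_smul, ← Λ.ilam_eq_ipa] at h1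
  have h2 : D.w rt = (2 * p) • Λ.g rt - (Λ.ilam * D.w r - (2 * p * Λ.s r 1) • Λ.g rt) := by
    unfold w g at *
    rw [← h1]; abel
  rw [h2, V, mul_add, add_smul, mul_one]; abel

theorem G_a_tilde {r rt : C(T, ℂ)} (h : D.det r ≠ 0) (ht : D.det rt ≠ 0)
    (hr : D.IsTilde p r rt) :
    p • D.w rt - D.G rt D.a = Λ.ilam * (p • D.w r + D.G r D.a) -
      (2 * p * (p * Λ.s r 1 + Λ.s r D.a)) • Λ.g rt := by
  have h1 := Λ.G_tilde h ht hr (p • 1 + D.a)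
  have e : Λ.ilam * (p • 1 + D.a) = p • (1 : C(T, ℂ)) - D.a := by
    ext t
    have := Λ.ilam_eq t
    simp only [ContinuousMap.mul_apply, ContinuousMap.add_apply, ContinuousMap.smul_apply,
      ContinuousMap.sub_apply, ContinuousMap.one_apply, smul_eq_mul]
    linear_combination this
  have es : Λ.s r (p • 1 + D.a) = p * Λ.s r 1 + Λ.s r D.a := by
    unfold s
    rw [map_add, map_smul, mul_add, mul_smul_comm, map_add, map_smul, smul_eq_mul]
  rw [e, es, map_sub, map_smul, map_add, map_smul] at h1
  exact h1

omit [T2Space T] in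
/-- `rt Λ⁻¹ = r (p + b) / (p - b)` under the functional. -/
theorem I_tilde {r rt : C(T, ℂ)} (hr : D.IsTilde p r rt) (h c y : C(T, ℂ))
    (hc : ∀ t, c t = h t * (p + D.b t) * Λ.ipb t) :
    D.I (rt * h * (Λ.ilam * y)) = D.I (r * c * y) := by
  congr 1
  ext t
  have h1 := hr t
  have h2 := Λ.ilam_eq t
  have h3 := Λ.ipb_eq t
  have h4 : p - D.b t ≠ 0 := left_ne_zero_of_mul_eq_one h3
  have h5 : p + D.a t ≠ 0 := left_ne_zero_of_mul_eq_one (Λ.ipa_eq t)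
  have h6 := Λ.pa_ne t
  have e3 : rt t = (p + D.a t) * (p + D.b t) * r t / ((p - D.a t) * (p - D.b t)) := by
    rw [eq_div_iff (mul_ne_zero h6 h4), h1]
  have e2 : Λ.ilam t = (p - D.a t) / (p + D.a t) := by rw [eq_div_iff h5, ← h2, mul_comm]
  have e4 : Λ.ipb t = (p - D.b t)⁻¹ := eq_inv_of_mul_eq_one_right h3
  simp only [ContinuousMap.mul_apply, hc, e2, e3, e4]
  field_simp

/-- Pair `w_tilde` with r̃. The term r̃ Λ⁻¹ w equals r w (p + b)/(p - b) = r w (2p/(p - b) - 1),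
which brings in the pairing inside `V` and the unshifted potential. -/
theorem u_sub_u {r rt : C(T, ℂ)} (h : D.det r ≠ 0) (ht : D.det rt ≠ 0)
    (hr : D.IsTilde p r rt) : 2 * p + D.u r - D.u rt = 2 * p * Λ.V r * Λ.Vs rt := by
  have e1 : D.w rt = (2 * p * Λ.V r) • Λ.g rt - Λ.ilam * D.w r :=
    eq_sub_of_add_eq (Λ.w_tilde h ht hr)
  have e2 := Λ.I_tilde hr 1 ((2 * p) • Λ.ipb - 1) (D.w r) (fun t => by
    have := Λ.ipb_eq t
    simp only [ContinuousMap.smul_apply, ContinuousMap.sub_apply, ContinuousMap.one_apply,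
      smul_eq_mul]
    linear_combination this)
  have e3 : r * ((2 * p) • Λ.ipb - 1) * D.w r = (2 * p) • (r * Λ.ipb * D.w r) - r * D.w r := by
    rw [mul_sub, mul_one, sub_mul, mul_smul_comm, smul_mul_assoc]
  have e4 : D.u rt = 2 * p * Λ.V r * D.I (rt * Λ.g rt) - (2 * p * Λ.s r 1 - D.u r) := by
    rw [u, e1, mul_sub, map_sub, mul_smul_comm, map_smul, smul_eq_mul]
    congr 1
    rw [mul_one] at e2
    rw [e2, e3, map_sub, map_smul]; rfl
  rw [e4, Vs, V]; ring

/-- `G_a_mul` at f = 1/(p + a), where a/(p + a) = 1 - p/(p + a), paired with r/b. -/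
theorem Y_mul_Vs {r r' : C(T, ℂ)} (h : D.det r ≠ 0) (h' : D.det r' ≠ 0)
    (hr : r' * D.b = -(D.a * r)) :
    Λ.Y r * Λ.Vs r' = 1 - p * D.I (r * Λ.ib * Λ.g r) := by
  have e1 := D.G_a_mul h h' hr Λ.ipa
  have e2 : D.a * Λ.ipa = 1 - p • Λ.ipa := by
    ext t
    have := Λ.ipa_eq t
    simp only [ContinuousMap.mul_apply, ContinuousMap.smul_apply, ContinuousMap.sub_apply,
      ContinuousMap.one_apply, smul_eq_mul]
    linear_combination this
  have e3 : r * Λ.ib * (D.a * Λ.g r') = -(r' * Λ.g r') := by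
    ext t
    have h1 := congrArg (fun f : C(T, ℂ) => f t) hr
    have h2 := Λ.b_ib t
    simp only [ContinuousMap.mul_apply, ContinuousMap.neg_apply] at h1 ⊢
    linear_combination (Λ.g r' t * Λ.ib t) * h1 - (r' t * Λ.g r' t) * h2
  rw [e2, map_sub, map_smul] at e1
  have e4 := congrArg (fun f => D.I (r * Λ.ib * f)) e1
  change D.I (r * Λ.ib * (D.w r - p • Λ.g r)) =
    D.I (r * Λ.ib * (D.a * Λ.g r' + D.I (r' * Λ.g r') • D.w r)) at e4
  rw [mul_sub, mul_add, e3, map_sub, map_add, map_neg, mul_smul_comm, map_smul, mul_smul_comm,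
    map_smul, smul_eq_mul, smul_eq_mul] at e4
  rw [Y, Vs]
  linear_combination (-1 : ℂ) * e4

/-- Pair `w_tilde` with r̃/b and use (p + b)/(b(p - b)) = 1/b + 2/(p - b). Divided by Ỹ, the
identity factorizes 1 + Y/Ỹ, which is e_{n+1,n}. -/
theorem V_mul_Vs {r rt rt' : C(T, ℂ)} (h : D.det r ≠ 0) (ht : D.det rt ≠ 0)
    (ht' : D.det rt' ≠ 0) (hr : D.IsTilde p r rt) (hrt : rt' * D.b = -(D.a * rt)) :
    2 * Λ.V r * Λ.Vs rt' * Λ.Y rt = Λ.Y r + Λ.Y rt := by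
  have e1 : D.w rt = (2 * p * Λ.V r) • Λ.g rt - Λ.ilam * D.w r :=
    eq_sub_of_add_eq (Λ.w_tilde h ht hr)
  have e2 := Λ.I_tilde hr Λ.ib (Λ.ib + (2 : ℂ) • Λ.ipb) (D.w r) (fun t => by
    have h1 := Λ.ipb_eq t
    have h2 := Λ.b_ib t
    simp only [ContinuousMap.smul_apply, ContinuousMap.add_apply, smul_eq_mul]
    linear_combination (-(Λ.ib t)) * h1 + (-(2 * Λ.ipb t)) * h2)
  have e3 : r * (Λ.ib + (2 : ℂ) • Λ.ipb) * D.w r =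
      r * Λ.ib * D.w r + (2 : ℂ) • (r * Λ.ipb * D.w r) := by
    rw [mul_add, add_mul, mul_smul_comm, smul_mul_assoc]
  have e4 : D.I (rt * Λ.ib * D.w rt) = 2 * p * Λ.V r * D.I (rt * Λ.ib * Λ.g rt) -
      (D.I (r * Λ.ib * D.w r) + 2 * Λ.s r 1) := by
    rw [e1, mul_sub, map_sub, mul_smul_comm, map_smul, smul_eq_mul, e2, e3, map_add, map_smul]
    rfl
  have e5 := Λ.Y_mul_Vs ht ht' hrt
  have e6 : Λ.Y rt = 1 - D.I (rt * Λ.ib * D.w rt) := rfl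
  have e7 : Λ.Y r = 1 - D.I (r * Λ.ib * D.w r) := rfl
  have e8 : Λ.V r = 1 + Λ.s r 1 := rfl
  linear_combination (2 * Λ.V r) * e5 - e6 - e7 + e4 + 2 * e8

theorem G_a {r r' : C(T, ℂ)} (h : D.det r ≠ 0) (h' : D.det r' ≠ 0)
    (hr : r' * D.b = -(D.a * r)) : D.G r D.a = D.a * D.w r' + D.u r' • D.w r := by
  have := D.G_a_mul h h' hr 1
  rwa [mul_one] at this

theorem s_a {r r' : C(T, ℂ)} (h : D.det r ≠ 0) (h' : D.det r' ≠ 0)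
    (hr : r' * D.b = -(D.a * r)) :
    p * Λ.s r 1 + Λ.s r D.a = (D.u r' + p) * Λ.V r - p * Λ.V r' := by
  have e1 : r * Λ.ipb * (D.a * D.w r') = r' * D.w r' - p • (r' * Λ.ipb * D.w r') := by
    ext t
    have h1 := congrArg (fun f : C(T, ℂ) => f t) hr
    have h2 := Λ.ipb_eq t
    simp only [ContinuousMap.mul_apply, ContinuousMap.neg_apply, ContinuousMap.sub_apply,
      ContinuousMap.smul_apply, smul_eq_mul] at h1 ⊢
    linear_combination (D.w r' t * Λ.ipb t) * h1 + (r' t * D.w r' t) * h2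
  have e2 : Λ.s r D.a = D.u r' - p * Λ.s r' 1 + D.u r' * Λ.s r 1 := by
    rw [s, G_a h h' hr, mul_add, map_add, e1, map_sub, map_smul, mul_smul_comm, map_smul]
    rfl
  rw [e2, V, V]; ring

/-- The discrete part of the linear problem. -/
theorem discrete_lax {r r' rt rt' : C(T, ℂ)} (h : D.det r ≠ 0) (h' : D.det r' ≠ 0)
    (ht : D.det rt ≠ 0) (ht' : D.det rt' ≠ 0) (hr : r' * D.b = -(D.a * r))
    (hrt : rt' * D.b = -(D.a * rt)) (hT : D.IsTilde p r rt) (hV : Λ.V r ≠ 0) {c₁ c₂ : ℂ}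
    (h₂ : c₂ * Λ.V r = p * Λ.V r') (h₁ : c₁ + c₂ = 2 * p + D.u r' - D.u rt') :
    c₁ • D.w rt - D.a * D.w rt' = Λ.ilam * (c₂ • D.w r + D.a * D.w r') := by
  have e1 := Λ.G_a_tilde h ht hT
  have e2 := Λ.w_tilde h ht hT
  rw [G_a h h' hr, G_a ht ht' hrt, Λ.s_a h h' hr] at e1
  ext t
  have e1' := congrArg (fun f : C(T, ℂ) => f t) e1
  have e2' := congrArg (fun f : C(T, ℂ) => f t) e2
  simp only [ContinuousMap.mul_apply, ContinuousMap.add_apply, ContinuousMap.smul_apply,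
    ContinuousMap.sub_apply, smul_eq_mul] at e1' e2' ⊢
  -- `w_tilde` expresses g̃ through w̃ and Λ⁻¹ w at the price of dividing by V. The value of c₂ is
  -- the one for which the resulting coefficient is u' + p - c₂.
  have h3 : c₂ = p * Λ.V r' / Λ.V r := by rw [eq_div_iff hV, h₂]
  have h4 : c₁ = 2 * p + D.u r' - D.u rt' - c₂ := by rw [← h₁]; ring
  have e3 : Λ.g rt t * (2 * p) = (D.w rt t + Λ.ilam t * D.w r t) / Λ.V r := by
    rw [eq_div_iff hV, e2']; ring
  have e4 : 2 * p * ((D.u r' + p) * Λ.V r - p * Λ.V r') * Λ.g rt t =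
      ((D.u r' + p) * Λ.V r - p * Λ.V r') / Λ.V r * (D.w rt t + Λ.ilam t * D.w r t) := by
    rw [div_mul_eq_mul_div, mul_div_assoc, ← e3]; ring
  rw [e4] at e1'
  have e5 : ((D.u r' + p) * Λ.V r - p * Λ.V r') / Λ.V r = D.u r' + p - c₂ := by
    rw [h3]; field_simp
  rw [e5] at e1'
  rw [h4]
  linear_combination e1'

end Lattice
end CauchyData

/-! ### Derivatives in the continuous variable. -/

/-- `t ↦ exp(c(t) y) f(t)`. -/
def expMul {X : Type*} [TopologicalSpace X] (c f : C(X, ℂ)) (y : ℝ) : C(X, ℂ) :=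
  ⟨fun t => exp (c t * y) * f t, by fun_prop⟩

/-- exp(y c) is an exponential in the Banach algebra C(X), so the derivative exists in sup norm and
can be pushed through functionals and operators. -/
theorem hasDerivAt_expMul {X : Type*} [TopologicalSpace X] [CompactSpace X] (c f : C(X, ℂ))
    (y : ℝ) : HasDerivAt (expMul c f) (c * expMul c f y) y := by
  have h := (hasDerivAt_exp_smul_const (𝕂 := ℝ) c y).mul_const f
  have e : ∀ z : ℝ, expMul c f z = NormedSpace.exp (z • c) * f := by
    intro z
    ext t
    have := NormedSpace.map_exp (ContinuousMap.evalAlgHom ℂ ℂ t)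
      (ContinuousMap.evalCLM ℂ t).continuous (z • c)
    have h2 : (NormedSpace.exp (z • c)) t = exp (c t * z) := by
      refine this.trans ?_
      rw [← Complex.exp_eq_exp_ℂ]
      congr 1
      simp [mul_comm]
    simp only [expMul, ContinuousMap.coe_mk, ContinuousMap.mul_apply, h2]
  rw [show expMul c f = fun z => NormedSpace.exp (z • c) * f from funext e]
  refine h.congr_deriv ?_
  ring

theorem hasDerivAt_clm_comp {E F : Type*} [NormedAddCommGroup E] [NormedSpace ℂ E]
    [NormedAddCommGroup F] [NormedSpace ℂ F] (L : E →L[ℂ] F) {f : ℝ → E} {f' : E} {x : ℝ}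
    (hf : HasDerivAt f f' x) : HasDerivAt (fun y => L (f y)) (L f') x :=
  (L.restrictScalars ℝ).hasFDerivAt.comp_hasDerivAt x hf

theorem hasDerivAt_inverse {A : Type*} [NormedRing A] [NormedAlgebra ℝ A] [CompleteSpace A]
    {f : ℝ → A} {f' : A} {x : ℝ} (hf : HasDerivAt f f' x) (h : IsUnit (f x)) :
    HasDerivAt (fun y => Ring.inverse (f y))
      (-(Ring.inverse (f x) * f' * Ring.inverse (f x))) x := by
  obtain ⟨U, hU⟩ := h
  have h1 := hasFDerivAt_ringInverse (𝕜 := ℝ) U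
  rw [hU] at h1
  have h2 := h1.comp_hasDerivAt x hf
  rw [← hU, Ring.inverse_unit]
  refine h2.congr_deriv ?_
  simp

namespace CauchyData

variable {T : Type*} [TopologicalSpace T] [CompactSpace T] [T2Space T] {D : CauchyData T}

/-- The derivative of the inverse is -G Ω((a + b) r G f). The displacement identity rewrites the
b-part, leaving a resolvent term at a f, multiplication by a, and a rank one term along w. -/
theorem hasDerivAt_G {r : ℝ → C(T, ℂ)} {x : ℝ} (hr : HasDerivAt r ((D.a + D.b) * r x) x)
    (h : D.det (r x) ≠ 0) (f : C(T, ℂ)) :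
    HasDerivAt (fun y => D.G (r y) f)
      (D.G (r x) (D.a * f) - D.a * D.G (r x) f - D.I (r x * D.G (r x) f) • D.w (r x)) x := by
  have hU : HasDerivAt (fun y => 1 + op D.I (D.ker (r y)))
      (op D.I (D.ker ((D.a + D.b) * r x))) x := by
    have := hasDerivAt_clm_comp (F := C(T, ℂ) →L[ℂ] C(T, ℂ)) (op D.I ∘L D.ker) hr
    exact this.const_add (1 : C(T, ℂ) →L[ℂ] C(T, ℂ))
  have hinv : HasDerivAt (fun y => D.G (r y))
      (-(D.G (r x) * op D.I (D.ker ((D.a + D.b) * r x)) * D.G (r x))) x :=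
    hasDerivAt_inverse (A := C(T, ℂ) →L[ℂ] C(T, ℂ)) hU (D.isUnit h)
  have hf : HasDerivAt (fun y => D.G (r y) f)
      ((-(D.G (r x) * op D.I (D.ker ((D.a + D.b) * r x)) * D.G (r x))) f) x :=
    hasDerivAt_clm_comp (E := C(T, ℂ) →L[ℂ] C(T, ℂ))
      (ContinuousLinearMap.apply ℂ C(T, ℂ) f) hinv
  refine hf.congr_deriv ?_
  symm
  set y := D.G (r x) f with hy
  have e1 : D.om ((D.a + D.b) * r x * y) =
      D.om (r x * (D.a * y)) + D.I (r x * y) • (1 : C(T, ℂ)) - D.a * (f - y) := by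
    have e2 := D.a_mul_om (r x * y)
    rw [D.om_G h f] at e2
    rw [e2, show (D.a + D.b) * r x * y = r x * (D.a * y) + D.b * (r x * y) by ring, map_add]
    abel
  have e3 : D.a * y = D.G (r x) (D.a * y + D.om (r x * (D.a * y))) := (D.eq_G h rfl).symm
  have e4 : (-(D.G (r x) * op D.I (D.ker ((D.a + D.b) * r x)) * D.G (r x))) f =
      -D.G (r x) (D.om ((D.a + D.b) * r x * y)) := by
    rw [← op_ker]; rfl
  rw [e4, e1, map_sub, map_add, map_smul]
  rw [map_add] at e3
  rw [mul_sub, map_sub, w]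
  nth_rewrite 1 [e3]
  abel

/-- `∬ dζ ρ k' σ φ`. -/
def flux (D : CauchyData T) (r : C(T, ℂ)) : ℂ := D.I (r * D.b * D.w r)

theorem hasDerivAt_pair {r : ℝ → C(T, ℂ)} {x : ℝ} (hr : HasDerivAt r ((D.a + D.b) * r x) x)
    (h : D.det (r x) ≠ 0) (c f : C(T, ℂ)) :
    HasDerivAt (fun y => D.I (r y * c * D.G (r y) f))
      (D.I (r x * (c * D.b) * D.G (r x) f) + D.I (r x * c * D.G (r x) (D.a * f)) -
        D.I (r x * D.G (r x) f) * D.I (r x * c * D.w (r x))) x := by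
  have h1 := (hr.mul_const c).mul (hasDerivAt_G hr h f)
  refine (hasDerivAt_clm_comp D.I h1).congr_deriv ?_
  rw [← smul_eq_mul (D.I _) (D.I _), ← map_smul, ← map_add, ← map_sub]
  congr 1
  rw [mul_sub, mul_sub, mul_smul_comm]
  ring

/-- The part that is not polynomial in the potentials is a difference of fluxes at neighbouring n,
so it cancels in a sum over a period. -/
theorem hasDerivAt_u {r r' : ℝ → C(T, ℂ)} {x : ℝ} (hr : HasDerivAt r ((D.a + D.b) * r x) x)
    (h : D.det (r x) ≠ 0) (h' : D.det (r' x) ≠ 0) (hs : r' x * D.b = -(D.a * r x)) :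
    HasDerivAt (fun y => D.u (r y)) (D.flux (r x) - D.flux (r' x) +
      (D.u (r' x) - D.u (r x)) * D.u (r x)) x := by
  have h1 := hasDerivAt_pair hr h 1 1
  simp only [mul_one, one_mul] at h1
  refine h1.congr_deriv ?_
  have e1 := D.G_a_mul h h' hs 1
  simp only [mul_one] at e1
  have e2 : r x * (D.a * D.G (r' x) 1) = -(r' x * D.b * D.w (r' x)) := by
    rw [hs, w]; ring
  rw [e1, mul_add, e2, map_add, map_neg, mul_smul_comm, map_smul, smul_eq_mul]
  simp only [flux, u, w]
  ring

namespace Lattice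

variable {p : ℂ} (Λ : D.Lattice p)

/-- The equation closes on V at n and n + 1: b/(p - b) = p/(p - b) - 1 handles the derivative of r,
and `s_a` the derivative of the resolvent. -/
theorem hasDerivAt_V {r r' : ℝ → C(T, ℂ)} {x : ℝ} (hr : HasDerivAt r ((D.a + D.b) * r x) x)
    (h : D.det (r x) ≠ 0) (h' : D.det (r' x) ≠ 0) (hs : r' x * D.b = -(D.a * r x)) :
    HasDerivAt (fun y => Λ.V (r y))
      ((D.u (r' x) - D.u (r x) + p) * Λ.V (r x) - p * Λ.V (r' x)) x := by
  have h1 := (hasDerivAt_pair hr h Λ.ipb 1).const_add 1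
  refine h1.congr_deriv ?_
  have e1 := Λ.s_a h h' hs
  have e2 : Λ.ipb * D.b = p • Λ.ipb - 1 := by
    ext t
    have := Λ.ipb_eq t
    simp only [ContinuousMap.mul_apply, ContinuousMap.smul_apply, ContinuousMap.sub_apply,
      ContinuousMap.one_apply, smul_eq_mul]
    linear_combination (-1 : ℂ) * this
  have e3 : D.I (r x * (Λ.ipb * D.b) * D.G (r x) 1) = p * Λ.s (r x) 1 - D.u (r x) := by
    rw [e2, mul_sub, mul_one, sub_mul, mul_smul_comm, smul_mul_assoc, map_sub, map_smul]; rfl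
  rw [e3, mul_one]
  change p * Λ.s (r x) 1 - D.u (r x) + Λ.s (r x) D.a - D.u (r x) * Λ.s (r x) 1 = _
  have e4 : Λ.V (r x) = 1 + Λ.s (r x) 1 := rfl
  linear_combination e1 + D.u (r x) * e4

theorem hasDerivAt_Vs {r r' : ℝ → C(T, ℂ)} {x : ℝ}
    (hr : HasDerivAt r' ((D.a + D.b) * r' x) x)
    (h : D.det (r x) ≠ 0) (h' : D.det (r' x) ≠ 0) (hs : r' x * D.b = -(D.a * r x)) :
    HasDerivAt (fun y => Λ.Vs (r' y))
      ((D.u (r x) - D.u (r' x) - p) * Λ.Vs (r' x) + p * Λ.Vs (r x)) x := by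
  have h1 := (hasDerivAt_pair hr h' 1 Λ.ipa).const_sub 1
  simp only [mul_one, one_mul] at h1
  refine h1.congr_deriv ?_
  have e2 : D.a * Λ.ipa = 1 - p • Λ.ipa := by
    ext t
    have := Λ.ipa_eq t
    simp only [ContinuousMap.mul_apply, ContinuousMap.smul_apply, ContinuousMap.sub_apply,
      ContinuousMap.one_apply, smul_eq_mul]
    linear_combination this
  have e3 : ∀ r, D.det r ≠ 0 → D.I (r * D.G r (D.a * Λ.ipa)) = D.u r - p * D.I (r * Λ.g r) := by
    intro r _
    rw [e2, map_sub, map_smul, mul_sub, map_sub, mul_smul_comm, map_smul]; rfl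
  have e4 : D.I (r' x * D.b * D.G (r' x) Λ.ipa) =
      -(D.u (r x) - p * D.I (r x * Λ.g (r x))) + D.I (r' x * Λ.g (r' x)) * D.u (r x) := by
    rw [← e3 _ h, D.G_a_mul h h' hs, hs, mul_add, map_add, mul_smul_comm, map_smul,
      show -(D.a * r x) * D.G (r' x) Λ.ipa = -(r x * (D.a * D.G (r' x) Λ.ipa)) by ring, map_neg]
    change _ = -(_ + D.I (r' x * Λ.g (r' x)) * D.u (r x)) + D.I (r' x * Λ.g (r' x)) * D.u (r x)
    ring
  rw [e4, e3 _ h']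
  change -(_ + _ - D.I (r' x * Λ.g (r' x)) * D.u (r' x)) = _
  rw [Vs, Vs]
  ring

end Lattice

/-- Conjugation by exp(a(t) y) makes the kernel exp((a(t) + b(s)) y) r₀(s)/(a(t) + b(s)).
Differentiation cancels the denominator, so the derivative is of rank one and `hasDerivAt_fred`
applies. -/
theorem hasDerivAt_det {r₀ : C(T, ℂ)} {x : ℝ} (h : D.det (expMul (D.a + D.b) r₀ x) ≠ 0) :
    HasDerivAt (fun y => D.det (expMul (D.a + D.b) r₀ y))
      (D.det (expMul (D.a + D.b) r₀ x) * D.u (expMul (D.a + D.b) r₀ x)) x := by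
  set c : C(T × T, ℂ) := ⟨fun q => D.a q.1 + D.b q.2, by fun_prop⟩ with hc
  set κ : ℝ → C(T × T, ℂ) := expMul c (D.ker r₀) with hκ
  have hdet : ∀ y, fred D.I (κ y) = D.det (expMul (D.a + D.b) r₀ y) := by
    intro y
    refine fred_conj D.I (fun t => exp (D.a t * y)) (fun t => exp_ne_zero _) fun t s => ?_
    simp only [hκ, hc, expMul, ker_apply, ContinuousMap.coe_mk, ContinuousMap.add_apply, add_mul,
      exp_add]
    ring
  set f : C(T, ℂ) := expMul D.a 1 x with hf
  set g : C(T, ℂ) := expMul D.b r₀ x with hg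
  have hder : HasDerivAt κ (tens f g) x := by
    convert hasDerivAt_expMul c (D.ker r₀) x using 1
    ext q
    have := D.add_ne q.1 q.2
    simp only [hc, hf, hg, expMul, ker_apply, ContinuousMap.coe_mk, tens_apply,
      ContinuousMap.mul_apply, ContinuousMap.one_apply, add_mul, exp_add]
    field_simp
  have h0 : fred D.I (κ x) ≠ 0 := by rwa [hdet]
  have hmain := hasDerivAt_fred D.I κ x f g hder h0
  have hres : resolv D.I (κ x) f = f * D.w (expMul (D.a + D.b) r₀ x) := by
    refine (eq_resolv (fred_ne_zero D.I _ h0).1 ?_).symm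
    set y := D.w (expMul (D.a + D.b) r₀ x) with hy
    have e1 : y + op D.I (D.ker (expMul (D.a + D.b) r₀ x)) y = 1 := by
      rw [op_ker, hy, w, D.om_G h]; abel
    have e2 : op D.I (κ x) (f * y) = f * op D.I (D.ker (expMul (D.a + D.b) r₀ x)) y := by
      ext t
      rw [ContinuousMap.mul_apply, op_apply, op_apply, ← smul_eq_mul (f t), ← map_smul]
      congr 1
      ext s
      simp only [hκ, hc, hf, expMul, ker_apply, ContinuousMap.coe_mk, ContinuousMap.smul_apply,
        ContinuousMap.mul_apply, ContinuousMap.one_apply, add_mul, exp_add,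
        ContinuousMap.curry_apply, ContinuousMap.add_apply, smul_eq_mul]
      ring
    rw [e2, ← mul_add, e1, mul_one]
  rw [hres] at hmain
  have e3 : g * (f * D.w (expMul (D.a + D.b) r₀ x)) =
      expMul (D.a + D.b) r₀ x * D.w (expMul (D.a + D.b) r₀ x) := by
    ext t
    simp only [hf, hg, expMul, ContinuousMap.coe_mk, ContinuousMap.mul_apply,
      ContinuousMap.one_apply, add_mul, exp_add, ContinuousMap.add_apply]
    ring
  rw [e3, hdet] at hmain
  simp only [hdet] at hmain
  exact hmain

end CauchyData

/-! ### The integration measures as functionals -/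

/-- The part of admissibility that concerns the measures alone. -/
structure Spectral.Regular (S : Spectral) (N : ℕ) : Prop where
  rad_pos : 0 < S.rad
  compact : ∀ ω ∈ primitiveRoots N ℂ, IsCompact (S.supp ω)
  carried : ∀ ω ∈ primitiveRoots N ℂ, S.mu ω (S.supp ω)ᶜ = 0
  integrable : ∀ ω ∈ primitiveRoots N ℂ, Integrable (S.dens ω) (S.mu ω)

theorem Kind.Admissible.regular {κ : Kind} {N : ℕ} {p : ℂ} {S : Spectral}
    (h : κ.Admissible N p S) : S.Regular N :=
  ⟨h.rad_pos, h.compact, h.carried, h.integrable⟩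

variable {N : ℕ} {S : Spectral}

theorem Spectral.base_compact (h : S.Regular N) : IsCompact (S.base N) := by
  have : S.base N = ⋃ ω ∈ primitiveRoots N ℂ, S.supp ω := by
    ext z; simp [Spectral.base]
  rw [this]
  exact (primitiveRoots N ℂ).isCompact_biUnion h.compact

theorem Spectral.discs_compact (h : S.Regular N) : IsCompact (S.discs N) := by
  have : S.discs N = ⋃ ω ∈ primitiveRoots N ℂ,
      (fun q : ℂ × ℂ => -(ω * q.1) + q.2) '' (S.supp ω ×ˢ Metric.closedBall 0 S.rad) := by
    ext z
    simp only [Spectral.discs, mem_ofPred_eq, mem_iUnion, mem_image, mem_prod, Prod.exists,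
      exists_prop]
    refine exists_congr fun ω => and_congr_right fun _ => ⟨?_, ?_⟩
    · rintro ⟨k, hk, hz⟩
      refine ⟨k, z + ω * k, ⟨hk, ?_⟩, by ring⟩
      rw [mem_closedBall_zero_iff]
      rwa [Metric.mem_closedBall, dist_eq_norm, sub_neg_eq_add] at hz
    · rintro ⟨k, y, ⟨hk, hy⟩, rfl⟩
      refine ⟨k, hk, ?_⟩
      rw [Metric.mem_closedBall, dist_eq_norm]
      rw [mem_closedBall_zero_iff] at hy
      simpa using hy
  rw [this]
  exact (primitiveRoots N ℂ).isCompact_biUnion fun ω hω =>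
    ((h.compact ω hω).prod (isCompact_closedBall _ _)).image (by fun_prop)

theorem Kind.left_compact (κ : Kind) (h : S.Regular N) : IsCompact (κ.left N S) := by
  cases κ
  · exact Spectral.base_compact h
  · exact (Spectral.base_compact h).union (Spectral.discs_compact h)
  · exact (Spectral.base_compact h).union (Spectral.discs_compact h)

theorem Kind.right_compact (κ : Kind) (h : S.Regular N) : IsCompact (κ.right N S) := by
  cases κ
  · exact Spectral.discs_compact h
  · exact (Spectral.base_compact h).union (Spectral.discs_compact h)
  · exact (Spectral.base_compact h).union (Spectral.discs_compact h)

theorem Kind.base_subset_left (κ : Kind) : S.base N ⊆ κ.left N S := by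
  cases κ
  · exact subset_rfl
  · exact subset_union_left
  · exact subset_union_left

theorem Kind.discs_subset_right (κ : Kind) : S.discs N ⊆ κ.right N S := by
  cases κ
  · exact subset_rfl
  · exact subset_union_right
  · exact subset_union_right

theorem lamInt_congr (h : S.Regular N) {ω : ℂ} (hω : ω ∈ primitiveRoots N ℂ) {f g : ℂ → ℂ}
    (hfg : ∀ k ∈ S.supp ω, f k = g k) : S.lamInt ω f = S.lamInt ω g := by
  refine integral_congr_ae ?_
  have : ∀ᵐ k ∂S.mu ω, k ∈ S.supp ω := h.carried ω hω
  filter_upwards [this] with k hk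
  rw [hfg k hk]

theorem zetaA_eq_average (h : S.Regular N) (F : ℂ → ℂ → ℂ) :
    zetaA N S F = ∑ ω ∈ primitiveRoots N ℂ,
      S.lamInt ω fun k => Real.circleAverage (F k) (-(ω * k)) S.rad := by
  refine Finset.sum_congr rfl fun ω _ => ?_
  congr 1
  funext k
  rw [Real.circleAverage_eq_circleIntegral h.rad_pos.ne', smul_eq_mul]
  congr 1
  refine congrArg (fun f => circleIntegral f (-(ω * k)) S.rad) ?_
  funext z
  rw [sub_neg_eq_add, smul_eq_mul, div_eq_inv_mul]

/-- The contour integral is an average over a circle, and the mean value property replaces it by the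
value at the centre. -/
theorem zetaA_of_differentiable (h : S.Regular N) {F : ℂ → ℂ → ℂ}
    (hF : ∀ k ∈ S.base N, ∀ k' ∈ S.discs N, DifferentiableAt ℂ (F k) k') :
    zetaA N S F = ∑ ω ∈ primitiveRoots N ℂ, S.lamInt ω fun k => F k (-(ω * k)) := by
  rw [zetaA_eq_average h]
  refine Finset.sum_congr rfl fun ω hω => lamInt_congr h hω fun k hk => ?_
  have hd : ∀ z ∈ Metric.closedBall (-(ω * k)) |S.rad|, DifferentiableAt ℂ (F k) z := by
    intro z hz
    rw [abs_of_pos h.rad_pos] at hz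
    exact hF k ⟨ω, hω, hk⟩ z ⟨ω, hω, k, hk, hz⟩
  exact circleAverage_of_differentiable_on_off_countable countable_empty
    (fun z hz => (hd z hz).continuousAt.continuousWithinAt)
    (fun z hz => hd z (Metric.ball_subset_closedBall hz.1))

/-- The functional `Z` is represented by `I` on continuous functions on `L × R`. -/
def Rep (Z : (ℂ → ℂ → ℂ) → ℂ) {L R : Set ℂ} [CompactSpace L] [CompactSpace R]
    (I : C(L × R, ℂ) →L[ℂ] ℂ) : Prop :=
  ∀ (F : ℂ → ℂ → ℂ) (f : C(L × R, ℂ)), (∀ t, f t = F t.1 t.2) → Z F = I f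

/-- Averages over the circles around the poles. -/
def averageL {L R : Set ℂ} [CompactSpace L] [CompactSpace R] {K : Set ℂ} [CompactSpace K]
    (pt : C(K × ℝ, L × R)) : C(L × R, ℂ) →L[ℂ] C(K, ℂ) :=
  LinearMap.mkContinuous
    { toFun := fun f => ⟨fun k : K => (2 * Real.pi)⁻¹ • ∫ θ in (0 : ℝ)..2 * Real.pi, f (pt (k, θ)), by
        refine Continuous.const_smul (M := ℝ) (α := ℂ) ?_ _
        exact intervalIntegral.continuous_parametric_intervalIntegral_of_continuous'
          (f := fun k θ => f (pt (k, θ))) (by unfold Function.uncurry; fun_prop) _ _⟩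
      map_add' := fun f g => by
        ext k
        have hc : ∀ f : C(L × R, ℂ), Continuous fun θ : ℝ => f (pt (k, θ)) := fun f => by fun_prop
        simp only [ContinuousMap.coe_mk, ContinuousMap.add_apply]
        rw [intervalIntegral.integral_add ((hc f).intervalIntegrable _ _)
          ((hc g).intervalIntegrable _ _), smul_add]
      map_smul' := fun c f => by
        ext k
        simp only [ContinuousMap.coe_mk, ContinuousMap.smul_apply, RingHom.id_apply]
        rw [intervalIntegral.integral_smul, smul_comm] } 1 fun f => by
    rw [one_mul, ContinuousMap.norm_le _ (norm_nonneg _)]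
    intro k
    have hpi : 0 < 2 * Real.pi := by positivity
    have := intervalIntegral.norm_integral_le_of_norm_le_const (a := (0 : ℝ)) (b := 2 * Real.pi)
      (f := fun θ => f (pt (k, θ))) (C := ‖f‖) fun θ _ => f.norm_coe_le_norm _
    rw [sub_zero, abs_of_pos hpi] at this
    change ‖(2 * Real.pi)⁻¹ • (_ : ℂ)‖ ≤ _
    rw [norm_smul, norm_inv, Real.norm_eq_abs, abs_of_pos hpi, inv_mul_le_iff₀ hpi]
    linarith

/-- Integration against a density over a compact set. -/
def densityL {K : Set ℂ} [CompactSpace K] (μ : Measure K) (d : K → ℂ)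
    (hd : Integrable d μ) : C(K, ℂ) →L[ℂ] ℂ :=
  have hint : ∀ f : C(K, ℂ), Integrable (fun k => f k * d k) μ := fun f =>
    hd.bdd_mul (c := ‖f‖) f.continuous.aestronglyMeasurable
      (Filter.Eventually.of_forall fun k => f.norm_coe_le_norm k)
  LinearMap.mkContinuous
    { toFun := fun f => ∫ k, f k * d k ∂μ
      map_add' := fun f g => by
        simp only [ContinuousMap.add_apply, add_mul]
        exact integral_add (hint f) (hint g)
      map_smul' := fun c f => by
        simp only [ContinuousMap.smul_apply, RingHom.id_apply, smul_eq_mul, mul_assoc]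
        exact integral_const_mul c _ } (∫ k, ‖d k‖ ∂μ) fun f => by
    change ‖∫ k, f k * d k ∂μ‖ ≤ _
    rw [mul_comm, ← integral_const_mul]
    refine norm_integral_le_of_norm_le (hd.norm.const_mul _)
      (Filter.Eventually.of_forall fun k => ?_)
    rw [norm_mul]
    gcongr
    exact f.norm_coe_le_norm k

/-- L and R may exceed the domain of the measure, which later allows spectral parameters to be
adjoined to them. -/
theorem exists_rep_zetaA (h : S.Regular N) (L R : Set ℂ) [CompactSpace L] [CompactSpace R]
    (hL : S.base N ⊆ L) (hR : S.discs N ⊆ R) :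
    ∃ I : C(L × R, ℂ) →L[ℂ] ℂ, Rep (zetaA N S) I := by
  have key : ∀ ω ∈ primitiveRoots N ℂ, ∃ I : C(L × R, ℂ) →L[ℂ] ℂ,
      Rep (fun F => S.lamInt ω fun k => Real.circleAverage (F k) (-(ω * k)) S.rad) I := by
    intro ω hω
    have hK := h.compact ω hω
    have : CompactSpace (S.supp ω) := isCompact_iff_compactSpace.1 hK
    have hms : MeasurableSet (S.supp ω) := hK.isClosed.measurableSet
    have hmem : ∀ (k : S.supp ω) (θ : ℝ), circleMap (-(ω * k)) S.rad θ ∈ R := fun k θ =>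
      hR ⟨ω, hω, k, k.2, Metric.sphere_subset_closedBall
        (circleMap_mem_sphere _ h.rad_pos.le _)⟩
    let pt : C(S.supp ω × ℝ, L × R) :=
      ⟨fun q => (⟨q.1, hL ⟨ω, hω, q.1.2⟩⟩, ⟨circleMap (-(ω * q.1)) S.rad q.2, hmem _ _⟩), by
        refine Continuous.prodMk (Continuous.subtype_mk (by fun_prop) _)
          (Continuous.subtype_mk ?_ _)
        unfold circleMap
        fun_prop⟩
    have hd : Integrable (fun k : S.supp ω => S.dens ω k)
        (Measure.comap Subtype.val (S.mu ω)) := by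
      have := (MeasurableEmbedding.subtype_coe hms).integrable_map_iff
        (μ := Measure.comap Subtype.val (S.mu ω)) (g := S.dens ω)
      rw [map_comap_subtype_coe hms] at this
      exact this.1 (h.integrable ω hω).integrableOn
    refine ⟨densityL _ _ hd ∘L averageL pt, fun F f hf => ?_⟩
    have e1 : S.lamInt ω (fun k => Real.circleAverage (F k) (-(ω * k)) S.rad) =
        ∫ k in S.supp ω, Real.circleAverage (F k) (-(ω * k)) S.rad * S.dens ω k ∂S.mu ω := by
      unfold Spectral.lamInt
      rw [Measure.restrict_eq_self_of_ae_mem (h.carried ω hω)]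
    change S.lamInt ω (fun k => Real.circleAverage (F k) (-(ω * k)) S.rad) = _
    rw [e1, ← integral_subtype_comap hms]
    change _ = ∫ k : S.supp ω, (averageL pt f) k * S.dens ω k ∂(Measure.comap Subtype.val (S.mu ω))
    refine integral_congr_ae (Filter.Eventually.of_forall fun k => ?_)
    change _ * _ = _ * _
    congr 1
    change _ = (2 * Real.pi)⁻¹ • ∫ θ in (0 : ℝ)..2 * Real.pi, f (pt (k, θ))
    rw [Real.circleAverage_def]
    congr 1
    refine intervalIntegral.integral_congr fun θ _ => ?_
    exact (hf (pt (k, θ))).symm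
  choose! I hI using key
  refine ⟨∑ ω ∈ primitiveRoots N ℂ, I ω, fun F f hf => ?_⟩
  rw [zetaA_eq_average h, sum_apply]
  exact Finset.sum_congr rfl fun ω hω => hI ω hω F f hf

theorem zetaB_eq (F : ℂ → ℂ → ℂ) : zetaB N S F =
    zetaA N S (fun k k' => k * F k k') - zetaA N S (fun k' k => k * F k k') := by
  unfold zetaB zetaA
  rw [Finset.sum_sub_distrib]

theorem zetaC_eq (F : ℂ → ℂ → ℂ) : zetaC N S F =
    zetaA N S F + zetaA N S (fun k' k => F k k') := by
  unfold zetaC zetaA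
  rw [Finset.sum_add_distrib]

/-- Composition with a fixed map. -/
def precompL {X Y : Type*} [TopologicalSpace X] [CompactSpace X] [TopologicalSpace Y]
    [CompactSpace Y] (g : C(X, Y)) : C(Y, ℂ) →L[ℂ] C(X, ℂ) :=
  LinearMap.mkContinuous
    { toFun := fun f => f.comp g
      map_add' := fun _ _ => rfl
      map_smul' := fun _ _ => rfl } 1 fun f => by
    rw [one_mul, ContinuousMap.norm_le _ (norm_nonneg _)]
    exact fun x => f.norm_coe_le_norm _

theorem exists_rep (κ : Kind) (h : S.Regular N) (L R : Set ℂ) [CompactSpace L] [CompactSpace R]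
    (hL : κ.left N S ⊆ L) (hR : κ.right N S ⊆ R) :
    ∃ I : C(L × R, ℂ) →L[ℂ] ℂ, Rep (κ.zeta N S) I := by
  obtain ⟨I, hI⟩ := exists_rep_zetaA h L R (κ.base_subset_left.trans hL)
    (κ.discs_subset_right.trans hR)
  let sw : C(L × R, ℂ) →L[ℂ] C(R × L, ℂ) :=
    precompL ⟨Prod.swap, continuous_swap⟩
  cases κ with
  | A => exact ⟨I, hI⟩
  | B =>
    obtain ⟨I', hI'⟩ := exists_rep_zetaA h R L
      (subset_union_left.trans hR) (subset_union_right.trans hL)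
    let m : C(L × R, ℂ) := ⟨fun q => q.1, by fun_prop⟩
    refine ⟨(I - I' ∘L sw) ∘L ContinuousLinearMap.mul ℂ _ m, fun F f hf => ?_⟩
    change zetaB N S F = _
    rw [zetaB_eq]
    exact congrArg₂ _ (hI _ _ fun t => by rw [← hf]; rfl)
      (hI' _ (sw (m * f)) fun t => by
        change _ = (t.2 : ℂ) * F (t.swap.1) (t.swap.2)
        rw [← hf]; rfl)
  | C =>
    obtain ⟨I', hI'⟩ := exists_rep_zetaA h R L
      (subset_union_left.trans hR) (subset_union_right.trans hL)
    refine ⟨I + I' ∘L sw, fun F f hf => ?_⟩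
    change zetaC N S F = _
    rw [zetaC_eq]
    exact congrArg₂ _ (hI _ _ hf)
      (hI' _ (sw f) fun t => by
        change _ = F (t.swap.1) (t.swap.2)
        rw [← hf]; rfl)

/-! ### Collapse of the contours -/

/-- `F` is holomorphic in each variable on `L × R`. -/
def SepDiff (L R : Set ℂ) (F : ℂ → ℂ → ℂ) : Prop :=
  ∀ k ∈ L, ∀ k' ∈ R, DifferentiableAt ℂ (fun z => F z k') k ∧ DifferentiableAt ℂ (F k) k'

theorem zetaB_of_sepDiff (h : S.Regular N) {F : ℂ → ℂ → ℂ}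
    (hF : SepDiff (Kind.B.left N S) (Kind.B.right N S) F) : zetaB N S F =
      (∑ ω ∈ primitiveRoots N ℂ, S.lamInt ω fun k => k * F k (-(ω * k))) -
      ∑ ω ∈ primitiveRoots N ℂ, S.lamInt ω fun k => -(ω * k) * F (-(ω * k)) k := by
  rw [zetaB_eq, zetaA_of_differentiable h (F := fun k k' => k * F k k') fun k hk k' hk' =>
      ((hF k (Or.inl hk) k' (Or.inr hk')).2).const_mul k,
    zetaA_of_differentiable h (F := fun k' k => k * F k k') fun k hk k' hk' =>
      (differentiableAt_id (𝕜 := ℂ)).mul (hF k' (Or.inr hk') k (Or.inl hk)).1]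

/-- On holomorphic functions the measure depends only on the values where `kᴺ = (-k')ᴺ`. -/
theorem zeta_congr_of_sepDiff (κ : Kind) (h : S.Regular N) {F G : ℂ → ℂ → ℂ}
    (hF : SepDiff (κ.left N S) (κ.right N S) F) (hG : SepDiff (κ.left N S) (κ.right N S) G)
    (hFG : ∀ k ∈ κ.left N S, ∀ k' ∈ κ.right N S, k ^ N = (-k') ^ N → F k k' = G k k') :
    κ.zeta N S F = κ.zeta N S G := by
  have hpow : ∀ ω ∈ primitiveRoots N ℂ, ∀ k : ℂ, (ω * k) ^ N = k ^ N := by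
    intro ω hω k
    have hN : 0 < N := by
      rcases Nat.eq_zero_or_pos N with rfl | hN
      · simp at hω
      · exact hN
    rw [mul_pow, (isPrimitiveRoot_of_mem_primitiveRoots hω).pow_eq_one, one_mul]
  have hdisc : ∀ ω ∈ primitiveRoots N ℂ, ∀ k ∈ S.supp ω, -(ω * k) ∈ S.discs N :=
    fun ω hω k hk => ⟨ω, hω, k, hk, Metric.mem_closedBall_self h.rad_pos.le⟩
  cases κ with
  | A =>
    change zetaA N S F = zetaA N S G
    rw [zetaA_of_differentiable h fun k hk k' hk' => (hF k hk k' hk').2,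
      zetaA_of_differentiable h fun k hk k' hk' => (hG k hk k' hk').2]
    refine Finset.sum_congr rfl fun ω hω => lamInt_congr h hω fun k hk => ?_
    exact hFG k ⟨ω, hω, hk⟩ _ (hdisc ω hω k hk) (by rw [neg_neg, hpow ω hω])
  | B =>
    change zetaB N S F = zetaB N S G
    rw [zetaB_of_sepDiff h hF, zetaB_of_sepDiff h hG]
    congr 1
    · refine Finset.sum_congr rfl fun ω hω => lamInt_congr h hω fun k hk => ?_
      rw [hFG k (Or.inl ⟨ω, hω, hk⟩) _ (Or.inr (hdisc ω hω k hk)) (by rw [neg_neg, hpow ω hω])]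
    · refine Finset.sum_congr rfl fun ω hω => lamInt_congr h hω fun k hk => ?_
      rw [hFG _ (Or.inr (hdisc ω hω k hk)) k (Or.inl ⟨ω, hω, hk⟩)
        (by rw [neg_pow, hpow ω hω, ← neg_pow])]
  | C =>
    have e : ∀ F, SepDiff (Kind.C.left N S) (Kind.C.right N S) F → zetaC N S F =
        (∑ ω ∈ primitiveRoots N ℂ, S.lamInt ω fun k => F k (-(ω * k))) +
        ∑ ω ∈ primitiveRoots N ℂ, S.lamInt ω fun k => F (-(ω * k)) k := by
      intro F hF
      rw [zetaC_eq, zetaA_of_differentiable h fun k hk k' hk' =>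
          (hF k (Or.inl hk) k' (Or.inr hk')).2,
        zetaA_of_differentiable h fun k hk k' hk' => (hF k' (Or.inr hk') k (Or.inl hk)).1]
    change zetaC N S F = zetaC N S G
    rw [e F hF, e G hG]
    congr 1
    · refine Finset.sum_congr rfl fun ω hω => lamInt_congr h hω fun k hk => ?_
      rw [hFG k (Or.inl ⟨ω, hω, hk⟩) _ (Or.inr (hdisc ω hω k hk)) (by rw [neg_neg, hpow ω hω])]
    · refine Finset.sum_congr rfl fun ω hω => lamInt_congr h hω fun k hk => ?_
      rw [hFG _ (Or.inr (hdisc ω hω k hk)) k (Or.inl ⟨ω, hω, hk⟩)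
        (by rw [neg_pow, hpow ω hω, ← neg_pow])]

/-- The symmetry of measure (C). -/
theorem zetaC_swap (F : ℂ → ℂ → ℂ) : zetaC N S F = zetaC N S fun k k' => F k' k := by
  rw [zetaC_eq, zetaC_eq, add_comm]

/-- The symmetry of measure (B). -/
theorem zetaB_swap (h : S.Regular N) {F : ℂ → ℂ → ℂ}
    (hF : SepDiff (Kind.B.left N S) (Kind.B.right N S) F)
    (h0 : ∀ k ∈ Kind.B.left N S, k ≠ 0) :
    zetaB N S F = zetaB N S fun k k' => F k' k * (-k' / k) := by
  have hL : ∀ ω ∈ primitiveRoots N ℂ, ∀ k ∈ S.supp ω, k ≠ 0 := fun ω hω k hk =>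
    h0 k (Or.inl ⟨ω, hω, hk⟩)
  have hL' : ∀ ω ∈ primitiveRoots N ℂ, ∀ k ∈ S.supp ω, ω * k ≠ 0 := fun ω hω k hk =>
    neg_ne_zero.1 (h0 _ (Or.inr ⟨ω, hω, k, hk, Metric.mem_closedBall_self h.rad_pos.le⟩))
  have hG : SepDiff (Kind.B.left N S) (Kind.B.right N S) fun k k' => F k' k * (-k' / k) := by
    intro k hk k' hk'
    exact ⟨(hF k' hk' k hk).2.mul ((differentiableAt_const (-k')).div
      (differentiableAt_id (𝕜 := ℂ)) (h0 k hk)), (hF k' hk' k hk).1.mul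
      ((differentiableAt_id (𝕜 := ℂ)).neg.div_const k)⟩
  -- At (k, -ωk) the weight -k'/k equals ω and at (-ωk, k) it equals 1/ω. It thus exchanges the
  -- factors k and ωk of the two halves, and their opposite signs match up.
  rw [zetaB_of_sepDiff h hF, zetaB_of_sepDiff h hG, ← neg_sub_neg]
  congr 1
  · rw [← Finset.sum_neg_distrib]
    refine Finset.sum_congr rfl fun ω hω => ?_
    unfold Spectral.lamInt
    rw [← integral_neg]
    simp only [← neg_mul]
    refine lamInt_congr h hω fun k hk => ?_
    have := hL ω hω k hk
    simp only [neg_neg]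
    field_simp
  · rw [← Finset.sum_neg_distrib]
    refine Finset.sum_congr rfl fun ω hω => ?_
    unfold Spectral.lamInt
    rw [← integral_neg]
    simp only [← neg_mul]
    refine lamInt_congr h hω fun k hk => ?_
    have := left_ne_zero_of_mul (hL' ω hω k hk)
    field_simp

/-! ### Iterated integrals of holomorphic functions -/

section Iterated

open Filter Topology

/-- Strict differentiability at (k, e x) holds locally uniformly in x, and compactness of X makes
the difference quotients converge in sup norm; hence continuous functionals of the family are
holomorphic in the parameter. Away from k the family has the default value 0, since analyticity is
only known to persist nearby. -/
theorem exists_differentiableAt_of_analyticAt {X E : Type*} [TopologicalSpace X] [CompactSpace X]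
    [NormedAddCommGroup E] [NormedSpace ℂ E] {F : ℂ × E → ℂ} {e : X → E} (he : Continuous e)
    {k : ℂ} (hF : ∀ x, AnalyticAt ℂ F (k, e x)) :
    ∃ f : ℂ → C(X, ℂ), DifferentiableAt ℂ f k ∧ ∀ᶠ z in 𝓝 k, ∀ x, f z x = F (z, e x) := by
  classical
  have hg : Continuous fun x => fderiv ℂ F (k, e x) (1, 0) := by
    refine continuous_iff_continuousAt.2 fun x => ?_
    have h1 : ContinuousAt (fun y => fderiv ℂ F (k, e y)) x :=
      ContinuousAt.comp (f := fun y => (k, e y)) (hF x).fderiv.continuousAt (by fun_prop)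
    exact h1.clm_apply continuousAt_const
  let g : C(X, ℂ) := ⟨_, hg⟩
  have hc : ∀ᶠ z in 𝓝 k, ∀ x, AnalyticAt ℂ F (z, e x) := by
    have := isCompact_univ.eventually_forall_of_forall_eventually (X := ℂ) (Y := X) (x₀ := k)
      (P := fun z x => AnalyticAt ℂ F (z, e x)) (K := univ) fun x _ => by
        have h1 : ContinuousAt (fun q : ℂ × X => (q.1, e q.2)) (k, x) := by fun_prop
        exact h1.eventually (hF x).eventually_analyticAt
    simpa using this
  have hcont : ∀ z, (∀ x, AnalyticAt ℂ F (z, e x)) → Continuous fun x => F (z, e x) := by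
    intro z hz
    refine continuous_iff_continuousAt.2 fun x => ?_
    exact ContinuousAt.comp (f := fun y => (z, e y)) (hz x).continuousAt (by fun_prop)
  let f : ℂ → C(X, ℂ) := fun z =>
    if h : ∀ x, AnalyticAt ℂ F (z, e x) then ⟨_, hcont z h⟩ else 0
  have hf : ∀ z, (∀ x, AnalyticAt ℂ F (z, e x)) → ∀ x, f z x = F (z, e x) := by
    intro z hz x
    simp only [f, dif_pos hz, ContinuousMap.coe_mk]
  refine ⟨f, ?_, hc.mono hf⟩
  refine HasDerivAt.differentiableAt (f' := g) ?_
  rw [hasDerivAt_iff_isLittleO, Asymptotics.isLittleO_iff]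
  intro c hc0
  have key : ∀ᶠ z in 𝓝 k, ∀ x,
      ‖F (z, e x) - F (k, e x) - (z - k) • fderiv ℂ F (k, e x) (1, 0)‖ ≤ c * ‖z - k‖ := by
    have := isCompact_univ.eventually_forall_of_forall_eventually (X := ℂ) (Y := X) (x₀ := k)
      (P := fun z x => ‖F (z, e x) - F (k, e x) - (z - k) • fderiv ℂ F (k, e x) (1, 0)‖
        ≤ c * ‖z - k‖) (K := univ) fun x _ => by
        have hs := (hF x).hasStrictFDerivAt.isLittleO
        rw [Asymptotics.isLittleO_iff] at hs
        have hs' := hs (half_pos hc0)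
        have h1 : Tendsto (fun q : ℂ × X => ((q.1, e q.2), (k, e q.2))) (𝓝 (k, x))
            (𝓝 ((k, e x), (k, e x))) := by
          have : ContinuousAt (fun q : ℂ × X => ((q.1, e q.2), (k, e q.2))) (k, x) := by fun_prop
          exact this
        have h2 : Tendsto (fun q : ℂ × X => fderiv ℂ F (k, e q.2) (1, 0)) (𝓝 (k, x))
            (𝓝 (fderiv ℂ F (k, e x) (1, 0))) :=
          (hg.tendsto x).comp (continuous_snd.tendsto (k, x))
        filter_upwards [h1.eventually hs', h2.eventually (Metric.ball_mem_nhds _ (half_pos hc0))]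
          with q hq hq'
        have e1 : ((q.1, e q.2) : ℂ × E) - (k, e q.2) = (q.1 - k) • ((1 : ℂ), (0 : E)) := by
          ext <;> simp
        rw [e1, map_smul, norm_smul] at hq
        have e2 : ‖((1 : ℂ), (0 : E))‖ = 1 := by simp [Prod.norm_def]
        rw [e2, mul_one] at hq
        rw [dist_eq_norm] at hq'
        calc _ = ‖(F (q.1, e q.2) - F (k, e q.2) - (q.1 - k) • fderiv ℂ F (k, e x) (1, 0)) -
              (q.1 - k) • (fderiv ℂ F (k, e q.2) (1, 0) - fderiv ℂ F (k, e x) (1, 0))‖ := by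
              congr 1; rw [smul_sub]; ring
          _ ≤ c / 2 * ‖q.1 - k‖ + ‖q.1 - k‖ * (c / 2) := by
              refine (norm_sub_le _ _).trans (add_le_add hq ?_)
              rw [norm_smul]
              gcongr
          _ = c * ‖q.1 - k‖ := by ring
    simpa using this
  filter_upwards [key, hc] with z hz hz'
  rw [ContinuousMap.norm_le _ (by positivity)]
  intro x
  have := hz x
  rw [← hf z hz', ← hf k hF] at this
  exact this

/-- The coordinates of `j` points of `L × R`. -/
def coords {L R : Set ℂ} {j : ℕ} (z : Fin j → L × R) : Fin j → ℂ × ℂ :=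
  fun i => ((z i).1, (z i).2)

theorem coords_cons {L R : Set ℂ} {j : ℕ} (t : L × R) (z : Fin j → L × R) :
    coords (Fin.cons t z) = Fin.cons ((t.1 : ℂ), (t.2 : ℂ)) (coords z) := by
  funext i
  refine Fin.cases ?_ (fun i => ?_) i <;> rfl

theorem continuous_coords {L R : Set ℂ} {j : ℕ} :
    Continuous (coords : (Fin j → L × R) → Fin j → ℂ × ℂ) := by
  unfold coords; fun_prop

variable {Z Z₁ Z₂ : (ℂ → ℂ → ℂ) → ℂ} {L R : Set ℂ} [CompactSpace L] [CompactSpace R]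

theorem multiInt_eq {I : C(L × R, ℂ) →L[ℂ] ℂ} (hI : Rep Z I) (j : ℕ)
    (F : (Fin j → ℂ × ℂ) → ℂ) (f : C(Fin j → L × R, ℂ)) (hf : ∀ z, f z = F (coords z)) :
    multiInt Z j F = multiFun I j f := by
  induction j with
  | zero =>
    rw [multiFun_zero, hf]
    exact congrArg F (Subsingleton.elim _ _)
  | succ j ih =>
    refine (hI _ ((multiFun I j).compLeftContinuous ℂ (L × R) (curryCons (L × R) j f))
      fun t => ?_)
    exact (ih _ (curryCons (L × R) j f t) fun z => by rw [curryCons_apply, hf, coords_cons]).symm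

theorem analyticAt_cons {j : ℕ} {F : (Fin (j + 1) → ℂ × ℂ) → ℂ} {a : ℂ × ℂ}
    {w : Fin j → ℂ × ℂ} (h : AnalyticAt ℂ F (Fin.cons a w)) :
    AnalyticAt ℂ (fun q : (ℂ × ℂ) × (Fin j → ℂ × ℂ) => F (Fin.cons q.1 q.2)) (a, w) := by
  refine AnalyticAt.fun_comp (f := fun q : (ℂ × ℂ) × (Fin j → ℂ × ℂ) =>
    (Fin.cons q.1 q.2 : Fin (j + 1) → ℂ × ℂ)) h (AnalyticAt.pi fun i => ?_)
  refine Fin.cases ?_ (fun i => ?_) i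
  · exact analyticAt_fst
  · exact (ContinuousLinearMap.proj (R := ℂ) (φ := fun _ : Fin j => ℂ × ℂ) i ∘L
      ContinuousLinearMap.snd ℂ (ℂ × ℂ) (Fin j → ℂ × ℂ)).analyticAt _

/-- By induction the inner integrals may be taken with either functional. As functions of the outer
pair they are holomorphic in each variable, so the outer functionals agree on them too. -/
theorem multiInt_congr_of_analyticAt {I₁ I₂ : C(L × R, ℂ) →L[ℂ] ℂ} (h₁ : Rep Z₁ I₁)
    (h₂ : Rep Z₂ I₂) (hZ : ∀ F, SepDiff L R F → Z₁ F = Z₂ F) (j : ℕ)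
    (F : (Fin j → ℂ × ℂ) → ℂ) (hF : ∀ z : Fin j → L × R, AnalyticAt ℂ F (coords z)) :
    multiInt Z₁ j F = multiInt Z₂ j F := by
  induction j with
  | zero => rfl
  | succ j ih =>
    have hcont : Continuous fun z : Fin (j + 1) → L × R => F (coords z) := by
      refine continuous_iff_continuousAt.2 fun z => ?_
      exact ContinuousAt.comp (f := coords) (hF z).continuousAt continuous_coords.continuousAt
    let f : C(Fin (j + 1) → L × R, ℂ) := ⟨_, hcont⟩
    let G : ℂ → ℂ → ℂ := fun k k' => multiInt Z₂ j fun z => F (Fin.cons (k, k') z)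
    have hcons : ∀ (t : L × R) (z : Fin j → L × R), AnalyticAt ℂ
        (fun q : (ℂ × ℂ) × (Fin j → ℂ × ℂ) => F (Fin.cons q.1 q.2))
        (((t.1 : ℂ), (t.2 : ℂ)), coords z) := by
      intro t z
      refine analyticAt_cons ?_
      rw [← coords_cons]
      exact hF _
    have hG : ∀ t : L × R, G t.1 t.2 = multiFun I₂ j (curryCons (L × R) j f t) := fun t =>
      multiInt_eq h₂ j _ _ fun z => by rw [← coords_cons]; rfl
    have e1 : Z₁ (fun k k' => multiInt Z₁ j fun z => F (Fin.cons (k, k') z)) = Z₁ G := by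
      let g := (multiFun I₂ j).compLeftContinuous ℂ (L × R) (curryCons (L × R) j f)
      rw [h₁ G g fun t => (hG t).symm]
      refine h₁ _ g fun t => ?_
      refine (hG t).symm.trans ?_
      refine (ih _ fun z => ?_).symm
      exact AnalyticAt.fun_comp (g := fun q : (ℂ × ℂ) × (Fin j → ℂ × ℂ) => F (Fin.cons q.1 q.2))
        (hcons t z) (analyticAt_const.prod analyticAt_id)
    refine e1.trans (hZ G ?_)
    intro k hk k' hk'
    constructor
    · obtain ⟨φ, hφ, hev⟩ := exists_differentiableAt_of_analyticAt (X := Fin j → L × R)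
        (F := fun q : ℂ × (Fin j → ℂ × ℂ) => F (Fin.cons (q.1, k') q.2)) (k := k)
        continuous_coords fun z => AnalyticAt.fun_comp
          (g := fun q : (ℂ × ℂ) × (Fin j → ℂ × ℂ) => F (Fin.cons q.1 q.2))
          (f := fun q : ℂ × (Fin j → ℂ × ℂ) => ((q.1, k'), q.2)) (hcons (⟨k, hk⟩, ⟨k', hk'⟩) z)
          ((analyticAt_fst.prod analyticAt_const).prod analyticAt_snd)
      refine ((multiFun I₂ j).differentiableAt.comp k hφ).congr_of_eventuallyEq ?_
      filter_upwards [hev] with z hz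
      exact multiInt_eq h₂ j _ _ hz
    · obtain ⟨φ, hφ, hev⟩ := exists_differentiableAt_of_analyticAt (X := Fin j → L × R)
        (F := fun q : ℂ × (Fin j → ℂ × ℂ) => F (Fin.cons (k, q.1) q.2)) (k := k')
        continuous_coords fun z => AnalyticAt.fun_comp
          (g := fun q : (ℂ × ℂ) × (Fin j → ℂ × ℂ) => F (Fin.cons q.1 q.2))
          (f := fun q : ℂ × (Fin j → ℂ × ℂ) => ((k, q.1), q.2)) (hcons (⟨k, hk⟩, ⟨k', hk'⟩) z)
          ((analyticAt_const.prod analyticAt_fst).prod analyticAt_snd)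
      refine ((multiFun I₂ j).differentiableAt.comp k' hφ).congr_of_eventuallyEq ?_
      filter_upwards [hev] with z hz
      exact multiInt_eq h₂ j _ _ hz

end Iterated

/-! ### Fredholm determinants under a change of variables -/

section Pull

variable {T : Type*} [TopologicalSpace T] [CompactSpace T]

/-- The functional `f ↦ I (m · (f ∘ g))`. -/
def pullL (I : C(T, ℂ) →L[ℂ] ℂ) (m : C(T, ℂ)) (g : C(T, T)) : C(T, ℂ) →L[ℂ] ℂ :=
  I ∘L ContinuousLinearMap.mul ℂ _ m ∘L precompL g

theorem pullL_apply (I : C(T, ℂ) →L[ℂ] ℂ) (m : C(T, ℂ)) (g : C(T, T)) (f : C(T, ℂ)) :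
    pullL I m g f = I (m * f.comp g) := rfl

theorem multiFun_pullL (I : C(T, ℂ) →L[ℂ] ℂ) (m : C(T, ℂ)) (g : C(T, T)) (j : ℕ)
    (F G : C(Fin j → T, ℂ)) (h : ∀ z, G z = F (g ∘ z) * ∏ a, m (z a)) :
    multiFun (pullL I m g) j F = multiFun I j G := by
  induction j with
  | zero =>
    rw [multiFun_zero, multiFun_zero, h, Finset.univ_eq_empty, Finset.prod_empty, mul_one]
    exact congrArg F (Subsingleton.elim _ _)
  | succ j ih =>
    change I (m * ((multiFun (pullL I m g) j).compLeftContinuous ℂ T (curryCons T j F)).comp g) =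
      I ((multiFun I j).compLeftContinuous ℂ T (curryCons T j G))
    congr 1
    ext t
    change m t * multiFun (pullL I m g) j (curryCons T j F (g t)) =
      multiFun I j (curryCons T j G t)
    rw [← smul_eq_mul, ← map_smul]
    refine ih _ _ fun z => ?_
    rw [curryCons_apply, h, Fin.prod_univ_succ, ContinuousMap.smul_apply, curryCons_apply,
      Fin.cons_zero, smul_eq_mul]
    have : g ∘ (Fin.cons t z : Fin (j + 1) → T) = Fin.cons (g t) (g ∘ z) := by
      funext i
      refine Fin.cases ?_ (fun i => ?_) i <;> rfl
    rw [this]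
    simp only [Fin.cons_succ]
    ring

/-- The weight m, one factor per variable, scales the columns of the determinant and so passes into
the kernel. -/
theorem fred_pullL (I : C(T, ℂ) →L[ℂ] ℂ) (m : C(T, ℂ)) (g : C(T, T)) (κ κ' : C(T × T, ℂ))
    (h : ∀ t s, κ' (t, s) = κ (g t, g s) * m s) : fred (pullL I m g) κ = fred I κ' := by
  refine tsum_congr fun j => ?_
  congr 1
  refine multiFun_pullL I m g j _ _ fun z => ?_
  change (Matrix.of fun a b : Fin j => κ' (z a, z b)).det =
    (Matrix.of fun a b : Fin j => κ (g (z a), g (z b))).det * _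
  rw [mul_comm, ← Matrix.det_mul_row]
  congr 1
  ext a b
  simp [h, mul_comm]

end Pull

/-! ### Plane waves and the tau function -/

/-- `L × R` avoids the singularities of the plane wave factors and of the Cauchy kernel. -/
structure Domain (p : ℂ) (L R : Set ℂ) : Prop where
  left_avoid : ∀ k ∈ L, k ≠ 0 ∧ k ≠ p ∧ k ≠ -p
  right_avoid : ∀ k ∈ R, k ≠ 0 ∧ k ≠ p ∧ k ≠ -p
  add_ne : ∀ k ∈ L, ∀ k' ∈ R, k + k' ≠ 0

theorem Kind.Admissible.domain {κ : Kind} {N : ℕ} {p : ℂ} {S : Spectral}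
    (h : κ.Admissible N p S) : Domain p (κ.left N S) (κ.right N S) :=
  ⟨fun k hk => h.avoid k (Or.inl hk), fun k hk => h.avoid k (Or.inr hk), h.kernel⟩

theorem analyticAt_rho {p k : ℂ} (n l : ℤ) (x : ℝ) (h : k ≠ 0 ∧ k ≠ p ∧ k ≠ -p) :
    AnalyticAt ℂ (rho p n l x) k := by
  have h1 : p - k ≠ 0 := sub_ne_zero.2 (Ne.symm h.2.1)
  have h2 : p + k ≠ 0 := fun e => h.2.2 (eq_neg_of_add_eq_zero_right e)
  unfold rho
  refine ((analyticAt_id.mul analyticAt_const).cexp'.mul (AnalyticAt.zpow ?_ ?_)).mul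
    (AnalyticAt.zpow analyticAt_id h.1)
  · exact (analyticAt_const.add analyticAt_id).div (analyticAt_const.sub analyticAt_id) h1
  · exact div_ne_zero h2 h1

theorem analyticAt_sigma {p k : ℂ} (n l : ℤ) (x : ℝ) (h : k ≠ 0 ∧ k ≠ p ∧ k ≠ -p) :
    AnalyticAt ℂ (sigma p n l x) k := by
  have h1 : p - k ≠ 0 := sub_ne_zero.2 (Ne.symm h.2.1)
  have h2 : p + k ≠ 0 := fun e => h.2.2 (eq_neg_of_add_eq_zero_right e)
  unfold sigma
  refine ((analyticAt_id.mul analyticAt_const).cexp'.mul (AnalyticAt.zpow ?_ ?_)).mul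
    (AnalyticAt.zpow analyticAt_id.neg (neg_ne_zero.2 h.1))
  · exact (analyticAt_const.add analyticAt_id).div (analyticAt_const.sub analyticAt_id) h1
  · exact div_ne_zero h2 h1

theorem rho_ne_zero {p k : ℂ} (n l : ℤ) (x : ℝ) (h : k ≠ 0 ∧ k ≠ p ∧ k ≠ -p) :
    rho p n l x k ≠ 0 := by
  have h1 : p - k ≠ 0 := sub_ne_zero.2 (Ne.symm h.2.1)
  have h2 : p + k ≠ 0 := fun e => h.2.2 (eq_neg_of_add_eq_zero_right e)
  exact mul_ne_zero (mul_ne_zero (exp_ne_zero _) (zpow_ne_zero _ (div_ne_zero h2 h1)))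
    (zpow_ne_zero _ h.1)

theorem sigma_ne_zero {p k : ℂ} (n l : ℤ) (x : ℝ) (h : k ≠ 0 ∧ k ≠ p ∧ k ≠ -p) :
    sigma p n l x k ≠ 0 := by
  have h1 : p - k ≠ 0 := sub_ne_zero.2 (Ne.symm h.2.1)
  have h2 : p + k ≠ 0 := fun e => h.2.2 (eq_neg_of_add_eq_zero_right e)
  exact mul_ne_zero (mul_ne_zero (exp_ne_zero _) (zpow_ne_zero _ (div_ne_zero h2 h1)))
    (zpow_ne_zero _ (neg_ne_zero.2 h.1))

theorem rho_add {p k : ℂ} (n i l : ℤ) (x : ℝ) (h : k ≠ 0) :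
    rho p (n + i) l x k = k ^ i * rho p n l x k := by
  unfold rho; rw [zpow_add₀ h]; ring

theorem sigma_add {p k : ℂ} (n i l : ℤ) (x : ℝ) (h : k ≠ 0) :
    sigma p (n + i) l x k = ((-k) ^ i)⁻¹ * sigma p n l x k := by
  unfold sigma; rw [neg_add, zpow_add₀ (neg_ne_zero.2 h), ← zpow_neg]; ring

theorem rho_shift {p k : ℂ} (n l : ℤ) (x : ℝ) (h : k ≠ p ∧ k ≠ -p) :
    rho p n (l + 1) x k * (p - k) = (p + k) * rho p n l x k := by
  have h1 : p - k ≠ 0 := sub_ne_zero.2 (Ne.symm h.1)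
  have h2 : p + k ≠ 0 := fun e => h.2 (eq_neg_of_add_eq_zero_right e)
  unfold rho; rw [zpow_add_one₀ (div_ne_zero h2 h1)]; field_simp

theorem sigma_shift {p k : ℂ} (n l : ℤ) (x : ℝ) (h : k ≠ p ∧ k ≠ -p) :
    sigma p n (l + 1) x k * (p - k) = (p + k) * sigma p n l x k := by
  have h1 : p - k ≠ 0 := sub_ne_zero.2 (Ne.symm h.1)
  have h2 : p + k ≠ 0 := fun e => h.2 (eq_neg_of_add_eq_zero_right e)
  unfold sigma; rw [zpow_add_one₀ (div_ne_zero h2 h1)]; field_simp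

theorem rho_eq_exp (p k : ℂ) (n l : ℤ) (x : ℝ) : rho p n l x k = exp (k * x) * rho p n l 0 k := by
  unfold rho; simp; ring

theorem sigma_eq_exp (p k : ℂ) (n l : ℤ) (x : ℝ) :
    sigma p n l x k = exp (k * x) * sigma p n l 0 k := by
  unfold sigma; simp; ring

namespace Domain

variable {p : ℂ} {L R : Set ℂ} (h : Domain p L R)

/-- `ρ_n(k) σ_n(k')` on `L × R`. -/
def pw (n l : ℤ) (x : ℝ) : C(L × R, ℂ) :=
  ⟨fun t => rho p n l x t.1 * sigma p n l x t.2, by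
    refine continuous_iff_continuousAt.2 fun t => ContinuousAt.mul ?_ ?_
    · exact ContinuousAt.comp (f := fun t : L × R => (t.1 : ℂ))
        (analyticAt_rho n l x (h.left_avoid _ t.1.2)).continuousAt (by fun_prop)
    · exact ContinuousAt.comp (f := fun t : L × R => (t.2 : ℂ))
        (analyticAt_sigma n l x (h.right_avoid _ t.2.2)).continuousAt (by fun_prop)⟩

theorem pw_apply (n l : ℤ) (x : ℝ) (t : L × R) :
    h.pw n l x t = rho p n l x t.1 * sigma p n l x t.2 := rfl

variable [CompactSpace L] [CompactSpace R]

/-- The Cauchy data on `L × R`. -/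
def data (I : C(L × R, ℂ) →L[ℂ] ℂ) : CauchyData (L × R) where
  I := I
  a := ⟨fun t => t.1, by fun_prop⟩
  b := ⟨fun t => t.2, by fun_prop⟩
  add_ne := fun t s => h.add_ne _ t.1.2 _ s.2.2

variable (I : C(L × R, ℂ) →L[ℂ] ℂ)

theorem data_a (t : L × R) : (h.data I).a t = t.1 := rfl

theorem data_b (t : L × R) : (h.data I).b t = t.2 := rfl

theorem pw_succ (n l : ℤ) (x : ℝ) :
    h.pw (n + 1) l x * (h.data I).b = -((h.data I).a * h.pw n l x) := by
  ext t
  have h2 := (h.right_avoid _ t.2.2).1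
  simp only [ContinuousMap.mul_apply, ContinuousMap.neg_apply, data_a, data_b, pw_apply]
  rw [rho_add _ _ _ _ (h.left_avoid _ t.1.2).1, sigma_add _ _ _ _ h2, zpow_one, zpow_one]
  field_simp

theorem pw_tilde (n l : ℤ) (x : ℝ) : (h.data I).IsTilde p (h.pw n l x) (h.pw n (l + 1) x) := by
  intro t
  have e1 := rho_shift n l x (h.left_avoid _ t.1.2).2
  have e2 := sigma_shift n l x (h.right_avoid _ t.2.2).2
  rw [data_a, data_b, pw_apply, pw_apply]
  linear_combination (sigma p n (l + 1) x t.2 * (p - t.2)) * e1 +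
    (p + t.1) * rho p n l x t.1 * e2

theorem pw_eq_expMul (n l : ℤ) (x : ℝ) :
    h.pw n l x = expMul ((h.data I).a + (h.data I).b) (h.pw n l 0) x := by
  ext t
  change rho p n l x t.1 * sigma p n l x t.2 =
    exp (((t.1 : ℂ) + t.2) * x) * (rho p n l 0 t.1 * sigma p n l 0 t.2)
  rw [rho_eq_exp, sigma_eq_exp, add_mul, Complex.exp_add]
  ring

theorem hasDerivAt_pw (n l : ℤ) (x : ℝ) : HasDerivAt (fun y => h.pw n l y)
    (((h.data I).a + (h.data I).b) * h.pw n l x) x := by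
  have := hasDerivAt_expMul ((h.data I).a + (h.data I).b) (h.pw n l 0) x
  rw [← pw_eq_expMul] at this
  exact this.congr_of_eventuallyEq (Filter.Eventually.of_forall fun y => h.pw_eq_expMul I n l y)

theorem hasDerivAt_det_pw (n l : ℤ) (x : ℝ) (hx : (h.data I).det (h.pw n l x) ≠ 0) :
    HasDerivAt (fun y => (h.data I).det (h.pw n l y))
      ((h.data I).det (h.pw n l x) * (h.data I).u (h.pw n l x)) x := by
  have := CauchyData.hasDerivAt_det (D := h.data I) (r₀ := h.pw n l 0) (x := x)
    (by rwa [← pw_eq_expMul])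
  rw [← pw_eq_expMul] at this
  refine this.congr_of_eventuallyEq (Filter.Eventually.of_forall fun y => ?_)
  exact congrArg (h.data I).det (h.pw_eq_expMul I n l y)

/-- Inverses of the factors occurring in the plane waves. -/
def lattice : (h.data I).Lattice p where
  ib := ⟨fun t => (t.2 : ℂ)⁻¹, Continuous.inv₀ (by fun_prop) fun t => (h.right_avoid _ t.2.2).1⟩
  ipa := ⟨fun t => (p + t.1 : ℂ)⁻¹, Continuous.inv₀ (by fun_prop) fun t e =>
    (h.left_avoid _ t.1.2).2.2 (eq_neg_of_add_eq_zero_right e)⟩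
  ipb := ⟨fun t => (p - t.2 : ℂ)⁻¹, Continuous.inv₀ (by fun_prop) fun t =>
    sub_ne_zero.2 (Ne.symm (h.right_avoid _ t.2.2).2.1)⟩
  ilam := ⟨fun t => (p - t.1) * (p + t.1 : ℂ)⁻¹, Continuous.mul (by fun_prop)
    (Continuous.inv₀ (by fun_prop) fun t e =>
      (h.left_avoid _ t.1.2).2.2 (eq_neg_of_add_eq_zero_right e))⟩
  b_ib := fun t => mul_inv_cancel₀ (h.right_avoid _ t.2.2).1
  ipa_eq := fun t => mul_inv_cancel₀ fun e =>
    (h.left_avoid _ t.1.2).2.2 (eq_neg_of_add_eq_zero_right e)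
  ipb_eq := fun t => mul_inv_cancel₀ (sub_ne_zero.2 (Ne.symm (h.right_avoid _ t.2.2).2.1))
  ilam_eq := fun t => by
    have : (p + t.1 : ℂ) ≠ 0 := fun e =>
      (h.left_avoid _ t.1.2).2.2 (eq_neg_of_add_eq_zero_right e)
    change (p + t.1 : ℂ) * ((p - t.1) * (p + t.1 : ℂ)⁻¹) = p - t.1
    field_simp
  a_ne := fun t => (h.left_avoid _ t.1.2).1
  pa_ne := fun t => sub_ne_zero.2 (Ne.symm (h.left_avoid _ t.1.2).2.1)

variable {I} {Z : (ℂ → ℂ → ℂ) → ℂ}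

/-- The matrix defining τ is the transpose of the matrix of the kernel r(s)/(a(t) + b(s)). -/
theorem tau_eq_det (hI : Rep Z I) (n l : ℤ) (x : ℝ) :
    tau Z p n l x = (h.data I).det (h.pw n l x) := by
  unfold tau CauchyData.det fred
  refine tsum_congr fun j => ?_
  congr 1
  refine multiInt_eq hI j _ _ fun z => ?_
  change (Matrix.of fun a b : Fin j => (h.data I).ker (h.pw n l x) (z a, z b)).det = _
  rw [← Matrix.det_transpose]
  congr 1
  ext a b
  change ((z b).1 + (z a).2 : ℂ)⁻¹ * (rho p n l x (z a).1 * sigma p n l x (z a).2) =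
    rho p n l x (z a).1 * sigma p n l x (z a).2 * (1 / ((z b).1 + (z a).2 : ℂ))
  rw [one_div, mul_comm]

/-- Each integrand of the series is built from plane waves and Cauchy factors, analytic near the
domain, so only the action of the functional on holomorphic functions matters. -/
theorem tau_congr (h : Domain p L R) {Z' : (ℂ → ℂ → ℂ) → ℂ} {I' : C(L × R, ℂ) →L[ℂ] ℂ} (hI : Rep Z I)
    (hI' : Rep Z' I') (hZ : ∀ F, SepDiff L R F → Z F = Z' F) (n l : ℤ) (x : ℝ) :
    tau Z p n l x = tau Z' p n l x := by
  unfold tau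
  refine tsum_congr fun j => ?_
  congr 1
  refine multiInt_congr_of_analyticAt hI hI' hZ j _ fun z => ?_
  have h1 : ∀ a : Fin j, AnalyticAt ℂ (fun w : Fin j → ℂ × ℂ => (w a).1) (coords z) := fun a =>
    (ContinuousLinearMap.fst ℂ ℂ ℂ ∘L
      ContinuousLinearMap.proj (R := ℂ) (φ := fun _ : Fin j => ℂ × ℂ) a).analyticAt _
  have h2 : ∀ a : Fin j, AnalyticAt ℂ (fun w : Fin j → ℂ × ℂ => (w a).2) (coords z) := fun a =>
    (ContinuousLinearMap.snd ℂ ℂ ℂ ∘L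
      ContinuousLinearMap.proj (R := ℂ) (φ := fun _ : Fin j => ℂ × ℂ) a).analyticAt _
  simp only [Matrix.det_apply, Matrix.of_apply]
  refine Finset.analyticAt_fun_sum _ fun s _ => ?_
  refine AnalyticAt.const_smul (Finset.analyticAt_fun_prod _ fun a _ => ?_)
  refine AnalyticAt.mul (AnalyticAt.mul ?_ ?_) ?_
  · exact AnalyticAt.fun_comp (g := rho p n l x)
      (analyticAt_rho n l x (h.left_avoid _ (z _).1.2)) (h1 _)
  · exact AnalyticAt.fun_comp (g := sigma p n l x)
      (analyticAt_sigma n l x (h.right_avoid _ (z _).2.2)) (h2 _)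
  · exact analyticAt_const.div ((h1 _).add (h2 _)) (h.add_ne _ (z _).1.2 _ (z _).2.2)

end Domain

/-! ### Periodicity and reflection symmetries of the tau function. -/

section Symmetries

variable {κ : Kind} {N : ℕ} {p : ℂ} {S : Spectral}

/-- On holomorphic functions the measure sees only points with k^N = (-k')^N, so the weight
(k/(-k'))^N may be inserted freely; inside the determinant it turns r_n into r_{n+N}. -/
theorem tau_periodic (h : κ.Admissible N p S) (n l : ℤ) (x : ℝ) :
    tau (κ.zeta N S) p (n + N) l x = tau (κ.zeta N S) p n l x := by
  have hd := h.domain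
  have : CompactSpace (κ.left N S) := isCompact_iff_compactSpace.1 (κ.left_compact h.regular)
  have : CompactSpace (κ.right N S) := isCompact_iff_compactSpace.1 (κ.right_compact h.regular)
  obtain ⟨I, hI⟩ := exists_rep κ h.regular _ _ subset_rfl subset_rfl
  let m : C(κ.left N S × κ.right N S, ℂ) := ⟨fun t => (t.1 / -t.2) ^ N, by
    refine Continuous.pow (Continuous.div (by fun_prop) (by fun_prop) fun t => ?_) N
    exact neg_ne_zero.2 (hd.right_avoid _ t.2.2).1⟩
  have hI' : Rep (fun F => κ.zeta N S fun k k' => (k / -k') ^ N * F k k')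
      (pullL I m (ContinuousMap.id _)) := fun F f hf => by
    rw [pullL_apply]
    refine hI _ _ fun t => ?_
    rw [← hf]; rfl
  rw [hd.tau_congr hI hI' (fun F hF => ?_) n l x, hd.tau_eq_det hI, hd.tau_eq_det hI']
  · symm
    refine fred_pullL I m _ _ _ fun t s => ?_
    have h2 := (hd.right_avoid _ s.2.2).1
    simp only [CauchyData.ker_apply, Domain.pw_apply, ContinuousMap.id_apply]
    rw [rho_add _ _ _ _ (hd.left_avoid _ s.1.2).1, sigma_add _ _ _ _ h2]
    change _ = _ * ((s.1 / -s.2 : ℂ) ^ N)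
    rw [div_pow, zpow_natCast, zpow_natCast, Domain.data_a, Domain.data_a, Domain.data_b,
      Domain.data_b]
    ring
  · refine zeta_congr_of_sepDiff κ h.regular hF ?_ fun k hk k' hk' hkk => ?_
    · intro k hk k' hk'
      have h2 := neg_ne_zero.2 (hd.right_avoid _ hk').1
      exact ⟨((differentiableAt_id.div_const _).pow N).mul (hF k hk k' hk').1,
        (((differentiableAt_const k).div differentiableAt_id.neg h2).pow N).mul
          (hF k hk k' hk').2⟩
    · rw [div_pow, hkk, div_self (pow_ne_zero N (neg_ne_zero.2 (hd.right_avoid _ hk').1)),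
        one_mul]

/-- The Fredholm determinant with the two variables interchanged. -/
theorem fred_swap {W : Set ℂ} [CompactSpace W] (hd : Domain p W W) (I : C(W × W, ℂ) →L[ℂ] ℂ)
    (m : C(W × W, ℂ)) (n n' l : ℤ) (x : ℝ)
    (hm : ∀ t : W × W, hd.pw n l x t.swap * m t = hd.pw n' l x t) :
    (hd.data (pullL I m ⟨Prod.swap, continuous_swap⟩)).det (hd.pw n l x) =
      (hd.data I).det (hd.pw n' l x) := by
  unfold CauchyData.det
  -- κ₁ is the kernel after interchanging k and k'. Its transpose κ₂ has the original Cauchy factor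
  -- but carries the weight on the row variable; conjugation by the nonvanishing weight moves it
  -- back to the column.
  let κ₁ : C((W × W) × (W × W), ℂ) := ⟨fun q => (q.1.2 + q.2.1 : ℂ)⁻¹ * hd.pw n' l x q.2, by
    refine Continuous.mul (Continuous.inv₀ (by fun_prop) fun q => ?_) (by fun_prop)
    rw [add_comm]
    exact hd.add_ne _ q.2.1.2 _ q.1.2.2⟩
  let κ₂ : C((W × W) × (W × W), ℂ) := ⟨fun q => (q.1.1 + q.2.2 : ℂ)⁻¹ * hd.pw n' l x q.1, by
    refine Continuous.mul (Continuous.inv₀ (by fun_prop) fun q => ?_) (by fun_prop)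
    exact hd.add_ne _ q.1.1.2 _ q.2.2.2⟩
  have hne : ∀ t, hd.pw n' l x t ≠ 0 := fun t =>
    mul_ne_zero (rho_ne_zero _ _ _ (hd.left_avoid _ t.1.2))
      (sigma_ne_zero _ _ _ (hd.right_avoid _ t.2.2))
  have e1 : fred (pullL I m ⟨Prod.swap, continuous_swap⟩)
      ((hd.data (pullL I m ⟨Prod.swap, continuous_swap⟩)).ker (hd.pw n l x)) = fred I κ₁ := by
    refine fred_pullL I m _ _ _ fun t s => ?_
    change (t.2 + s.1 : ℂ)⁻¹ * hd.pw n' l x s = (t.2 + s.1 : ℂ)⁻¹ * hd.pw n l x s.swap * m s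
    rw [mul_assoc, hm]
  have e2 : fred I κ₂ = fred I κ₁ := fred_transpose I fun t s => by
    change (t.1 + s.2 : ℂ)⁻¹ * _ = (s.2 + t.1 : ℂ)⁻¹ * _
    rw [add_comm]
  have e3 : fred I κ₂ = fred I ((hd.data I).ker (hd.pw n' l x)) :=
    fred_conj I (fun t => hd.pw n' l x t) hne fun t s => by
      change (t.1 + s.2 : ℂ)⁻¹ * hd.pw n' l x t * hd.pw n' l x s =
        hd.pw n' l x t * ((t.1 + s.2 : ℂ)⁻¹ * hd.pw n' l x s)
      ring
  exact e1.trans (e2.symm.trans e3)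

/-- The n-dependence is the nth power of k/(-k'), which the interchange inverts. -/
theorem pw_swap {W : Set ℂ} (hd : Domain p W W) (n l : ℤ) (x : ℝ) (t : W × W) :
    hd.pw n l x t.swap = hd.pw (-n) l x t := by
  have h1 := (hd.left_avoid _ t.1.2).1
  have h2 := (hd.left_avoid _ t.2.2).1
  rw [Domain.pw_apply, Domain.pw_apply]
  unfold rho sigma
  have e : ∀ (z : ℂ) (i : ℤ), (-z) ^ i = (-1) ^ i * z ^ i := fun z i => by
    rw [← mul_zpow, neg_one_mul]
  have e' : (-1 : ℂ) ^ (-n) = (-1) ^ n := by rw [zpow_neg, ← inv_zpow]; norm_num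
  rw [neg_neg, Prod.fst_swap, Prod.snd_swap, e t.1, e t.2, e']
  ring

theorem tauC_symm (h : Kind.C.Admissible N p S) (n l : ℤ) (x : ℝ) :
    tau (Kind.C.zeta N S) p (0 - n) l x = tau (Kind.C.zeta N S) p n l x := by
  have hd : Domain p (S.base N ∪ S.discs N) (S.base N ∪ S.discs N) := h.domain
  have : CompactSpace (S.base N ∪ S.discs N : Set ℂ) :=
    isCompact_iff_compactSpace.1 (Kind.C.left_compact h.regular)
  obtain ⟨I, hI⟩ := exists_rep Kind.C h.regular (S.base N ∪ S.discs N) (S.base N ∪ S.discs N)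
    subset_rfl subset_rfl
  have hI' : Rep (Kind.C.zeta N S) (pullL I 1 ⟨Prod.swap, continuous_swap⟩) := fun F f hf => by
    refine (zetaC_swap F).trans ?_
    rw [pullL_apply, one_mul]
    refine hI _ _ fun t => ?_
    exact hf _
  rw [hd.tau_eq_det hI, hd.tau_eq_det hI' n]
  symm
  refine fred_swap hd I 1 n (0 - n) l x fun t => ?_
  rw [pw_swap, zero_sub, ContinuousMap.one_apply, mul_one]

/-- The interchange gives n ↦ -n, and the weight -k'/k is the inverse of the factor of one step,
which makes it n ↦ -1 - n. -/
theorem tauB_symm (h : Kind.B.Admissible N p S) (n l : ℤ) (x : ℝ) :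
    tau (Kind.B.zeta N S) p (-1 - n) l x = tau (Kind.B.zeta N S) p n l x := by
  have hd : Domain p (S.base N ∪ S.discs N) (S.base N ∪ S.discs N) := h.domain
  have : CompactSpace (S.base N ∪ S.discs N : Set ℂ) :=
    isCompact_iff_compactSpace.1 (Kind.B.left_compact h.regular)
  obtain ⟨I, hI⟩ := exists_rep Kind.B h.regular (S.base N ∪ S.discs N) (S.base N ∪ S.discs N)
    subset_rfl subset_rfl
  let m : C((S.base N ∪ S.discs N : Set ℂ) × (S.base N ∪ S.discs N : Set ℂ), ℂ) :=
    ⟨fun t => -t.2 / t.1, Continuous.div (by fun_prop) (by fun_prop) fun t =>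
      (hd.left_avoid _ t.1.2).1⟩
  have hI' : Rep (fun F => Kind.B.zeta N S fun k k' => F k' k * (-k' / k))
      (pullL I m ⟨Prod.swap, continuous_swap⟩) := fun F f hf => by
    rw [pullL_apply, mul_comm]
    refine hI _ _ fun t => ?_
    change f t.swap * (-t.2 / t.1 : ℂ) = _
    rw [hf]; rfl
  rw [hd.tau_congr hI hI' (fun F hF => ?_) n l x, hd.tau_eq_det hI, hd.tau_eq_det hI' n]
  · symm
    refine fred_swap hd I m n (-1 - n) l x fun t => ?_
    have h1 := (hd.left_avoid _ t.1.2).1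
    have h2 := (hd.left_avoid _ t.2.2).1
    rw [pw_swap, show -1 - n = -n + (-1) by ring, Domain.pw_apply, Domain.pw_apply,
      rho_add _ _ _ _ h1, sigma_add _ _ _ _ h2, zpow_neg_one, zpow_neg_one, inv_inv]
    change _ * (-t.2 / t.1 : ℂ) = _
    ring
  · exact zetaB_swap h.regular hF fun k hk => (hd.left_avoid k hk).1

end Symmetries

/-! ### The wave functions -/

namespace CauchyData

variable {T : Type*} [TopologicalSpace T] [CompactSpace T] (D : CauchyData T)

/-- The data of the adjoint equation. -/
def swap : CauchyData T where
  I := D.I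
  a := D.b
  b := D.a
  add_ne := fun t s => by rw [add_comm]; exact D.add_ne s t

theorem det_swap {r : C(T, ℂ)} (hr : ∀ t, r t ≠ 0) : D.swap.det r = D.det r := by
  unfold det
  let κ : C(T × T, ℂ) := ⟨fun q => (D.a q.1 + D.b q.2)⁻¹ * r q.1, by
    have := D.add_ne
    exact Continuous.mul (Continuous.inv₀ (by fun_prop) fun q => this _ _) (by fun_prop)⟩
  have e1 : fred D.I κ = fred D.I (D.swap.ker r) := fred_transpose D.I fun t s => by
    change (D.a t + D.b s)⁻¹ * r t = (D.b s + D.a t)⁻¹ * r t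
    rw [add_comm]
  have e2 : fred D.I κ = fred D.I (D.ker r) := fred_conj D.I (fun t => r t) hr fun t s => by
    change (D.a t + D.b s)⁻¹ * r t * r s = r t * ((D.a t + D.b s)⁻¹ * r s)
    ring
  exact e1.symm.trans e2

variable [T2Space T]

/-- If the functional cannot tell r from r' on Cauchy factors times w_r, then w_r also solves the
equation for r', whose solution is unique. -/
theorem w_congr {r r' : C(T, ℂ)} (h : D.det r ≠ 0) (h' : D.det r' ≠ 0)
    (hI : ∀ t, D.I (r' * (D.cauchy.curry t * D.w r)) = D.I (r * (D.cauchy.curry t * D.w r))) :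
    D.w r' = D.w r := by
  refine D.eq_G h' ?_
  have e : D.om (r' * D.w r) = D.om (r * D.w r) := by
    ext t
    unfold om
    rw [op_apply, op_apply, mul_left_comm, hI, mul_left_comm]
  rw [e]
  unfold w
  rw [om_G _ h]
  abel

end CauchyData

open Filter Topology in
theorem exists_cauchy_integral {X : Type*} [TopologicalSpace X] [CompactSpace X]
    (I : C(X, ℂ) →L[ℂ] ℂ) (b g : C(X, ℂ)) {k : ℂ} (hk : ∀ x, k + b x ≠ 0) :
    ∃ f : ℂ → C(X, ℂ), DifferentiableAt ℂ (fun z => I (f z * g)) k ∧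
      ∀ᶠ z in 𝓝 k, ∀ x, f z x = (z + b x)⁻¹ := by
  obtain ⟨f, hf, hev⟩ := exists_differentiableAt_of_analyticAt (X := X)
    (F := fun q : ℂ × ℂ => (q.1 + q.2)⁻¹) (k := k) b.continuous fun x =>
      (analyticAt_fst.add analyticAt_snd).inv (hk x)
  exact ⟨f, I.differentiableAt.comp k (hf.mul_const g), hev⟩

/-! ### Adjoined spectral parameters and identification of the wave functions. -/

/-- A representation of the integration measure on a domain that may be larger than its own. -/
structure Model (κ : Kind) (N : ℕ) (p : ℂ) (S : Spectral) (L R : Set ℂ)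
    [CompactSpace L] [CompactSpace R] where
  regular : S.Regular N
  dom : Domain p L R
  left_sub : κ.left N S ⊆ L
  right_sub : κ.right N S ⊆ R
  I : C(L × R, ℂ) →L[ℂ] ℂ
  rep : Rep (κ.zeta N S) I

section

variable {κ : Kind} {N : ℕ} {p : ℂ} {S : Spectral}

/-- Admissibility of k and k' is exactly what keeps the domain regular when they are adjoined to L
and R. A wave function at a parameter off the support becomes the value of a continuous function at
a point of L × R. -/
theorem exists_model (h : κ.Admissible N p S) {k k' : ℂ} (hk : k ∈ paramDomain p (κ.right N S))
    (hk' : k' ∈ paramDomain p (κ.left N S)) (hkk : k + k' ≠ 0) :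
    ∃ (L R : Set ℂ) (_ : CompactSpace L) (_ : CompactSpace R) (_ : Model κ N p S L R),
      k ∈ L ∧ k' ∈ R := by
  have hd : Domain p (insert k (κ.left N S)) (insert k' (κ.right N S)) := by
    refine ⟨?_, ?_, ?_⟩
    · rintro z (rfl | hz)
      · exact ⟨hk.1, hk.2.1, hk.2.2.1⟩
      · exact h.avoid z (Or.inl hz)
    · rintro z (rfl | hz)
      · exact ⟨hk'.1, hk'.2.1, hk'.2.2.1⟩
      · exact h.avoid z (Or.inr hz)
    · rintro z (rfl | hz) z' (rfl | hz')
      · exact hkk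
      · intro e
        exact hk.2.2.2 (by rwa [neg_eq_of_add_eq_zero_right e])
      · intro e
        exact hk'.2.2.2 (by rwa [neg_eq_of_add_eq_zero_left e])
      · exact h.kernel z hz z' hz'
  have i1 : CompactSpace (insert k (κ.left N S) : Set ℂ) :=
    isCompact_iff_compactSpace.1 ((κ.left_compact h.regular).insert k)
  have i2 : CompactSpace (insert k' (κ.right N S) : Set ℂ) :=
    isCompact_iff_compactSpace.1 ((κ.right_compact h.regular).insert k')
  obtain ⟨I, hI⟩ := exists_rep κ h.regular (insert k (κ.left N S)) (insert k' (κ.right N S))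
    (subset_insert _ _) (subset_insert _ _)
  exact ⟨_, _, i1, i2, ⟨h.regular, hd, subset_insert _ _, subset_insert _ _, I, hI⟩,
    mem_insert _ _, mem_insert _ _⟩

/-- The plane is not compact. This supplies a companion point when only one of the two spectral
parameters is prescribed. -/
theorem exists_mem_paramDomain {W : Set ℂ} (hW : IsCompact W) (p k : ℂ) :
    ∃ c ∈ paramDomain p W, k + c ≠ 0 := by
  have hK : IsCompact (-W ∪ {0, p, -p, -k}) :=
    hW.neg.union (Set.toFinite {0, p, -p, -k}).isCompact
  obtain ⟨c, hc⟩ := (ne_univ_iff_exists_notMem _).1 hK.ne_univ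
  simp only [mem_union, mem_insert_iff, mem_singleton_iff, not_or, Set.mem_neg] at hc
  exact ⟨c, ⟨hc.2.1, hc.2.2.1, hc.2.2.2.1, hc.1⟩, fun e =>
    hc.2.2.2.2 (eq_neg_of_add_eq_zero_right e)⟩

theorem exists_model_left (h : κ.Admissible N p S) {k : ℂ}
    (hk : k ∈ paramDomain p (κ.right N S)) :
    ∃ (L R : Set ℂ) (_ : CompactSpace L) (_ : CompactSpace R) (_ : Model κ N p S L R),
      k ∈ L ∧ R.Nonempty := by
  obtain ⟨c, hc, hkc⟩ := exists_mem_paramDomain (κ.left_compact h.regular) p k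
  obtain ⟨L, R, i, j, M, h1, h2⟩ := exists_model h hk hc hkc
  exact ⟨L, R, i, j, M, h1, _, h2⟩

theorem exists_model_right (h : κ.Admissible N p S) {k' : ℂ}
    (hk' : k' ∈ paramDomain p (κ.left N S)) :
    ∃ (L R : Set ℂ) (_ : CompactSpace L) (_ : CompactSpace R) (_ : Model κ N p S L R),
      L.Nonempty ∧ k' ∈ R := by
  obtain ⟨c, hc, hkc⟩ := exists_mem_paramDomain (κ.right_compact h.regular) p k'
  obtain ⟨L, R, i, j, M, h1, h2⟩ := exists_model h hc hk' (by rwa [add_comm])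
  exact ⟨L, R, i, j, M, ⟨_, h1⟩, h2⟩

end

namespace Model

variable {κ : Kind} {N : ℕ} {p : ℂ} {S : Spectral} {L R : Set ℂ} [CompactSpace L] [CompactSpace R]
  (M : Model κ N p S L R)

abbrev D : CauchyData (L × R) := M.dom.data M.I

abbrev r (n l : ℤ) (x : ℝ) : C(L × R, ℂ) := M.dom.pw n l x

theorem r_ne (n l : ℤ) (x : ℝ) (t : L × R) : M.r n l x t ≠ 0 :=
  mul_ne_zero (rho_ne_zero _ _ _ (M.dom.left_avoid _ t.1.2))
    (sigma_ne_zero _ _ _ (M.dom.right_avoid _ t.2.2))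

theorem det_ne {n l : ℤ} {x : ℝ} (h : tau (κ.zeta N S) p n l x ≠ 0) :
    M.D.det (M.r n l x) ≠ 0 := by rwa [← M.dom.tau_eq_det M.rep]

theorem left_param (M : Model κ N p S L R) : L ⊆ paramDomain p (κ.right N S) := fun k hk =>
  have h := M.dom.left_avoid k hk
  ⟨h.1, h.2.1, h.2.2, fun h' => M.dom.add_ne k hk _ (M.right_sub h') (add_neg_cancel k)⟩

theorem right_param (M : Model κ N p S L R) : R ⊆ paramDomain p (κ.left N S) := fun k hk =>
  have h := M.dom.right_avoid k hk
  ⟨h.1, h.2.1, h.2.2, fun h' => M.dom.add_ne _ (M.left_sub h') k hk (neg_add_cancel k)⟩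

variable {n l : ℤ} {x : ℝ}

/-- u/ρ solves the equation characterizing w, and τ ≠ 0 gives uniqueness; hence nothing depends on
which solution was chosen. -/
theorem wave_eq {u : ℂ → ℤ → ℂ} (hτ : tau (κ.zeta N S) p n l x ≠ 0)
    (hu : IsWave (κ.zeta N S) (κ.right N S) p n l x u) (t : L × R) :
    u t.1 0 = rho p n l x t.1 * M.D.w (M.r n l x) t := by
  have hρ : ∀ t : L × R, rho p n l x t.1 ≠ 0 := fun t =>
    rho_ne_zero _ _ _ (M.dom.left_avoid _ t.1.2)
  let y : C(L × R, ℂ) := ⟨fun t => u t.1 0 / rho p n l x t.1, by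
    refine Continuous.div ((hu 0).1.comp_continuous (by fun_prop) fun t =>
      M.left_param t.1.2) ?_ hρ
    exact continuous_iff_continuousAt.2 fun t => ContinuousAt.comp (f := fun t : L × R => (t.1 : ℂ))
      (analyticAt_rho n l x (M.dom.left_avoid _ t.1.2)).continuousAt (by fun_prop)⟩
  have hy : y + M.D.om (M.r n l x * y) = 1 := by
    ext t
    have h1 := (hu 0).2 t.1 (M.left_param t.1.2)
    rw [M.rep _ (rho p n l x t.1 • (M.D.cauchy.curry t * (M.r n l x * y))) fun s => ?_, map_smul,
      zpow_zero, mul_one, smul_eq_mul] at h1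
    · change u t.1 0 / rho p n l x t.1 + M.I (M.D.cauchy.curry t * (M.r n l x * y)) = 1
      field_simp [hρ t]
      exact h1
    · have := hρ s
      change rho p n l x t.1 * ((t.1 + s.2 : ℂ)⁻¹ * (rho p n l x s.1 * sigma p n l x s.2 *
        (u s.1 0 / rho p n l x s.1))) = _
      unfold cauchyKernel
      field_simp
  have := M.D.eq_G (M.det_ne hτ) hy
  unfold CauchyData.w
  rw [this]
  change _ = _ * (u t.1 0 / rho p n l x t.1)
  field_simp [hρ t]

theorem adjoint_eq {v : ℂ → ℤ → ℂ} (hτ : tau (κ.zeta N S) p n l x ≠ 0)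
    (hv : IsAdjointWave (κ.zeta N S) (κ.left N S) p n l x v) (t : L × R) :
    v t.2 0 = sigma p n l x t.2 * M.D.swap.w (M.r n l x) t := by
  have hσ : ∀ t : L × R, sigma p n l x t.2 ≠ 0 := fun t =>
    sigma_ne_zero _ _ _ (M.dom.right_avoid _ t.2.2)
  let y : C(L × R, ℂ) := ⟨fun t => v t.2 0 / sigma p n l x t.2, by
    refine Continuous.div ((hv 0).1.comp_continuous (by fun_prop) fun t =>
      M.right_param t.2.2) ?_ hσ
    exact continuous_iff_continuousAt.2 fun t => ContinuousAt.comp (f := fun t : L × R => (t.2 : ℂ))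
      (analyticAt_sigma n l x (M.dom.right_avoid _ t.2.2)).continuousAt (by fun_prop)⟩
  have hy : y + M.D.swap.om (M.r n l x * y) = 1 := by
    ext t
    have h1 := (hv 0).2 t.2 (M.right_param t.2.2)
    rw [M.rep _ (sigma p n l x t.2 • (M.D.swap.cauchy.curry t * (M.r n l x * y))) fun s => ?_,
      map_smul, zpow_zero, one_mul, smul_eq_mul] at h1
    · change v t.2 0 / sigma p n l x t.2 + M.I (M.D.swap.cauchy.curry t * (M.r n l x * y)) = 1
      field_simp [hσ t]
      exact h1
    · have := hσ s
      change sigma p n l x t.2 * ((t.2 + s.1 : ℂ)⁻¹ * (rho p n l x s.1 * sigma p n l x s.2 *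
        (v s.2 0 / sigma p n l x s.2))) = _
      unfold cauchyKernel
      rw [add_comm]
      field_simp
  have hdet : M.D.swap.det (M.r n l x) ≠ 0 := by
    rw [CauchyData.det_swap _ (M.r_ne n l x)]
    exact M.det_ne hτ
  have := M.D.swap.eq_G hdet hy
  unfold CauchyData.w
  rw [this]
  change _ = _ * (v t.2 0 / sigma p n l x t.2)
  field_simp [hσ t]

theorem pot_eq {u : WaveFamily} (hτ : tau (κ.zeta N S) p n l x ≠ 0)
    (hu : IsWave (κ.zeta N S) (κ.right N S) p n l x (u n l x)) :
    pot (κ.zeta N S) p u n l x = M.D.u (M.r n l x) := by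
  refine M.rep _ (M.r n l x * M.D.w (M.r n l x)) fun t => ?_
  rw [M.wave_eq hτ hu, zpow_zero, ContinuousMap.mul_apply, Domain.pw_apply]
  ring

/-- The equation itself upgrades continuity: it writes u(k) as ρ(k) times 1 minus a Cauchy integral,
holomorphic in k. This is needed because contours collapse only for holomorphic integrands. -/
theorem differentiableAt_wave (M : Model κ N p S L R) {u : ℂ → ℤ → ℂ}
    (hu : IsWave (κ.zeta N S) (κ.right N S) p n l x u) {k : ℂ} (hk : k ∈ κ.left N S) :
    DifferentiableAt ℂ (fun z => u z 0) k := by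
  have hL := M.left_sub hk
  let g : C(L × R, ℂ) := ⟨fun t => sigma p n l x t.2 * u t.1 0, by
    refine Continuous.mul ?_ ((hu 0).1.comp_continuous (by fun_prop) fun t => M.left_param t.1.2)
    exact continuous_iff_continuousAt.2 fun t => ContinuousAt.comp (f := fun t : L × R => (t.2 : ℂ))
      (analyticAt_sigma n l x (M.dom.right_avoid _ t.2.2)).continuousAt (by fun_prop)⟩
  obtain ⟨f, hf, hev⟩ := exists_cauchy_integral M.I M.D.b g (k := k) fun t =>
    M.dom.add_ne _ hL _ t.2.2
  have hρ := (analyticAt_rho n l x (M.dom.left_avoid _ hL)).differentiableAt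
  refine (hρ.sub (hρ.mul hf)).congr_of_eventuallyEq ?_
  have hopen : IsOpen (paramDomain p (κ.right N S)) := by
    have e : paramDomain p (κ.right N S) = {0}ᶜ ∩ ({p}ᶜ ∩ ({-p}ᶜ ∩ (-(κ.right N S))ᶜ)) := by
      ext z; simp [paramDomain]
    rw [e]
    refine isOpen_compl_singleton.inter (isOpen_compl_singleton.inter
      (isOpen_compl_singleton.inter ?_))
    exact (κ.right_compact M.regular).neg.isClosed.isOpen_compl
  filter_upwards [hev, hopen.mem_nhds (M.left_param hL)] with z hz hzp
  have h1 := (hu 0).2 z hzp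
  rw [M.rep _ (rho p n l x z • (f z * g)) fun s => ?_, map_smul, zpow_zero, mul_one,
    smul_eq_mul] at h1
  · exact eq_sub_of_add_eq h1
  · rw [ContinuousMap.smul_apply, ContinuousMap.mul_apply, hz]
    change rho p n l x z * ((z + s.2 : ℂ)⁻¹ * (sigma p n l x s.2 * u s.1 0)) = _
    unfold cauchyKernel
    ring

theorem differentiableAt_adjoint (M : Model κ N p S L R) {v : ℂ → ℤ → ℂ}
    (hv : IsAdjointWave (κ.zeta N S) (κ.left N S) p n l x v) {k : ℂ} (hk : k ∈ κ.right N S) :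
    DifferentiableAt ℂ (fun z => v z 0) k := by
  have hR := M.right_sub hk
  let g : C(L × R, ℂ) := ⟨fun t => rho p n l x t.1 * v t.2 0, by
    refine Continuous.mul ?_ ((hv 0).1.comp_continuous (by fun_prop) fun t => M.right_param t.2.2)
    exact continuous_iff_continuousAt.2 fun t => ContinuousAt.comp (f := fun t : L × R => (t.1 : ℂ))
      (analyticAt_rho n l x (M.dom.left_avoid _ t.1.2)).continuousAt (by fun_prop)⟩
  obtain ⟨f, hf, hev⟩ := exists_cauchy_integral M.I M.D.a g (k := k) fun t => by
    rw [add_comm]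
    exact M.dom.add_ne _ t.1.2 _ hR
  have hσ := (analyticAt_sigma n l x (M.dom.right_avoid _ hR)).differentiableAt
  refine (hσ.sub (hσ.mul hf)).congr_of_eventuallyEq ?_
  have hopen : IsOpen (paramDomain p (κ.left N S)) := by
    have e : paramDomain p (κ.left N S) = {0}ᶜ ∩ ({p}ᶜ ∩ ({-p}ᶜ ∩ (-(κ.left N S))ᶜ)) := by
      ext z; simp [paramDomain]
    rw [e]
    refine isOpen_compl_singleton.inter (isOpen_compl_singleton.inter
      (isOpen_compl_singleton.inter ?_))
    exact (κ.left_compact M.regular).neg.isClosed.isOpen_compl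
  filter_upwards [hev, hopen.mem_nhds (M.right_param hR)] with z hz hzp
  have h1 := (hv 0).2 z hzp
  rw [M.rep _ (sigma p n l x z • (f z * g)) fun s => ?_, map_smul, zpow_zero, one_mul,
    smul_eq_mul] at h1
  · exact eq_sub_of_add_eq h1
  · rw [ContinuousMap.smul_apply, ContinuousMap.mul_apply, hz]
    change sigma p n l x z * ((z + s.1 : ℂ)⁻¹ * (rho p n l x s.1 * v s.2 0)) = _
    unfold cauchyKernel
    rw [add_comm z]
    ring

/-! ### Periodicity of the wave functions -/

/-- r_{n+N}/r_n = (k/(-k'))^N equals 1 wherever the collapsed measure lives. -/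
theorem I_periodic {F : ℂ → ℂ → ℂ} (hF : SepDiff (κ.left N S) (κ.right N S) F)
    (f : C(L × R, ℂ)) (hf : ∀ t, f t = F t.1 t.2) :
    M.I (M.r (n + N) l x * f) = M.I (M.r n l x * f) := by
  have hd : ∀ n, SepDiff (κ.left N S) (κ.right N S)
      fun k k' => rho p n l x k * sigma p n l x k' * F k k' := fun n k hk k' hk' => by
    have h1 := (analyticAt_rho n l x (M.dom.left_avoid _ (M.left_sub hk))).differentiableAt
    have h2 := (analyticAt_sigma n l x (M.dom.right_avoid _ (M.right_sub hk'))).differentiableAt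
    exact ⟨(h1.mul_const _).mul (hF k hk k' hk').1, (h2.const_mul _).mul (hF k hk k' hk').2⟩
  have e : ∀ n, κ.zeta N S (fun k k' => rho p n l x k * sigma p n l x k' * F k k') =
      M.I (M.r n l x * f) := fun n => M.rep _ _ fun t => by
    rw [ContinuousMap.mul_apply, hf, Domain.pw_apply]
  rw [← e, ← e]
  refine zeta_congr_of_sepDiff κ M.regular (hd _) (hd _) fun k hk k' hk' hkk => ?_
  have h1 := (M.dom.left_avoid _ (M.left_sub hk)).1
  have h2 := (M.dom.right_avoid _ (M.right_sub hk')).1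
  rw [rho_add _ _ _ _ h1, sigma_add _ _ _ _ h2, zpow_natCast, zpow_natCast, ← hkk]
  have := pow_ne_zero N h1
  field_simp

section Periodic

variable {u v : ℂ → ℤ → ℂ} (hτ : tau (κ.zeta N S) p n l x ≠ 0)
  (hu : IsWave (κ.zeta N S) (κ.right N S) p n l x u)
  (hv : IsAdjointWave (κ.zeta N S) (κ.left N S) p n l x v)
  (hτ' : tau (κ.zeta N S) p (n + N) l x ≠ 0)

include hτ hu in
theorem I_w_periodic (c : C(L × R, ℂ)) {C : ℂ → ℂ} (hc : ∀ t, c t = C t.2)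
    (hC : ∀ k ∈ κ.right N S, DifferentiableAt ℂ C k) :
    M.I (M.r (n + N) l x * (c * M.D.w (M.r n l x))) =
      M.I (M.r n l x * (c * M.D.w (M.r n l x))) := by
  refine M.I_periodic (F := fun k k' => C k' * (u k 0 / rho p n l x k)) (fun k hk k' hk' => ?_)
    _ fun t => ?_
  · have h1 := M.dom.left_avoid _ (M.left_sub hk)
    exact ⟨((M.differentiableAt_wave hu hk).div (analyticAt_rho n l x h1).differentiableAt
      (rho_ne_zero _ _ _ h1)).const_mul _, (hC k' hk').mul_const _⟩
  · have := rho_ne_zero n l x (M.dom.left_avoid _ t.1.2)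
    rw [M.wave_eq hτ hu, ContinuousMap.mul_apply, hc]
    field_simp

include hτ hu hτ' in
theorem w_periodic : M.D.w (M.r (n + N) l x) = M.D.w (M.r n l x) := by
  refine M.D.w_congr (M.det_ne hτ) (M.det_ne hτ') fun t => ?_
  refine M.I_w_periodic hτ hu _ (C := fun k' => (t.1 + k' : ℂ)⁻¹) (fun s => rfl) fun k' hk' => ?_
  exact ((differentiableAt_const _).add differentiableAt_id).inv
    (M.dom.add_ne _ t.1.2 _ (M.right_sub hk'))

include hτ hv hτ' in
theorem adjoint_periodic : M.D.swap.w (M.r (n + N) l x) = M.D.swap.w (M.r n l x) := by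
  have hs : ∀ {n}, tau (κ.zeta N S) p n l x ≠ 0 → M.D.swap.det (M.r n l x) ≠ 0 := fun h => by
    rw [CauchyData.det_swap _ (M.r_ne _ l x)]
    exact M.det_ne h
  refine M.D.swap.w_congr (hs hτ) (hs hτ') fun t => ?_
  refine M.I_periodic (F := fun k k' => (t.2 + k : ℂ)⁻¹ * (v k' 0 / sigma p n l x k'))
    (fun k hk k' hk' => ?_) _ fun s => ?_
  · have h1 := M.dom.right_avoid _ (M.right_sub hk')
    refine ⟨DifferentiableAt.mul_const ?_ _, ((M.differentiableAt_adjoint hv hk').div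
      (analyticAt_sigma n l x h1).differentiableAt (sigma_ne_zero _ _ _ h1)).const_mul _⟩
    refine ((differentiableAt_const _).add differentiableAt_id).inv ?_
    change (t.2 + k : ℂ) ≠ 0
    rw [add_comm]
    exact M.dom.add_ne _ (M.left_sub hk) _ t.2.2
  · have := sigma_ne_zero n l x (M.dom.right_avoid _ s.2.2)
    rw [M.adjoint_eq hτ hv, ContinuousMap.mul_apply]
    change (t.2 + s.1 : ℂ)⁻¹ * _ = _
    field_simp

include hτ hu hτ' in
theorem u_periodic : M.D.u (M.r (n + N) l x) = M.D.u (M.r n l x) := by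
  unfold CauchyData.u
  rw [M.w_periodic hτ hu hτ']
  have := M.I_w_periodic hτ hu 1 (C := fun _ => 1) (fun _ => rfl)
    fun _ _ => differentiableAt_const _
  simp only [one_mul] at this
  exact this

include hτ hu hτ' in
theorem flux_periodic : M.D.flux (M.r (n + N) l x) = M.D.flux (M.r n l x) := by
  unfold CauchyData.flux
  rw [M.w_periodic hτ hu hτ', mul_assoc, mul_assoc]
  exact M.I_w_periodic hτ hu M.D.b (C := id) (fun _ => rfl) fun _ _ => differentiableAt_id

include hτ hu hτ' in
theorem V_periodic : (M.dom.lattice M.I).V (M.r (n + N) l x) =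
    (M.dom.lattice M.I).V (M.r n l x) := by
  unfold CauchyData.Lattice.V CauchyData.Lattice.s
  have := M.w_periodic hτ hu hτ'
  unfold CauchyData.w at this
  rw [this, mul_assoc, mul_assoc]
  congr 1
  refine M.I_w_periodic hτ hu (M.dom.lattice M.I).ipb (C := fun k => (p - k)⁻¹) (fun _ => rfl)
    fun k hk => ?_
  exact ((differentiableAt_const _).sub differentiableAt_id).inv
    (sub_ne_zero.2 (Ne.symm (M.dom.right_avoid _ (M.right_sub hk)).2.1))

end Periodic

end Model

/-! ### Solutions of the reduced systems -/

section

variable {κ : Kind} {N : ℕ} {p : ℂ} {S : Spectral} {m : ℤ} {J : Set ℝ} {u v : WaveFamily}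

theorem exists_model_any (h : κ.Admissible N p S) :
    ∃ (L R : Set ℂ) (_ : CompactSpace L) (_ : CompactSpace R), Nonempty (Model κ N p S L R) := by
  obtain ⟨c, hc, -⟩ := exists_mem_paramDomain (κ.right_compact h.regular) p 0
  obtain ⟨L, R, i, j, M, -⟩ := exists_model_left h hc
  exact ⟨L, R, i, j, ⟨M⟩⟩

namespace IsDLSolution

theorem periodic (h : IsDLSolution κ N p S m J u v) : PeriodicReduction κ N p S m J u v where
  tau_eq := tau_periodic h.admissible
  pot_eq n l hl x hx := by
    obtain ⟨L, R, _, _, ⟨M⟩⟩ := exists_model_any h.admissible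
    have hτ := h.tau_ne n l hl x hx
    have hτ' := h.tau_ne (n + N) l hl x hx
    have hu := h.wave n l hl x hx
    rw [M.pot_eq hτ hu, M.pot_eq hτ' (h.wave _ l hl x hx), M.u_periodic hτ hu hτ']
  phi_eq n l hl x hx k hk := by
    obtain ⟨L, R, _, _, M, hkL, c, hc⟩ := exists_model_left h.admissible hk
    have hτ := h.tau_ne n l hl x hx
    have hτ' := h.tau_ne (n + N) l hl x hx
    have hu := h.wave n l hl x hx
    have e1 := M.wave_eq hτ hu (⟨k, hkL⟩, ⟨c, hc⟩)
    have e2 := M.wave_eq hτ' (h.wave _ l hl x hx) (⟨k, hkL⟩, ⟨c, hc⟩)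
    unfold scalarWave
    rw [e1, e2, M.w_periodic hτ hu hτ', rho_add _ _ _ _ hk.1, zpow_natCast]
    ring
  psi_eq n l hl x hx k' hk' k hkk := by
    obtain ⟨L, R, _, _, M, ⟨c, hc⟩, hkR⟩ := exists_model_right h.admissible hk'
    have hτ := h.tau_ne n l hl x hx
    have hτ' := h.tau_ne (n + N) l hl x hx
    have hv := h.adjoint n l hl x hx
    have e1 := M.adjoint_eq hτ hv (⟨c, hc⟩, ⟨k', hkR⟩)
    have e2 := M.adjoint_eq hτ' (h.adjoint _ l hl x hx) (⟨c, hc⟩, ⟨k', hkR⟩)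
    unfold scalarWave
    rw [e1, e2, M.adjoint_periodic hτ hv hτ', sigma_add _ _ _ _ hk'.1, zpow_natCast, hkk]
    ring

theorem hasDerivAt_tau (h : IsDLSolution κ N p S m J u v) (n : ℤ) {l : ℤ}
    (hl : l ∈ ({m, m + 1} : Set ℤ)) {x : ℝ} (hx : x ∈ J) :
    HasDerivAt (fun y => tau (κ.zeta N S) p n l y)
      (tau (κ.zeta N S) p n l x * pot (κ.zeta N S) p u n l x) x := by
  obtain ⟨L, R, _, _, ⟨M⟩⟩ := exists_model_any h.admissible
  have hτ := h.tau_ne n l hl x hx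
  rw [M.pot_eq hτ (h.wave n l hl x hx)]
  simp only [M.dom.tau_eq_det M.rep]
  exact M.dom.hasDerivAt_det_pw M.I n l x (M.det_ne hτ)

/-- ∂τ_n = τ_n u_n with τ_n ≠ 0, so u inherits every symmetry of τ by differentiation. -/
theorem symmetric (h : IsDLSolution κ N p S m J u v) {c : ℤ}
    (hτ : ∀ (n l : ℤ) (x : ℝ), tau (κ.zeta N S) p (c - n) l x = tau (κ.zeta N S) p n l x) :
    SymmetricReduction κ N c p S m J u where
  tau_eq := hτ
  pot_eq n l hl x hx := by
    have h1 := h.hasDerivAt_tau n hl hx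
    have h2 := h.hasDerivAt_tau (c - n) hl hx
    simp only [hτ] at h2
    exact mul_left_cancel₀ (h.tau_ne n l hl x hx) (h2.unique h1)

theorem hasDerivAt_pot (hJ : IsOpen J) (h : IsDLSolution κ N p S m J u v) {L R : Set ℂ}
    [CompactSpace L] [CompactSpace R] (M : Model κ N p S L R) (n : ℤ) {l : ℤ}
    (hl : l ∈ ({m, m + 1} : Set ℤ)) {x : ℝ} (hx : x ∈ J) :
    HasDerivAt (fun y => pot (κ.zeta N S) p u n l y)
      (M.D.flux (M.r n l x) - M.D.flux (M.r (n + 1) l x) +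
        (pot (κ.zeta N S) p u (n + 1) l x - pot (κ.zeta N S) p u n l x) *
          pot (κ.zeta N S) p u n l x) x := by
  have hp : ∀ n, ∀ y ∈ J, pot (κ.zeta N S) p u n l y = M.D.u (M.r n l y) := fun n y hy =>
    M.pot_eq (h.tau_ne n l hl y hy) (h.wave n l hl y hy)
  have h1 := CauchyData.hasDerivAt_u (r' := fun y => M.r (n + 1) l y)
    (M.dom.hasDerivAt_pw M.I n l x)
    (M.det_ne (h.tau_ne n l hl x hx)) (M.det_ne (h.tau_ne (n + 1) l hl x hx))
    (M.dom.pw_succ M.I n l x)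
  rw [hp n x hx, hp (n + 1) x hx]
  refine h1.congr_of_eventuallyEq ?_
  filter_upwards [hJ.mem_nhds hx] with y hy using hp n y hy

end IsDLSolution

/-- A nonvanishing solution of `g' = g f` on an interval is the exponential of a primitive of `f`. -/
theorem exists_exp_primitive {J : Set ℝ} (hJ : IsOpen J) (hJ' : J.OrdConnected) {f g : ℝ → ℂ}
    (hf : ContinuousOn f J) (hg : ∀ x ∈ J, g x ≠ 0) (hd : ∀ x ∈ J, HasDerivAt g (g x * f x) x) :
    ∃ s : ℝ → ℂ, ∀ x ∈ J, exp (s x) = g x ∧ HasDerivAt s (f x) x := by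
  rcases J.eq_empty_or_nonempty with rfl | ⟨x₀, hx₀⟩
  · exact ⟨0, fun x hx => hx.elim⟩
  let s : ℝ → ℂ := fun x => log (g x₀) + ∫ y in x₀..x, f y
  have hs : ∀ x ∈ J, HasDerivAt s (f x) x := by
    intro x hx
    refine HasDerivAt.const_add _ (intervalIntegral.integral_hasDerivAt_right ?_ ?_ ?_)
    · exact (hf.mono (hJ'.uIcc_subset hx₀ hx)).intervalIntegrable
    · exact hf.stronglyMeasurableAtFilter hJ x hx
    · exact hf.continuousAt (hJ.mem_nhds hx)
  have hc : ∀ x ∈ J, HasDerivAt (fun y => exp (-s y) * g y) 0 x := by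
    intro x hx
    refine ((hs x hx).neg.cexp.mul (hd x hx)).congr_deriv ?_
    ring
  obtain ⟨c, hc'⟩ := hJ.exists_is_const_of_deriv_eq_zero hJ'.isPreconnected
    (fun x hx => (hc x hx).differentiableAt.differentiableWithinAt) fun x hx => (hc x hx).deriv
  have h0 : c = 1 := by
    rw [← hc' x₀ hx₀]
    simp only [s, intervalIntegral.integral_same, add_zero]
    rw [exp_neg, exp_log (hg x₀ hx₀), inv_mul_cancel₀ (hg x₀ hx₀)]
  refine ⟨s, fun x hx => ⟨?_, hs x hx⟩⟩
  have h1 := hc' x hx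
  rw [h0, exp_neg, inv_mul_eq_one₀ (exp_ne_zero _)] at h1
  exact h1

theorem IsDLSolution.exists_fields (hJ : IsOpen J) (hJ' : J.OrdConnected)
    (h : IsDLSolution κ N p S m J u v) : ∃ F : Fields, IsFieldsOf κ N p S m J u F := by
  obtain ⟨L, R, _, _, ⟨M⟩⟩ := exists_model_any h.admissible
  have key : ∀ l ∈ ({m, m + 1} : Set ℤ), ∀ n : ℤ, ∃ s : ℝ → ℂ, ∀ x ∈ J,
      exp (s x) = tau (κ.zeta N S) p n l x ∧ HasDerivAt s (pot (κ.zeta N S) p u n l x) x := by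
    intro l hl n
    refine exists_exp_primitive hJ hJ' (fun x hx => ?_) (h.tau_ne n l hl)
      fun x hx => h.hasDerivAt_tau n hl hx
    exact (h.hasDerivAt_pot hJ M n hl hx).continuousAt.continuousWithinAt
  choose s hs using key m (by simp)
  choose st hst using key (m + 1) (by simp)
  exact ⟨⟨fun n x => pot (κ.zeta N S) p u n m x, fun n x => pot (κ.zeta N S) p u n (m + 1) x, s, st⟩,
    fun _ _ _ => rfl, fun _ _ _ => rfl, fun n x hx => (hs n x hx).1,
    fun n x hx => (hst n x hx).1, fun n x hx => ⟨(hs n x hx).2, (hst n x hx).2⟩⟩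

/-! ### Elementary properties of `e` -/

namespace Fields

variable (F : Fields)

theorem e_self (a : ℤ) (x : ℝ) : F.e a a x = 2 := by
  unfold e; rw [sub_self, exp_zero]; norm_num

/-- The two exponentials are reciprocal; where e is nonzero this reads 1/e_{a,b} + 1/e_{b,a} = 1. -/
theorem e_symm (a b : ℤ) (x : ℝ) : F.e a b x + F.e b a x = F.e a b x * F.e b a x := by
  unfold e
  set z := (F.s a x - F.st a x) - (F.s b x - F.st b x) with hz
  have : (F.s b x - F.st b x) - (F.s a x - F.st a x) = -z := by rw [hz]; ring
  rw [this]
  have h1 : exp z * exp (-z) = 1 := by rw [← Complex.exp_add, add_neg_cancel, exp_zero]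
  linear_combination -h1

theorem e_ne_zero {a b : ℤ} {x : ℝ} (h : F.e a b x ≠ 0) : F.e b a x ≠ 0 := by
  intro e
  have := F.e_symm a b x
  rw [e, mul_zero, add_zero] at this
  exact h this

theorem inv_e {a b : ℤ} {x : ℝ} (h : F.e a b x ≠ 0) : (F.e b a x)⁻¹ = 1 - (F.e a b x)⁻¹ := by
  have h' := F.e_ne_zero h
  have := F.e_symm a b x
  field_simp
  linear_combination this

end Fields

/-! ### The constraints, the equations and the linear problem -/

namespace IsFieldsOf

variable {F : Fields} (hF : IsFieldsOf κ N p S m J u F) (h : IsDLSolution κ N p S m J u v)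
  {x : ℝ} (hx : x ∈ J)

include hF h hx

theorem first_constraint (hJ : IsOpen J) : FirstConstraint F N x := by
  obtain ⟨L, R, _, _, ⟨M⟩⟩ := exists_model_any h.admissible
  have hl : m ∈ ({m, m + 1} : Set ℤ) := by simp
  have h1 : ∀ n : ℤ, HasDerivAt (F.u n) (M.D.flux (M.r n m x) - M.D.flux (M.r (n + 1) m x) +
      (F.u (n + 1) x - F.u n x) * F.u n x) x := by
    intro n
    have := h.hasDerivAt_pot hJ M n hl hx
    rw [← hF.u_eq _ x hx, ← hF.u_eq _ x hx] at this
    refine this.congr_of_eventuallyEq ?_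
    filter_upwards [hJ.mem_nhds hx] with y hy using hF.u_eq n y hy
  have h2 := HasDerivAt.fun_sum (u := Finset.range N) fun i _ => h1 i
  refine h2.congr_deriv ?_
  rw [Finset.sum_add_distrib]
  -- The fluxes telescope to their difference between n = 0 and n = N, which vanishes by
  -- periodicity.
  have h3 := Finset.sum_range_sub' (fun i : ℕ => M.D.flux (M.r i m x)) N
  push_cast at h3
  rw [h3, ← M.flux_periodic (h.tau_ne 0 m hl x hx) (h.wave 0 m hl x hx)
    (h.tau_ne (0 + N) m hl x hx), zero_add, sub_self, zero_add]

variable {L R : Set ℂ} [CompactSpace L] [CompactSpace R] (M : Model κ N p S L R)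

theorem u_eq_model (n : ℤ) : F.u n x = M.D.u (M.r n m x) := by
  rw [hF.u_eq n x hx, M.pot_eq (h.tau_ne n m (by simp) x hx) (h.wave n m (by simp) x hx)]

theorem ut_eq_model (n : ℤ) : F.ut n x = M.D.u (M.r n (m + 1) x) := by
  rw [hF.ut_eq n x hx,
    M.pot_eq (h.tau_ne n (m + 1) (by simp) x hx) (h.wave n (m + 1) (by simp) x hx)]

theorem q_eq_model (n : ℤ) : F.q p n x =
    2 * p * (M.dom.lattice M.I).V (M.r n m x) * (M.dom.lattice M.I).Vs (M.r n (m + 1) x) := by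
  unfold Fields.q
  rw [hF.u_eq_model h hx M, hF.ut_eq_model h hx M]
  exact (M.dom.lattice M.I).u_sub_u (M.det_ne (h.tau_ne n m (by simp) x hx))
    (M.det_ne (h.tau_ne n (m + 1) (by simp) x hx)) (M.dom.pw_tilde M.I n m x)

/-- The exponentials of the primitives are tau functions, so e_{n+1,n} = 1 + Y_n/Ỹ_n by `det_shift`,
and `V_mul_Vs` factorizes it. -/
theorem e_eq_model (n : ℤ) : F.e (n + 1) n x =
    2 * (M.dom.lattice M.I).V (M.r n m x) *
      (M.dom.lattice M.I).Vs (M.r (n + 1) (m + 1) x) := by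
  set Λ := M.dom.lattice M.I
  have hd : ∀ n, ∀ l ∈ ({m, m + 1} : Set ℤ), M.D.det (M.r n l x) ≠ 0 := fun n l hl =>
    M.det_ne (h.tau_ne n l hl x hx)
  have hY : ∀ l ∈ ({m, m + 1} : Set ℤ),
      M.D.det (M.r (n + 1) l x) = M.D.det (M.r n l x) * Λ.Y (M.r n l x) := fun l hl =>
    M.D.det_shift (hd n l hl) Λ.a_ne Λ.ib Λ.b_ib (M.dom.pw_succ M.I n l x)
  have hm : m ∈ ({m, m + 1} : Set ℤ) := by simp
  have hm1 : m + 1 ∈ ({m, m + 1} : Set ℤ) := by simp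
  have key := Λ.V_mul_Vs (hd n m hm) (hd n (m + 1) hm1) (hd (n + 1) (m + 1) hm1)
    (M.dom.pw_tilde M.I n m x) (M.dom.pw_succ M.I n (m + 1) x)
  have hY1 : Λ.Y (M.r n (m + 1) x) ≠ 0 := by
    have := hd (n + 1) (m + 1) hm1
    rw [hY _ hm1] at this
    exact right_ne_zero_of_mul this
  have hs : ∀ n, exp (F.s n x) = M.D.det (M.r n m x) := fun n => by
    rw [hF.exp_s n x hx, M.dom.tau_eq_det M.rep]
  have hst : ∀ n, exp (F.st n x) = M.D.det (M.r n (m + 1) x) := fun n => by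
    rw [hF.exp_st n x hx, M.dom.tau_eq_det M.rep]
  refine mul_right_cancel₀ hY1 (Eq.trans ?_ key.symm)
  unfold Fields.e
  rw [exp_sub, exp_sub, exp_sub, hs, hs, hst, hst, hY _ hm, hY _ hm1]
  have h1 := hd n m hm
  have h2 := hd n (m + 1) hm1
  field_simp
  ring

variable (he : ∀ n : ℤ, F.e (n + 1) n x ≠ 0)

include he

theorem V_ne (n : ℤ) : (M.dom.lattice M.I).V (M.r n m x) ≠ 0 := by
  have := he n
  rw [hF.e_eq_model h hx M] at this
  exact right_ne_zero_of_mul (left_ne_zero_of_mul this)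

theorem Vs_ne (n : ℤ) : (M.dom.lattice M.I).Vs (M.r n (m + 1) x) ≠ 0 := by
  have := he (n - 1)
  rw [hF.e_eq_model h hx M, sub_add_cancel] at this
  exact right_ne_zero_of_mul this

/-- The factor Vs_{n+1} cancels. The remaining ratio of consecutive V telescopes in the second
constraint and is the coefficient c₂ in `discrete_lax`. -/
theorem q_div_e (n : ℤ) : F.q p (n + 1) x / F.e (n + 1) n x =
    p * (M.dom.lattice M.I).V (M.r (n + 1) m x) / (M.dom.lattice M.I).V (M.r n m x) := by
  have h1 := hF.V_ne h hx M he n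
  have h2 := hF.Vs_ne h hx M he (n + 1)
  rw [hF.q_eq_model h hx M, hF.e_eq_model h hx M]
  field_simp

theorem q_ne (hp : p ≠ 0) (n : ℤ) : F.q p n x ≠ 0 := by
  obtain ⟨L, R, _, _, ⟨M⟩⟩ := exists_model_any h.admissible
  rw [hF.q_eq_model h hx M]
  exact mul_ne_zero (mul_ne_zero (mul_ne_zero two_ne_zero hp) (hF.V_ne h hx M he n))
    (hF.Vs_ne h hx M he n)

theorem second_constraint : SecondConstraint F p N x := by
  obtain ⟨L, R, _, _, ⟨M⟩⟩ := exists_model_any h.admissible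
  unfold SecondConstraint
  simp only [hF.q_div_e h hx M he]
  have key : ∀ k : ℕ, ∏ n ∈ Finset.range k, p * (M.dom.lattice M.I).V (M.r (n + 1) m x) /
      (M.dom.lattice M.I).V (M.r n m x) =
      p ^ k * ((M.dom.lattice M.I).V (M.r (0 + k) m x) / (M.dom.lattice M.I).V (M.r 0 m x)) := by
    intro k
    induction k with
    | zero => simp [hF.V_ne h hx M he 0]
    | succ k ih =>
      rw [Finset.prod_range_succ, ih, zero_add, zero_add]
      have h1 := hF.V_ne h hx M he k
      have h2 := hF.V_ne h hx M he 0
      push_cast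
      field_simp
      ring
  have hl : m ∈ ({m, m + 1} : Set ℤ) := by simp
  rw [key, M.V_periodic (h.tau_ne 0 m hl x hx) (h.wave 0 m hl x hx)
    (h.tau_ne (0 + N) m hl x hx), div_self (hF.V_ne h hx M he 0), mul_one]

/-- q_n = 2p V_n Vs_n, so ∂ ln q_n splits into those of `V` and `Vs`. Each satisfies a linear
equation with one neighbour: V_{n+1}/V_n is recovered from q_{n+1}/e_{n+1,n} and Vs_{n-1}/Vs_n from
q_{n-1}/e_{n-1,n}. -/
theorem semi_discrete (hJ : IsOpen J) (hp : p ≠ 0) (n : ℤ) : SemiDiscreteEq F p n x := by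
  obtain ⟨L, R, _, _, ⟨M⟩⟩ := exists_model_any h.admissible
  have hm : m ∈ ({m, m + 1} : Set ℤ) := by simp
  have hm1 : m + 1 ∈ ({m, m + 1} : Set ℤ) := by simp
  have hd : ∀ n, ∀ l ∈ ({m, m + 1} : Set ℤ), M.D.det (M.r n l x) ≠ 0 := fun n l hl =>
    M.det_ne (h.tau_ne n l hl x hx)
  have hV := CauchyData.Lattice.hasDerivAt_V (Λ := M.dom.lattice M.I) (r := fun y => M.r n m y)
    (r' := fun y => M.r (n + 1) m y)
    (M.dom.hasDerivAt_pw M.I n m x) (hd n m hm) (hd (n + 1) m hm) (M.dom.pw_succ M.I n m x)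
  have hs := M.dom.pw_succ M.I (n - 1) (m + 1) x
  rw [sub_add_cancel] at hs
  have hVs := CauchyData.Lattice.hasDerivAt_Vs (Λ := M.dom.lattice M.I) (r := fun y => M.r (n - 1) (m + 1) y)
    (r' := fun y => M.r n (m + 1) y) (M.dom.hasDerivAt_pw M.I n (m + 1) x)
    (hd (n - 1) (m + 1) hm1) (hd n (m + 1) hm1) hs
  have hq : HasDerivAt (F.q p n) _ x := ((hV.const_mul (2 * p)).mul hVs).congr_of_eventuallyEq (by
    filter_upwards [hJ.mem_nhds hx] with y hy
    exact hF.q_eq_model h hy M n)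
  refine ⟨hF.q_ne h hx he hp n, _, hq, ?_⟩
  have e1 := hF.q_div_e h hx M he n
  have e2 : F.q p (n - 1) x / F.e (n - 1) n x = F.q p (n - 1) x -
      p * (M.dom.lattice M.I).Vs (M.r (n - 1) (m + 1) x) / (M.dom.lattice M.I).Vs (M.r n (m + 1) x) := by
    have h1 := he (n - 1)
    rw [sub_add_cancel] at h1
    rw [div_eq_mul_inv, F.inv_e h1, mul_sub, mul_one]
    have h2 := hF.e_eq_model h hx M (n - 1)
    rw [sub_add_cancel] at h2
    rw [h2, hF.q_eq_model h hx M (n - 1)]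
    have h3 := hF.V_ne h hx M he (n - 1)
    have h4 := hF.Vs_ne h hx M he n
    field_simp
  have e3 : F.q p n x = 2 * p + F.u n x - F.ut n x := rfl
  have e4 : F.q p (n - 1) x = 2 * p + F.u (n - 1) x - F.ut (n - 1) x := rfl
  have h3 := hF.V_ne h hx M he n
  have h4 := hF.Vs_ne h hx M he n
  rw [e1, e2, one_mul, e4]
  conv_lhs => rw [hF.q_eq_model h hx M]
  rw [e3]
  simp only [← hF.u_eq_model h hx M, ← hF.ut_eq_model h hx M]
  field_simp
  ring

end IsFieldsOf

end

/-- Quasi-periodicity makes the corner entry k^N act as the wrap-around of the index shift. -/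
theorem cyc_mulVec (N : ℕ) (k : ℂ) (φ : ℤ → ℂ) (h : φ N = k ^ N * φ 0) (i : Fin N) :
    (cyc N k).mulVec (fun i : Fin N => φ (i : ℕ)) i = φ ((i : ℕ) + 1) := by
  unfold cyc Matrix.mulVec dotProduct
  simp only [Matrix.of_apply, add_mul, Finset.sum_add_distrib]
  by_cases hi : (i : ℕ) + 1 = N
  · rw [Finset.sum_eq_zero, Finset.sum_eq_single (⟨0, by omega⟩ : Fin N)]
    · have : ((i : ℕ) : ℤ) + 1 = N := by exact_mod_cast hi
      simp [hi, this, h]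
    · intro j _ hj
      have : (j : ℕ) ≠ 0 := fun e => hj (Fin.ext e)
      simp [this]
    · simp
    · intro j _
      have : (j : ℕ) ≠ (i : ℕ) + 1 := by omega
      simp [this]
  · rw [Finset.sum_eq_single (⟨(i : ℕ) + 1, by omega⟩ : Fin N), Finset.sum_eq_zero]
    · simp
    · intro j _
      simp [hi]
    · intro j _ hj
      have : (j : ℕ) ≠ (i : ℕ) + 1 := fun e => hj (Fin.ext e)
      simp [this]
    · simp

section

variable {κ : Kind} {N : ℕ} {p : ℂ} {S : Spectral} {m : ℤ} {J : Set ℝ} {u v : WaveFamily}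

theorem IsFieldsOf.lax_pair {F : Fields} (hF : IsFieldsOf κ N p S m J u F)
    (h : IsDLSolution κ N p S m J u v) {x : ℝ} (hx : x ∈ J) (hJ : IsOpen J)
    (he : ∀ n : ℤ, F.e (n + 1) n x ≠ 0) {k : ℂ} (hk : k ∈ paramDomain p (κ.right N S)) :
    LaxPairHolds (genP N F.u k x) (genQ₁ N F p k x) (genQ₂ N F p k x)
      (Phi N u k m) (Phi N u k (m + 1)) x := by
  obtain ⟨L, R, _, _, M, hkL, c, hc⟩ := exists_model_left h.admissible hk
  set t : L × R := (⟨k, hkL⟩, ⟨c, hc⟩) with ht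
  have hm : m ∈ ({m, m + 1} : Set ℤ) := by simp
  have hm1 : m + 1 ∈ ({m, m + 1} : Set ℤ) := by simp
  have hd : ∀ n, ∀ l ∈ ({m, m + 1} : Set ℤ), M.D.det (M.r n l x) ≠ 0 := fun n l hl =>
    M.det_ne (h.tau_ne n l hl x hx)
  have hφ : ∀ n, ∀ l ∈ ({m, m + 1} : Set ℤ), ∀ y ∈ J,
      scalarWave u k n l y = rho p n l y k * M.D.w (M.r n l y) t := fun n l hl y hy =>
    M.wave_eq (h.tau_ne n l hl y hy) (h.wave n l hl y hy) t
  have hρ : ∀ n l (y : ℝ), rho p (n + 1) l y k = k * rho p n l y k := fun n l y => by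
    rw [rho_add _ _ _ _ hk.1, zpow_one]
  have hper : ∀ l ∈ ({m, m + 1} : Set ℤ),
      scalarWave u k N l x = k ^ N * scalarWave u k 0 l x := fun l hl => by
    simpa using h.periodic.phi_eq 0 l hl x hx k hk
  have hcyc : ∀ l ∈ ({m, m + 1} : Set ℤ), ∀ i : Fin N,
      (cyc N k).mulVec (Phi N u k l x) i = scalarWave u k ((i : ℕ) + 1) l x := fun l hl i =>
    cyc_mulVec N k (fun n => scalarWave u k n l x) (hper l hl) i
  constructor
  · rw [hasDerivAt_pi]
    intro i
    unfold genP
    rw [Matrix.add_mulVec, Pi.add_apply, hcyc m hm, Matrix.mulVec_diagonal]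
    set n : ℤ := ((i : ℕ) : ℤ)
    have h1 := CauchyData.hasDerivAt_G (M.dom.hasDerivAt_pw M.I n m x) (hd n m hm) 1
    have h2 := hasDerivAt_clm_comp (ContinuousMap.evalCLM ℂ t) h1
    have h3 : HasDerivAt (fun y : ℝ => rho p n m y k) (k * rho p n m x k) x := by
      have h4 : HasDerivAt (fun y : ℝ => exp (k * y) * rho p n m 0 k)
          (exp (k * x) * (k * 1) * rho p n m 0 k) x :=
        (((ofRealCLM.hasDerivAt (x := x)).const_mul k).cexp).mul_const _
      rw [rho_eq_exp p k n m x]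
      refine (h4.congr_of_eventuallyEq (Filter.Eventually.of_forall fun y =>
        rho_eq_exp p k n m y)).congr_deriv ?_
      ring
    have h5 := h3.mul h2
    have h6 : HasDerivAt (fun y => Phi N u k m y i) _ x := h5.congr_of_eventuallyEq (by
      filter_upwards [hJ.mem_nhds hx] with y hy
      exact hφ n m hm y hy)
    refine h6.congr_deriv ?_
    rw [mul_one, CauchyData.Lattice.G_a (hd n m hm) (hd (n + 1) m hm)
      (M.dom.pw_succ M.I n m x)]
    have e1 : Phi N u k m x i = rho p n m x k * M.D.w (M.r n m x) t := hφ n m hm x hx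
    rw [e1, hφ (n + 1) m hm x hx, hρ, hF.u_eq_model h hx M, hF.u_eq_model h hx M]
    change k * rho p n m x k * M.D.w (M.r n m x) t + rho p n m x k *
      (k * M.D.w (M.r (n + 1) m x) t + M.D.u (M.r (n + 1) m x) * M.D.w (M.r n m x) t -
        k * M.D.w (M.r n m x) t - M.D.u (M.r n m x) * M.D.w (M.r n m x) t) = _
    ring
  · funext i
    unfold genQ₁ genQ₂
    rw [Matrix.sub_mulVec, Matrix.add_mulVec, Pi.sub_apply, Pi.add_apply, hcyc m hm,
      hcyc (m + 1) hm1, Matrix.mulVec_diagonal, Matrix.mulVec_diagonal]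
    set n : ℤ := ((i : ℕ) : ℤ)
    have e1 : Phi N u k m x i = rho p n m x k * M.D.w (M.r n m x) t := hφ n m hm x hx
    have e2 : Phi N u k (m + 1) x i = rho p n (m + 1) x k * M.D.w (M.r n (m + 1) x) t :=
      hφ n (m + 1) hm1 x hx
    have hV := hF.V_ne h hx M he n
    -- The two coefficients add up to q_{n+1} because 1/e_{n,n+1} + 1/e_{n+1,n} = 1. Multiplication
    -- by ρ̃ then absorbs Λ⁻¹, since ρ̃ Λ⁻¹ = ρ.
    have key := (M.dom.lattice M.I).discrete_lax (hd n m hm) (hd (n + 1) m hm)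
      (hd n (m + 1) hm1) (hd (n + 1) (m + 1) hm1) (M.dom.pw_succ M.I n m x)
      (M.dom.pw_succ M.I n (m + 1) x) (M.dom.pw_tilde M.I n m x) hV
      (c₁ := F.q p (n + 1) x / F.e n (n + 1) x) (c₂ := F.q p (n + 1) x / F.e (n + 1) n x)
      (by rw [hF.q_div_e h hx M he]; field_simp)
      (by
        rw [← hF.u_eq_model h hx M, ← hF.ut_eq_model h hx M, div_eq_mul_inv, div_eq_mul_inv,
          F.inv_e (he n)]
        unfold Fields.q
        ring)
    have key' := congrArg (fun f : C(L × R, ℂ) => f t) key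
    change F.q p (n + 1) x / F.e n (n + 1) x * M.D.w (M.r n (m + 1) x) t -
      k * M.D.w (M.r (n + 1) (m + 1) x) t = (M.dom.lattice M.I).ilam t *
      (F.q p (n + 1) x / F.e (n + 1) n x * M.D.w (M.r n m x) t +
        k * M.D.w (M.r (n + 1) m x) t) at key'
    have hpk : p + k ≠ 0 := fun e => hk.2.2.1 (eq_neg_of_add_eq_zero_right e)
    have hl : rho p n (m + 1) x k * (M.dom.lattice M.I).ilam t = rho p n m x k := by
      refine mul_left_cancel₀ hpk ?_
      have h1 : (p + k) * (M.dom.lattice M.I).ilam t = p - k := (M.dom.lattice M.I).ilam_eq t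
      have h2 := rho_shift n m x (p := p) (k := k) ⟨hk.2.1, hk.2.2.1⟩
      linear_combination rho p n (m + 1) x k * h1 + h2
    rw [e1, e2, hφ (n + 1) m hm x hx, hφ (n + 1) (m + 1) hm1 x hx, hρ, hρ]
    linear_combination rho p n (m + 1) x k * key' + (F.q p (n + 1) x / F.e (n + 1) n x *
      M.D.w (M.r n m x) t + k * M.D.w (M.r (n + 1) m x) t) * hl

theorem IsDLSolution.reduced_system (hp : p ≠ 0) (hJ : IsOpen J) (hJ' : J.OrdConnected)
    (h : IsDLSolution κ N p S m J u v) : ReducedSystem κ N p S m J u :=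
  ⟨h.exists_fields hJ hJ', fun _ hF _ hx => ⟨hF.first_constraint h hx hJ, fun he =>
    ⟨hF.second_constraint h hx he, hF.semi_discrete h hx he hJ hp, fun _ hk =>
      hF.lax_pair h hx hJ he hk⟩⟩⟩

end

/-! ### Compatibility of the linear problem -/

section LaxAlgebra

variable {N : ℕ}

theorem cyc_mul_diagonal (k : ℂ) (a : ℤ → ℂ) (ha : a N = a 0) :
    cyc N k * Matrix.diagonal (fun i : Fin N => a (i : ℕ)) =
      Matrix.diagonal (fun i : Fin N => a ((i : ℕ) + 1)) * cyc N k := by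
  ext i j
  rw [Matrix.mul_diagonal, Matrix.diagonal_mul]
  unfold cyc
  rw [Matrix.of_apply]
  by_cases h1 : (j : ℕ) = (i : ℕ) + 1
  · have h2 : (i : ℕ) + 1 ≠ N := by omega
    have h3 : ((j : ℕ) : ℤ) = (i : ℕ) + 1 := by exact_mod_cast h1
    simp only [h1, h2, if_true, false_and, if_false, add_zero, one_mul, mul_one]
    norm_cast
  · by_cases h2 : (i : ℕ) + 1 = N ∧ (j : ℕ) = 0
    · have h3 : ((i : ℕ) : ℤ) + 1 = N := by exact_mod_cast h2.1
      have h4 : ((j : ℕ) : ℤ) = 0 := by exact_mod_cast h2.2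
      rw [if_neg h1, if_pos h2, h3, h4, ha]
      ring
    · rw [if_neg h1, if_neg h2]
      ring

/-- Factorization of `Q₁' + Q₁ P̃` for bidiagonal cyclic matrices. -/
theorem bidiagonal_sub_factor (k : ℂ) (a d a' : ℤ → ℂ) (c : Fin N → ℂ) (ha : a N = a 0)
    (hd : d N = d 0)
    (hc : ∀ i : Fin N, c i = a ((i : ℕ) + 1) - a (i : ℕ) + d ((i : ℕ) + 1)) :
    Matrix.diagonal (fun i : Fin N => a' (i : ℕ)) +
      (Matrix.diagonal (fun i : Fin N => a (i : ℕ)) - cyc N k) *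
        (Matrix.diagonal (fun i : Fin N => d (i : ℕ)) + cyc N k) =
    (Matrix.diagonal c + cyc N k) * (Matrix.diagonal (fun i : Fin N => a (i : ℕ)) - cyc N k) +
      Matrix.diagonal (fun i : Fin N => a' (i : ℕ) + a (i : ℕ) * d (i : ℕ) - c i * a (i : ℕ)) := by
  -- Moving `cyc` across a diagonal matrix shifts its index. The choice of `c` balances the terms
  -- linear in `cyc`, the quadratic ones agree, and only a diagonal remainder is left.
  have e1 : Matrix.diagonal c = Matrix.diagonal (fun i : Fin N => a ((i : ℕ) + 1)) -
      Matrix.diagonal (fun i : Fin N => a (i : ℕ)) +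
      Matrix.diagonal (fun i : Fin N => d ((i : ℕ) + 1)) := by
    rw [Matrix.diagonal_sub, Matrix.diagonal_add]
    exact congrArg _ (funext hc)
  have e2 : Matrix.diagonal (fun i : Fin N => a' (i : ℕ) + a (i : ℕ) * d (i : ℕ) -
      c i * a (i : ℕ)) = Matrix.diagonal (fun i : Fin N => a' (i : ℕ)) +
      Matrix.diagonal (fun i : Fin N => a (i : ℕ)) * Matrix.diagonal (fun i : Fin N => d (i : ℕ)) -
      Matrix.diagonal c * Matrix.diagonal (fun i : Fin N => a (i : ℕ)) := by
    rw [Matrix.diagonal_mul_diagonal, Matrix.diagonal_mul_diagonal, Matrix.diagonal_add,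
      Matrix.diagonal_sub]
  have e3 := cyc_mul_diagonal k a ha
  have e4 := cyc_mul_diagonal k d hd
  rw [e2]
  simp only [mul_add, mul_sub, add_mul, sub_mul, e3, e4]
  rw [e1]
  simp only [add_mul, sub_mul]
  abel

/-- Factorization of `Q₂' + Q₂ P` for bidiagonal cyclic matrices. -/
theorem bidiagonal_add_factor (k : ℂ) (b d b' : ℤ → ℂ) (c : Fin N → ℂ) (hb : b N = b 0)
    (hd : d N = d 0)
    (hc : ∀ i : Fin N, c i = b (i : ℕ) - b ((i : ℕ) + 1) + d ((i : ℕ) + 1)) :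
    Matrix.diagonal (fun i : Fin N => b' (i : ℕ)) +
      (Matrix.diagonal (fun i : Fin N => b (i : ℕ)) + cyc N k) *
        (Matrix.diagonal (fun i : Fin N => d (i : ℕ)) + cyc N k) =
    (Matrix.diagonal c + cyc N k) * (Matrix.diagonal (fun i : Fin N => b (i : ℕ)) + cyc N k) +
      Matrix.diagonal (fun i : Fin N => b' (i : ℕ) + b (i : ℕ) * d (i : ℕ) - c i * b (i : ℕ)) := by
  have e1 : Matrix.diagonal c = Matrix.diagonal (fun i : Fin N => b (i : ℕ)) -
      Matrix.diagonal (fun i : Fin N => b ((i : ℕ) + 1)) +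
      Matrix.diagonal (fun i : Fin N => d ((i : ℕ) + 1)) := by
    rw [Matrix.diagonal_sub, Matrix.diagonal_add]
    exact congrArg _ (funext hc)
  have e2 : Matrix.diagonal (fun i : Fin N => b' (i : ℕ) + b (i : ℕ) * d (i : ℕ) -
      c i * b (i : ℕ)) = Matrix.diagonal (fun i : Fin N => b' (i : ℕ)) +
      Matrix.diagonal (fun i : Fin N => b (i : ℕ)) * Matrix.diagonal (fun i : Fin N => d (i : ℕ)) -
      Matrix.diagonal c * Matrix.diagonal (fun i : Fin N => b (i : ℕ)) := by
    rw [Matrix.diagonal_mul_diagonal, Matrix.diagonal_mul_diagonal, Matrix.diagonal_add,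
      Matrix.diagonal_sub]
  have e3 := cyc_mul_diagonal k b hb
  have e4 := cyc_mul_diagonal k d hd
  rw [e2]
  simp only [mul_add, add_mul, e3, e4]
  rw [e1]
  simp only [add_mul, sub_mul]
  abel

theorem isZGraded_bidiagonal (d : Fin N → ℂ) (c : ℂ) :
    IsZGraded fun k => Matrix.diagonal d + c • cyc N k := by
  refine ⟨Matrix.diagonal d, c • cyc N 1, fun i j h => ?_, fun i j h => ?_, fun k i j => ?_⟩
  · by_cases hij : i = j
    · rw [hij]
    · exact absurd (Matrix.diagonal_apply_ne _ hij) h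
  · unfold cyc at h
    rw [Matrix.smul_apply, Matrix.of_apply] at h
    by_cases h1 : (j : ℕ) = (i : ℕ) + 1
    · rw [h1]
    · by_cases h2 : (i : ℕ) + 1 = N ∧ (j : ℕ) = 0
      · rw [h2.1, h2.2]
        exact (Nat.modEq_zero_iff_dvd.2 dvd_rfl).symm
      · rw [if_neg h1, if_neg h2, add_zero, smul_zero] at h
        exact absurd rfl h
  · have h0 : k ^ (j : ℕ) * Matrix.diagonal d i j = k ^ (i : ℕ) * Matrix.diagonal d i j := by
      by_cases hij : i = j
      · rw [hij]
      · rw [Matrix.diagonal_apply_ne _ hij, mul_zero, mul_zero]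
    have h1 : k ^ (j : ℕ) * cyc N k i j = k ^ (i : ℕ) * (k * cyc N 1 i j) := by
      unfold cyc
      rw [Matrix.of_apply, Matrix.of_apply]
      by_cases h1 : (j : ℕ) = (i : ℕ) + 1
      · have h2 : (i : ℕ) + 1 ≠ N := by omega
        rw [if_pos h1, if_neg fun h => h2 h.1, if_neg fun h => h2 h.1, h1]
        ring
      · by_cases h2 : (i : ℕ) + 1 = N ∧ (j : ℕ) = 0
        · have h3 : k ^ N = k ^ (i : ℕ) * k := by rw [← pow_succ, h2.1]
          rw [if_neg h1, if_pos h2, if_pos h2, h2.2, h3]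
          ring
        · rw [if_neg h1, if_neg h2, if_neg h2]
          ring
    change k ^ (j : ℕ) * (Matrix.diagonal d i j + c * cyc N k i j) =
      k ^ (i : ℕ) * (Matrix.diagonal d i j + k * (c * cyc N 1 i j))
    linear_combination h0 + c * h1

end LaxAlgebra

/-- All fields have period `N` in the discrete index. -/
structure Fields.IsPeriodic (F : Fields) (N : ℕ) : Prop where
  u_eq : ∀ n, F.u (n + N) = F.u n
  ut_eq : ∀ n, F.ut (n + N) = F.ut n
  s_eq : ∀ n, F.s (n + N) = F.s n
  st_eq : ∀ n, F.st (n + N) = F.st n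

namespace Fields

variable {F : Fields} {N : ℕ} {p : ℂ} {x : ℝ}

theorem IsPeriodic.q_eq (hF : F.IsPeriodic N) (n : ℤ) : F.q p (n + N) = F.q p n := by
  funext y
  unfold q
  rw [hF.u_eq, hF.ut_eq]

theorem IsPeriodic.e_eq (hF : F.IsPeriodic N) (a b : ℤ) : F.e (a + N) (b + N) = F.e a b := by
  funext y
  unfold e
  rw [hF.s_eq, hF.s_eq, hF.st_eq, hF.st_eq]

theorem hasDerivAt_e {a b : ℤ} (ha : F.IsPrimitiveAt a x) (hb : F.IsPrimitiveAt b x) :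
    HasDerivAt (F.e a b) ((F.e a b x - 1) * (F.q p a x - F.q p b x)) x := by
  have := ((ha.1.sub ha.2).sub (hb.1.sub hb.2)).cexp.const_add 1
  refine this.congr_deriv ?_
  unfold e q
  simp only [Pi.sub_apply]
  ring

/-- The obstruction to compatibility is the semi-discrete equation. -/
theorem laxCompatible_iff (hF : F.IsPeriodic N) (hN : 0 < N)
    (hu : ∀ n, DifferentiableAt ℝ (F.u n) x) (hut : ∀ n, DifferentiableAt ℝ (F.ut n) x)
    (hp : ∀ n, F.IsPrimitiveAt n x) (hq : ∀ n, F.q p n x ≠ 0) (he : ∀ n, F.e (n + 1) n x ≠ 0) :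
    (∀ n, SemiDiscreteEq F p n x) ↔
      ∀ k : ℂ, LaxCompatible (genP N F.u k) (genP N F.ut k) (genQ₁ N F p k) (genQ₂ N F p k) x := by
  have he' : ∀ n, F.e n (n + 1) x ≠ 0 := fun n => F.e_ne_zero (he n)
  have hinv : ∀ n, (F.e n (n + 1) x)⁻¹ = 1 - (F.e (n + 1) n x)⁻¹ := fun n => F.inv_e (he n)
  have hq' : ∀ n, HasDerivAt (F.q p n) (deriv (F.u n) x - deriv (F.ut n) x) x := fun n =>
    ((hu n).hasDerivAt.const_add (2 * p)).sub (hut n).hasDerivAt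
  set q' : ℤ → ℂ := fun n => deriv (F.u n) x - deriv (F.ut n) x
  let a : ℤ → ℂ := fun n => F.q p (n + 1) x / F.e n (n + 1) x
  let b : ℤ → ℂ := fun n => F.q p (n + 1) x / F.e (n + 1) n x
  let d : ℤ → ℂ := fun n => F.u (n + 1) x - F.u n x
  let dt : ℤ → ℂ := fun n => F.ut (n + 1) x - F.ut n x
  -- The defect of the semi-discrete equation at n.
  let η : ℤ → ℂ := fun n => q' n / F.q p n x -
    (F.u (n + 1) x - 2 * F.u n x + F.u (n - 1) x + F.q p n x
      - F.q p (n + 1) x / F.e (n + 1) n x - F.q p (n - 1) x / F.e (n - 1) n x)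
  let c : ℤ → ℂ := fun n => a (n + 1) - a n + dt (n + 1)
  -- The derivatives of a and b, written through η so that the remainders of the two factorizations
  -- come out as a η and b η; `hA` and `hB` match this with the quotient rule.
  let a' : ℤ → ℂ := fun n => a n * (η (n + 1) + c n - dt n)
  let b' : ℤ → ℂ := fun n => b n * (η (n + 1) + c n - d n)
  have hab : ∀ n, a n + b n = F.q p (n + 1) x := fun n => by
    simp only [a, b, div_eq_mul_inv, hinv]; ring
  have hA : ∀ n, η (n + 1) + c n - dt n = q' (n + 1) / F.q p (n + 1) x -
      (1 - (F.e n (n + 1) x)⁻¹) * (F.q p n x - F.q p (n + 1) x) := fun n => by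
    simp only [η, c, a, dt, add_sub_cancel_right, div_eq_mul_inv, hinv]
    generalize q' (n + 1) * (F.q p (n + 1) x)⁻¹ = Q
    simp only [q]
    ring
  have hB : ∀ n, η (n + 1) + c n - d n = q' (n + 1) / F.q p (n + 1) x -
      (1 - (F.e (n + 1) n x)⁻¹) * (F.q p (n + 1) x - F.q p n x) := fun n => by
    simp only [η, c, a, d, dt, add_sub_cancel_right, div_eq_mul_inv, hinv]
    generalize q' (n + 1) * (F.q p (n + 1) x)⁻¹ = Q
    simp only [q]
    ring
  have ha' : ∀ n, HasDerivAt (fun y => F.q p (n + 1) y / F.e n (n + 1) y) (a' n) x := fun n => by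
    refine ((hq' (n + 1)).div (hasDerivAt_e (p := p) (hp n) (hp (n + 1))) (he' n)).congr_deriv ?_
    have h1 := hq (n + 1)
    have h2 := he' n
    change _ = F.q p (n + 1) x / F.e n (n + 1) x * (η (n + 1) + c n - dt n)
    rw [hA]
    simp only [q']
    field_simp
  have hb' : ∀ n, HasDerivAt (fun y => F.q p (n + 1) y / F.e (n + 1) n y) (b' n) x := fun n => by
    refine ((hq' (n + 1)).div (hasDerivAt_e (p := p) (hp (n + 1)) (hp n)) (he n)).congr_deriv ?_
    have h1 := hq (n + 1)
    have h2 := he n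
    change _ = F.q p (n + 1) x / F.e (n + 1) n x * (η (n + 1) + c n - d n)
    rw [hB]
    simp only [q']
    field_simp
  have hsd : (∀ n, SemiDiscreteEq F p n x) ↔ ∀ i : Fin N, η ((i : ℕ) + 1) = 0 := by
    have h1 : ∀ n, SemiDiscreteEq F p n x ↔ η n = 0 := fun n => by
      unfold SemiDiscreteEq LogDerivEq
      constructor
      · rintro ⟨-, f', hf', h⟩
        rw [hf'.unique (hq' n), one_mul] at h
        exact sub_eq_zero.2 h
      · intro h
        exact ⟨hq n, _, hq' n, by rw [one_mul]; exact sub_eq_zero.1 h⟩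
    have hη : Function.Periodic η N := fun n => by
      have s1 : n + N + 1 = n + 1 + N := by ring
      have s2 : n + N - 1 = n - 1 + N := by ring
      simp only [η, q', s1, s2, hF.u_eq, hF.ut_eq, hF.q_eq, hF.e_eq]
    simp only [h1]
    refine ⟨fun h i => h _, fun h n => ?_⟩
    have hN' : (0 : ℤ) < N := by exact_mod_cast hN
    have h2 := Int.emod_nonneg (n - 1) hN'.ne'
    have h3 := Int.emod_lt_of_pos (n - 1) hN'
    have h4 := h ⟨((n - 1) % N).toNat, by omega⟩
    have h5 : (((n - 1) % N).toNat : ℤ) = (n - 1) % N := Int.toNat_of_nonneg h2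
    simp only [h5] at h4
    rw [← h4]
    have h6 : n = (n - 1) % N + 1 + ((n - 1) / N) * N := by
      have := Int.emod_add_mul_ediv (n - 1) N
      linarith [mul_comm (N : ℤ) ((n - 1) / N)]
    conv_lhs => rw [h6]
    exact (hη.int_mul ((n - 1) / N)) _
  have haN : a N = a 0 := by
    have := hF.q_eq (p := p) 1
    have h2 := hF.e_eq 0 1
    rw [zero_add] at h2
    simp only [a]
    rw [show (N : ℤ) + 1 = 1 + N by ring, this, h2, zero_add]
  have hbN : b N = b 0 := by
    have := hF.q_eq (p := p) 1
    have h2 := hF.e_eq 1 0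
    rw [zero_add] at h2
    simp only [b]
    rw [show (N : ℤ) + 1 = 1 + N by ring, this, h2, zero_add]
  have hdN : d N = d 0 := by
    have h1 := hF.u_eq 1
    have h2 := hF.u_eq 0
    rw [zero_add] at h2
    simp only [d]
    rw [show (N : ℤ) + 1 = 1 + N by ring, h1, h2, zero_add]
  have hdtN : dt N = dt 0 := by
    have h1 := hF.ut_eq 1
    have h2 := hF.ut_eq 0
    rw [zero_add] at h2
    simp only [dt]
    rw [show (N : ℤ) + 1 = 1 + N by ring, h1, h2, zero_add]
  have hcb : ∀ n, c n = b n - b (n + 1) + d (n + 1) := fun n => by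
    have h1 := hab n
    have h2 := hab (n + 1)
    simp only [c, d, dt]
    simp only [q] at h1 h2
    linear_combination h2 - h1
  have hD₁ : ∀ (k : ℂ) (i j : Fin N), HasDerivAt (fun y => genQ₁ N F p k y i j)
      (Matrix.diagonal (fun i : Fin N => a' (i : ℕ)) i j) x := fun k i j => by
    refine HasDerivAt.sub_const (c := cyc N k i j) ?_
    by_cases hij : i = j
    · subst hij
      simpa only [Matrix.diagonal_apply_eq] using ha' _
    · simpa only [Matrix.diagonal_apply_ne _ hij] using hasDerivAt_const x (0 : ℂ)
  have hD₂ : ∀ (k : ℂ) (i j : Fin N), HasDerivAt (fun y => genQ₂ N F p k y i j)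
      (Matrix.diagonal (fun i : Fin N => b' (i : ℕ)) i j) x := fun k i j => by
    refine HasDerivAt.add_const (c := cyc N k i j) ?_
    by_cases hij : i = j
    · subst hij
      simpa only [Matrix.diagonal_apply_eq] using hb' _
    · simpa only [Matrix.diagonal_apply_ne _ hij] using hasDerivAt_const x (0 : ℂ)
  have f₁ : ∀ k : ℂ, Matrix.diagonal (fun i : Fin N => a' (i : ℕ)) + genQ₁ N F p k x *
      genP N F.ut k x = (Matrix.diagonal (fun i : Fin N => c (i : ℕ)) + cyc N k) *
        genQ₁ N F p k x + Matrix.diagonal fun i : Fin N => a (i : ℕ) * η ((i : ℕ) + 1) := fun k => by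
    refine (bidiagonal_sub_factor k a dt a' (fun i => c (i : ℕ)) haN hdtN fun i => rfl).trans ?_
    refine congrArg₂ _ rfl (congrArg _ (funext fun i => ?_))
    simp only [a']
    ring
  have f₂ : ∀ k : ℂ, Matrix.diagonal (fun i : Fin N => b' (i : ℕ)) + genQ₂ N F p k x *
      genP N F.u k x = (Matrix.diagonal (fun i : Fin N => c (i : ℕ)) + cyc N k) *
        genQ₂ N F p k x + Matrix.diagonal fun i : Fin N => b (i : ℕ) * η ((i : ℕ) + 1) := fun k => by
    refine (bidiagonal_add_factor k b d b' (fun i => c (i : ℕ)) hbN hdN fun i => hcb _).trans ?_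
    refine congrArg₂ _ rfl (congrArg _ (funext fun i => ?_))
    simp only [b']
    ring
  rw [hsd]
  constructor
  · intro h k
    refine ⟨_, _, hD₁ k, hD₂ k, fun X Y hXY => ?_⟩
    have hz : ∀ f : ℤ → ℂ, Matrix.diagonal (fun i : Fin N => f (i : ℕ) * η ((i : ℕ) + 1)) = 0 := by
      intro f
      simp only [h, mul_zero]
      exact Matrix.diagonal_zero
    rw [f₁, f₂, hz, hz, add_zero, add_zero, ← Matrix.mulVec_mulVec, ← Matrix.mulVec_mulVec, hXY]
  · intro h i
    obtain ⟨D₁, D₂, h₁, h₂, hD⟩ := h 1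
    have e₁ : D₁ = Matrix.diagonal (fun i : Fin N => a' (i : ℕ)) := by
      ext i j; exact (h₁ i j).unique (hD₁ 1 i j)
    have e₂ : D₂ = Matrix.diagonal (fun i : Fin N => b' (i : ℕ)) := by
      ext i j; exact (h₂ i j).unique (hD₂ 1 i j)
    -- Test vectors at k = 1. Since a + b = q, they satisfy aX - bY = 1 and X + Y = 1; together
    -- these give Q₁X = Q₂Y, and compatibility applied to this pair reads η = 0 in each component.
    let X : ℤ → ℂ := fun n => (1 + b n) / F.q p (n + 1) x
    let Y : ℤ → ℂ := fun n => (a n - 1) / F.q p (n + 1) x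
    have hq1 : F.q p (N + 1) x = F.q p (0 + 1) x := by
      rw [show (N : ℤ) + 1 = 0 + 1 + N by ring, hF.q_eq]
    have hX : X N = 1 ^ N * X 0 := by simp only [X, hbN, one_pow, one_mul, hq1]
    have hY : Y N = 1 ^ N * Y 0 := by simp only [Y, haN, one_pow, one_mul, hq1]
    have hXY : ∀ n, a n * X n - b n * Y n = 1 := fun n => by
      have h1 := hq (n + 1)
      have h2 := hab n
      simp only [X, Y]
      field_simp
      linear_combination h2
    have hXY' : ∀ n, X n + Y n = 1 := fun n => by
      have h1 := hq (n + 1)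
      have h2 := hab n
      simp only [X, Y]
      field_simp
      linear_combination h2
    have hQ : (genQ₁ N F p 1 x).mulVec (fun i : Fin N => X (i : ℕ)) =
        (genQ₂ N F p 1 x).mulVec (fun i : Fin N => Y (i : ℕ)) := by
      funext i
      unfold genQ₁ genQ₂
      rw [Matrix.sub_mulVec, Matrix.add_mulVec, Pi.sub_apply, Pi.add_apply,
        cyc_mulVec N 1 X hX, cyc_mulVec N 1 Y hY, Matrix.mulVec_diagonal, Matrix.mulVec_diagonal]
      change a (i : ℕ) * X (i : ℕ) - _ = b (i : ℕ) * Y (i : ℕ) + _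
      linear_combination hXY (i : ℕ) - hXY' ((i : ℕ) + 1)
    have key := congrFun (hD _ _ hQ) i
    rw [e₁, e₂, f₁, f₂, Matrix.add_mulVec, Matrix.add_mulVec, ← Matrix.mulVec_mulVec,
      ← Matrix.mulVec_mulVec, hQ, Pi.add_apply, Pi.add_apply, add_right_inj,
      Matrix.mulVec_diagonal, Matrix.mulVec_diagonal] at key
    linear_combination key - η ((i : ℕ) + 1) * hXY (i : ℕ)

end Fields

/-! ### Folding the discrete index -/

/-- The fields `u_{φ(n)}`. -/
def Fields.fold (F : Fields) (φ : ℤ → ℤ) : Fields :=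
  ⟨fun n => F.u (φ n), fun n => F.ut (φ n), fun n => F.s (φ n), fun n => F.st (φ n)⟩

namespace Fields

variable (F : Fields) (φ : ℤ → ℤ) (p : ℂ)

theorem fold_u (n : ℤ) : (F.fold φ).u n = F.u (φ n) := rfl

theorem fold_q (n : ℤ) : (F.fold φ).q p n = F.q p (φ n) := rfl

theorem fold_e (a b : ℤ) : (F.fold φ).e a b = F.e (φ a) (φ b) := rfl

theorem fold_periodic {N : ℕ} (h : ∀ n, φ (n + N) = φ n) : (F.fold φ).IsPeriodic N :=
  ⟨fun n => congrArg F.u (h n), fun n => congrArg F.ut (h n), fun n => congrArg F.s (h n),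
    fun n => congrArg F.st (h n)⟩

end Fields

/-- Reduction of the index modulo `n ↦ n + N` and `n ↦ M - n`, for `N - 1 ≤ M ≤ N`. -/
def foldIdx (N M n : ℤ) : ℤ := min (n % N) (M - n % N)

theorem foldIdx_add (N : ℕ) (M n : ℤ) : foldIdx N M (n + N) = foldIdx N M n := by
  unfold foldIdx
  rw [Int.add_emod_right]

theorem foldIdx_invariant {α : Type*} {f : ℤ → α} {N M : ℤ} (h : ∀ n, f (n + N) = f n)
    (h' : ∀ n, f (M - n) = f n) (n : ℤ) : f (foldIdx N M n) = f n := by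
  have e : f (n % N) = f n := by
    have hp : Function.Periodic f N := h
    conv_rhs => rw [← Int.emod_add_mul_ediv n N, mul_comm]
    exact (hp.int_mul (n / N) (n % N)).symm
  unfold foldIdx
  rcases min_choice (n % N) (M - n % N) with h1 | h1 <;> rw [h1]
  · exact e
  · rw [h', e]

theorem foldIdx_forall {N M : ℤ} (hN : 0 < N) {P : ℤ → ℤ → ℤ → Prop} :
    (∀ n, P (foldIdx N M (n - 1)) (foldIdx N M n) (foldIdx N M (n + 1))) ↔
      ∀ n, 0 ≤ n → n < N → P (foldIdx N M (n - 1)) (foldIdx N M n) (foldIdx N M (n + 1)) := by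
  refine ⟨fun h n _ _ => h n, fun h n => ?_⟩
  have h1 := h (n % N) (Int.emod_nonneg n hN.ne') (Int.emod_lt_of_pos n hN)
  unfold foldIdx at h1 ⊢
  rwa [Int.emod_add_emod, Int.emod_sub_emod, Int.emod_emod_of_dvd n dvd_rfl] at h1

section

variable {κ : Kind} {N : ℕ} {p : ℂ} {S : Spectral} {m : ℤ} {J : Set ℝ} {u v : WaveFamily}

/-- Folded primitives need not equal the original ones, but their exponentials and derivatives agree
with those prescribed by τ and u. The folded fields therefore belong to the same solution, and the
general results apply to them. -/
theorem IsFieldsOf.fold {F : Fields} (hF : IsFieldsOf κ N p S m J u F) {φ : ℤ → ℤ}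
    (hτ : ∀ n, ∀ l ∈ ({m, m + 1} : Set ℤ), ∀ x ∈ J,
      tau (κ.zeta N S) p (φ n) l x = tau (κ.zeta N S) p n l x)
    (hu : ∀ n, ∀ l ∈ ({m, m + 1} : Set ℤ), ∀ x ∈ J,
      pot (κ.zeta N S) p u (φ n) l x = pot (κ.zeta N S) p u n l x) :
    IsFieldsOf κ N p S m J u (F.fold φ) where
  u_eq n x hx := (hF.u_eq _ x hx).trans (hu n m (by simp) x hx)
  ut_eq n x hx := (hF.ut_eq _ x hx).trans (hu n (m + 1) (by simp) x hx)
  exp_s n x hx := (hF.exp_s _ x hx).trans (hτ n m (by simp) x hx)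
  exp_st n x hx := (hF.exp_st _ x hx).trans (hτ n (m + 1) (by simp) x hx)
  prim n x hx := hF.prim _ x hx

/-- The reflection about c may be composed with one period; this puts the centre M in the range
where `foldIdx` picks a fundamental domain. -/
theorem IsFieldsOf.foldIdx {F : Fields} (hF : IsFieldsOf κ N p S m J u F)
    (h : IsDLSolution κ N p S m J u v) {c M : ℤ} (hs : SymmetricReduction κ N c p S m J u)
    (hM : M = c ∨ M = N + c) : IsFieldsOf κ N p S m J u (F.fold (foldIdx N M)) := by
  have key : ∀ f : ℤ → ℂ, (∀ n, f (n + N) = f n) → (∀ n, f (c - n) = f n) →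
      ∀ n, f (SemiDS.foldIdx N M n) = f n := fun f h1 h2 n => by
    refine foldIdx_invariant h1 (fun n => ?_) n
    rcases hM with rfl | rfl
    · exact h2 n
    · rw [show N + c - n = c - n + N by ring, h1, h2]
  exact hF.fold (fun n l _ x _ => key (fun n => tau (κ.zeta N S) p n l x)
      (fun n => h.periodic.tau_eq n l x) (fun n => hs.tau_eq n l x) n)
    fun n l hl x hx => key (fun n => pot (κ.zeta N S) p u n l x)
      (fun n => h.periodic.pot_eq n l hl x hx) (fun n => hs.pot_eq n l hl x hx) n

/-- The reduced system in terms of folded fields. -/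
theorem IsFieldsOf.folded_system {F : Fields} {φ : ℤ → ℤ} (hJ : IsOpen J) (hp : p ≠ 0)
    (h : IsDLSolution κ N p S m J u v) (hF : IsFieldsOf κ N p S m J u (F.fold φ)) {x : ℝ}
    (hx : x ∈ J) (he : ∀ n, F.e (φ (n + 1)) (φ n) x ≠ 0) :
    (∀ n, SemiDiscreteEq (F.fold φ) p n x) ∧ FirstConstraint (F.fold φ) N x ∧
      SecondConstraint (F.fold φ) p N x ∧
      ∀ k ∈ paramDomain p (κ.right N S),
        LaxPairHolds (genP N (F.fold φ).u k x) (genQ₁ N (F.fold φ) p k x)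
          (genQ₂ N (F.fold φ) p k x) (Phi N u k m) (Phi N u k (m + 1)) x :=
  ⟨hF.semi_discrete h hx he hJ hp, hF.first_constraint h hx hJ, hF.second_constraint h hx he,
    fun _ hk => hF.lax_pair h hx hJ he hk⟩

end

/-- A system in folded fields has the graded Lax pair of the folded fields. -/
theorem hasGradedLaxPair_of_fold {N : ℕ} (hN : 0 < N) {φ : ℤ → ℤ} (hφ : ∀ n, φ (n + N) = φ n)
    {comp idx : Set ℤ} (hc : ∀ n, φ n ∈ comp) {Sys : Fields → ℂ → ℝ → Prop}
    {P : (ℤ → ℝ → ℂ) → ℂ → ℝ → Matrix (Fin N) (Fin N) ℂ}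
    {Q₁ Q₂ : Fields → ℂ → ℂ → ℝ → Matrix (Fin N) (Fin N) ℂ}
    (hP : ∀ u : ℤ → ℝ → ℂ, P u = genP N fun n => u (φ n))
    (hQ₁ : ∀ F p, Q₁ F p = genQ₁ N (F.fold φ) p) (hQ₂ : ∀ F p, Q₂ F p = genQ₂ N (F.fold φ) p)
    (he : ∀ (F : Fields) (x : ℝ), (∀ b ∈ idx, F.e (b + 1) b x ≠ 0) →
      ∀ n, F.e (φ (n + 1)) (φ n) x ≠ 0)
    (hSys : ∀ (F : Fields) (p : ℂ) (x : ℝ), (∀ b ∈ idx, F.e (b + 1) b x ≠ 0) →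
      (Sys F p x ↔ ∀ n, SemiDiscreteEq (F.fold φ) p n x)) :
    HasGradedLaxPair N comp idx Sys P Q₁ Q₂ := by
  intro F p x
  rw [hP, hP, hQ₁, hQ₂]
  refine ⟨?_, ?_, ?_, fun h hb => ?_⟩
  · unfold genP
    simpa only [one_smul] using isZGraded_bidiagonal _ 1
  · have := isZGraded_bidiagonal (fun i : Fin N => (F.fold φ).q p ((i : ℕ) + 1) x /
      (F.fold φ).e (i : ℕ) ((i : ℕ) + 1) x) (-1)
    unfold genQ₁
    simpa only [neg_smul, one_smul, ← sub_eq_add_neg] using this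
  · unfold genQ₂
    simpa only [one_smul] using isZGraded_bidiagonal _ 1
  · rw [hSys F p x hb]
    exact Fields.laxCompatible_iff (F.fold_periodic φ hφ) hN (fun n => (h _ (hc n)).1)
      (fun n => (h _ (hc n)).2.1) (fun n => (h _ (hc n)).2.2.1) (fun n => (h _ (hc n)).2.2.2)
      (he F x hb)

/-! ### The explicit systems -/

/-- The semi-discrete equation for `u_b` with neighbours `u_a` and `u_c`. -/
def NeighbourEq (F : Fields) (p : ℂ) (x : ℝ) (a b c : ℤ) : Prop :=
  LogDerivEq 1 (F.q p b) (F.u c x - 2 * F.u b x + F.u a x + F.q p b x -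
    F.q p c x / F.e c b x - F.q p a x / F.e a b x) x

theorem logDerivEq_iff {c : ℂ} (hc : c ≠ 0) {f : ℝ → ℂ} {L L' : ℂ} {x : ℝ} (h : L = c * L') :
    LogDerivEq c f L x ↔ LogDerivEq 1 f L' x := by
  unfold LogDerivEq
  refine and_congr_right fun _ => exists_congr fun f' => and_congr_right fun _ => ?_
  rw [h, one_mul]
  exact mul_right_inj' hc

/-! ### Type A_1^(1): period 2. -/

theorem foldIdx_two_values : foldIdx 2 2 (-1) = 1 ∧ foldIdx 2 2 0 = 0 ∧ foldIdx 2 2 1 = 1 ∧ foldIdx 2 2 2 = 0 := by decide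

theorem foldIdx_two_forall {P : ℤ → ℤ → ℤ → Prop} :
    (∀ n, P (foldIdx 2 2 (n - 1)) (foldIdx 2 2 n) (foldIdx 2 2 (n + 1))) ↔
      P 1 0 1 ∧ P 0 1 0 := by
  rw [foldIdx_forall (by norm_num)]
  constructor
  · exact fun h => ⟨h 0 (by norm_num) (by norm_num), h 1 (by norm_num) (by norm_num)⟩
  · rintro ⟨h0, h1⟩ n hn hn'
    interval_cases n
    exacts [h0, h1]

theorem A11P_eq (u : ℤ → ℝ → ℂ) : A11P u = genP 2 fun n => u (foldIdx 2 2 n) := by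
  obtain ⟨-, h0, h1, h2⟩ := foldIdx_two_values
  funext k x
  ext i j
  fin_cases i <;> fin_cases j <;> simp [A11P, genP, cyc, h0, h1, h2]

theorem A11Q₁_eq (F : Fields) (p : ℂ) :
    A11Q₁ F p = genQ₁ 2 (F.fold (foldIdx 2 2)) p := by
  obtain ⟨-, h0, h1, h2⟩ := foldIdx_two_values
  funext k x
  ext i j
  fin_cases i <;> fin_cases j <;>
    simp [A11Q₁, genQ₁, cyc, Fields.fold_q, Fields.fold_e, h0, h1, h2]

theorem A11Q₂_eq (F : Fields) (p : ℂ) :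
    A11Q₂ F p = genQ₂ 2 (F.fold (foldIdx 2 2)) p := by
  obtain ⟨-, h0, h1, h2⟩ := foldIdx_two_values
  funext k x
  ext i j
  fin_cases i <;> fin_cases j <;>
    simp [A11Q₂, genQ₂, cyc, Fields.fold_q, Fields.fold_e, h0, h1, h2]

theorem A11System_iff (F : Fields) (p : ℂ) (x : ℝ) :
    A11System F p x ↔ ∀ n, SemiDiscreteEq (F.fold (foldIdx 2 2)) p n x := by
  refine Iff.trans ?_ (foldIdx_two_forall (P := NeighbourEq F p x)).symm
  have hswap : ∀ a b c, NeighbourEq F p x a b c → NeighbourEq F p x c b a := fun a b c h => by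
    unfold NeighbourEq at h ⊢
    convert h using 1
    ring
  unfold A11System
  rw [logDerivEq_iff (f := F.q p 0) (c := 1) (L' := F.u 1 x - 2 * F.u 0 x + F.u 1 x + F.q p 0 x -
    F.q p 1 x / F.e 1 0 x - F.q p 1 x / F.e 1 0 x) (by norm_num)
    (by ring)]
  rw [logDerivEq_iff (f := F.q p 1) (c := 1) (L' := F.u 0 x - 2 * F.u 1 x + F.u 0 x + F.q p 1 x -
    F.q p 0 x / F.e 0 1 x - F.q p 0 x / F.e 0 1 x) (by norm_num)
    (by ring)]
  exact ⟨fun ⟨h0, h1⟩ => ⟨h0, h1⟩, fun ⟨h0, h1⟩ => ⟨h0, h1⟩⟩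

theorem e_foldIdx_two_ne {F : Fields} {x : ℝ}
    (h : ∀ b ∈ ({0} : Set ℤ), F.e (b + 1) b x ≠ 0) (n : ℤ) :
    F.e (foldIdx 2 2 (n + 1)) (foldIdx 2 2 n) x ≠ 0 := by
  have h0 : F.e 1 0 x ≠ 0 := h 0 (by simp)
  exact (foldIdx_two_forall (P := fun _ b c => F.e c b x ≠ 0)).2
    ⟨h0, F.e_ne_zero h0⟩ n

theorem A11_hasGradedLaxPair :
    HasGradedLaxPair 2 {0, 1} {0} A11System A11P A11Q₁ A11Q₂ :=
  hasGradedLaxPair_of_fold (by norm_num) (foldIdx_add 2 2)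
    ((foldIdx_two_forall (P := fun _ b _ => b ∈ ({0, 1} : Set ℤ))).2 (by simp))
    A11P_eq A11Q₁_eq A11Q₂_eq (fun _ _ h => e_foldIdx_two_ne h)
    fun F p x _ => A11System_iff F p x

theorem A11_explicit {p : ℂ} {S : Spectral} {m : ℤ} {J : Set ℝ} {u v : WaveFamily}
    (hp : p ≠ 0) (hJ : IsOpen J) (h : IsDLSolution .A 2 p S m J u v) :
    ExplicitSystem .A 2 p S m J u {0} A11System A11Constraints A11P A11Q₁ A11Q₂ := by
  intro F hF x hx hb
  have hF' : IsFieldsOf .A 2 p S m J u (F.fold (foldIdx 2 2)) := by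
    have key : ∀ f : ℤ → ℂ, (∀ n, f (n + (2 : ℕ)) = f n) → ∀ n, f (foldIdx 2 2 n) = f n := by
      intro f hf
      -- For period 2 the reflection n ↦ 2 - n differs from the identity by the even number 2(1 -
      -- n), so periodicity alone suffices.
      refine foldIdx_invariant hf fun n => ?_
      have := (show Function.Periodic f (2 : ℤ) from hf).int_mul (1 - n) n
      rw [← this]
      congr 1
      push_cast
      ring
    exact hF.fold (fun n l _ x _ => key (fun n => tau (Kind.A.zeta 2 S) p n l x)
        (fun n => h.periodic.tau_eq n l x) n)
      fun n l hl x hx => key (fun n => pot (Kind.A.zeta 2 S) p u n l x)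
        (fun n => h.periodic.pot_eq n l hl x hx) n
  obtain ⟨hsd, hc₁, hc₂, hlax⟩ :=
    IsFieldsOf.folded_system hJ hp h hF' hx (e_foldIdx_two_ne hb)
  refine ⟨(A11System_iff F p x).2 hsd, ⟨?_, ?_⟩, fun k hk => ?_⟩
  · obtain ⟨-, h0, h1, h2⟩ := foldIdx_two_values
    unfold FirstConstraint at hc₁
    norm_num [Finset.sum_range_succ, Fields.fold_u, h0, h1, h2] at hc₁
    refine (hc₁.congr_deriv ?_).congr_of_eventuallyEq (Filter.Eventually.of_forall fun y => ?_)
    · ring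
    · ring
  · obtain ⟨-, h0, h1, h2⟩ := foldIdx_two_values
    unfold SecondConstraint at hc₂
    norm_num [Finset.prod_range_succ, Fields.fold_q, Fields.fold_e, Fields.e_self, h0, h1, h2] at hc₂
    rw [← hc₂]
    ring
  · rw [A11P_eq, A11Q₁_eq, A11Q₂_eq]
    exact hlax k hk

/-! ### Type A_2^(2): period 3 with reflection n ↦ 2 - n. -/

theorem foldIdx_three_values : foldIdx 3 2 (-1) = 0 ∧ foldIdx 3 2 0 = 0 ∧ foldIdx 3 2 1 = 1 ∧ foldIdx 3 2 2 = 0 ∧ foldIdx 3 2 3 = 0 := by decide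

theorem foldIdx_three_forall {P : ℤ → ℤ → ℤ → Prop} :
    (∀ n, P (foldIdx 3 2 (n - 1)) (foldIdx 3 2 n) (foldIdx 3 2 (n + 1))) ↔
      P 0 0 1 ∧ P 0 1 0 ∧ P 1 0 0 := by
  rw [foldIdx_forall (by norm_num)]
  constructor
  · exact fun h => ⟨h 0 (by norm_num) (by norm_num), h 1 (by norm_num) (by norm_num), h 2 (by norm_num) (by norm_num)⟩
  · rintro ⟨h0, h1, h2⟩ n hn hn'
    interval_cases n
    exacts [h0, h1, h2]

theorem A22P_eq (u : ℤ → ℝ → ℂ) : A22P u = genP 3 fun n => u (foldIdx 3 2 n) := by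
  obtain ⟨-, h0, h1, h2, h3⟩ := foldIdx_three_values
  funext k x
  ext i j
  fin_cases i <;> fin_cases j <;> simp [A22P, genP, cyc, h0, h1, h2, h3]

theorem A22Q₁_eq (F : Fields) (p : ℂ) :
    A22Q₁ F p = genQ₁ 3 (F.fold (foldIdx 3 2)) p := by
  obtain ⟨-, h0, h1, h2, h3⟩ := foldIdx_three_values
  funext k x
  ext i j
  fin_cases i <;> fin_cases j <;>
    simp [A22Q₁, genQ₁, cyc, Fields.fold_q, Fields.fold_e, Fields.e_self, h0, h1, h2, h3]

theorem A22Q₂_eq (F : Fields) (p : ℂ) :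
    A22Q₂ F p = genQ₂ 3 (F.fold (foldIdx 3 2)) p := by
  obtain ⟨-, h0, h1, h2, h3⟩ := foldIdx_three_values
  funext k x
  ext i j
  fin_cases i <;> fin_cases j <;>
    simp [A22Q₂, genQ₂, cyc, Fields.fold_q, Fields.fold_e, Fields.e_self, h0, h1, h2, h3]

/-- At the fold, u_0 is its own neighbour and e_{0,0} = 2 contributes q_0/2, which clearing
denominators turns into the coefficient 2. The equation at n = 2 mirrors the one at n = 0. -/
theorem A22System_iff (F : Fields) (p : ℂ) (x : ℝ) :
    A22System F p x ↔ ∀ n, SemiDiscreteEq (F.fold (foldIdx 3 2)) p n x := by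
  refine Iff.trans ?_ (foldIdx_three_forall (P := NeighbourEq F p x)).symm
  have hswap : ∀ a b c, NeighbourEq F p x a b c → NeighbourEq F p x c b a := fun a b c h => by
    unfold NeighbourEq at h ⊢
    convert h using 1
    ring
  unfold A22System
  rw [logDerivEq_iff (f := F.q p 0) (c := 2) (L' := F.u 1 x - 2 * F.u 0 x + F.u 0 x + F.q p 0 x -
    F.q p 1 x / F.e 1 0 x - F.q p 0 x / F.e 0 0 x) (by norm_num)
    (by simp only [F.e_self]; ring)]
  rw [logDerivEq_iff (f := F.q p 1) (c := 1) (L' := F.u 0 x - 2 * F.u 1 x + F.u 0 x + F.q p 1 x -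
    F.q p 0 x / F.e 0 1 x - F.q p 0 x / F.e 0 1 x) (by norm_num)
    (by ring)]
  exact ⟨fun ⟨h0, h1⟩ => ⟨h0, h1, hswap _ _ _ h0⟩, fun ⟨h0, h1, _⟩ => ⟨h0, h1⟩⟩

theorem e_foldIdx_three_ne {F : Fields} {x : ℝ}
    (h : ∀ b ∈ ({0} : Set ℤ), F.e (b + 1) b x ≠ 0) (n : ℤ) :
    F.e (foldIdx 3 2 (n + 1)) (foldIdx 3 2 n) x ≠ 0 := by
  have hs : ∀ a, F.e a a x ≠ 0 := fun a => by
    rw [F.e_self]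
    exact two_ne_zero
  have h0 : F.e 1 0 x ≠ 0 := h 0 (by simp)
  exact (foldIdx_three_forall (P := fun _ b c => F.e c b x ≠ 0)).2
    ⟨h0, F.e_ne_zero h0, hs _⟩ n

theorem A22_hasGradedLaxPair :
    HasGradedLaxPair 3 {0, 1} {0} A22System A22P A22Q₁ A22Q₂ :=
  hasGradedLaxPair_of_fold (by norm_num) (foldIdx_add 3 2)
    ((foldIdx_three_forall (P := fun _ b _ => b ∈ ({0, 1} : Set ℤ))).2 (by simp))
    A22P_eq A22Q₁_eq A22Q₂_eq (fun _ _ h => e_foldIdx_three_ne h)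
    fun F p x _ => A22System_iff F p x

theorem A22_explicit {p : ℂ} {S : Spectral} {m : ℤ} {J : Set ℝ} {u v : WaveFamily}
    (hp : p ≠ 0) (hJ : IsOpen J) (h : IsDLSolution .B 3 p S m J u v) :
    ExplicitSystem .B 3 p S m J u {0} A22System A22Constraints A22P A22Q₁ A22Q₂ := by
  intro F hF x hx hb
  have hF' : IsFieldsOf .B 3 p S m J u (F.fold (foldIdx 3 2)) :=
    hF.foldIdx h (h.symmetric (tauB_symm h.admissible)) (Or.inr (by norm_num))
  obtain ⟨hsd, hc₁, hc₂, hlax⟩ :=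
    IsFieldsOf.folded_system hJ hp h hF' hx (e_foldIdx_three_ne hb)
  refine ⟨(A22System_iff F p x).2 hsd, ⟨?_, ?_⟩, fun k hk => ?_⟩
  · obtain ⟨-, h0, h1, h2, h3⟩ := foldIdx_three_values
    unfold FirstConstraint at hc₁
    norm_num [Finset.sum_range_succ, Fields.fold_u, h0, h1, h2, h3] at hc₁
    refine (hc₁.congr_deriv ?_).congr_of_eventuallyEq (Filter.Eventually.of_forall fun y => ?_)
    · ring
    · ring
  · obtain ⟨-, h0, h1, h2, h3⟩ := foldIdx_three_values
    unfold SecondConstraint at hc₂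
    norm_num [Finset.prod_range_succ, Fields.fold_q, Fields.fold_e, Fields.e_self, h0, h1, h2, h3] at hc₂
    rw [← hc₂]
    ring
  · rw [A22P_eq, A22Q₁_eq, A22Q₂_eq]
    exact hlax k hk

/-! ### Type C_2^(1): period 4 with reflection n ↦ 4 - n. -/

theorem foldIdx_four_values : foldIdx 4 4 (-1) = 1 ∧ foldIdx 4 4 0 = 0 ∧ foldIdx 4 4 1 = 1 ∧ foldIdx 4 4 2 = 2 ∧ foldIdx 4 4 3 = 1 ∧ foldIdx 4 4 4 = 0 := by decide

theorem foldIdx_four_forall {P : ℤ → ℤ → ℤ → Prop} :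
    (∀ n, P (foldIdx 4 4 (n - 1)) (foldIdx 4 4 n) (foldIdx 4 4 (n + 1))) ↔
      P 1 0 1 ∧ P 0 1 2 ∧ P 1 2 1 ∧ P 2 1 0 := by
  rw [foldIdx_forall (by norm_num)]
  constructor
  · exact fun h => ⟨h 0 (by norm_num) (by norm_num), h 1 (by norm_num) (by norm_num), h 2 (by norm_num) (by norm_num), h 3 (by norm_num) (by norm_num)⟩
  · rintro ⟨h0, h1, h2, h3⟩ n hn hn'
    interval_cases n
    exacts [h0, h1, h2, h3]

theorem C21P_eq (u : ℤ → ℝ → ℂ) : C21P u = genP 4 fun n => u (foldIdx 4 4 n) := by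
  obtain ⟨-, h0, h1, h2, h3, h4⟩ := foldIdx_four_values
  funext k x
  ext i j
  fin_cases i <;> fin_cases j <;> simp [C21P, genP, cyc, h0, h1, h2, h3, h4]

theorem C21Q₁_eq (F : Fields) (p : ℂ) :
    C21Q₁ F p = genQ₁ 4 (F.fold (foldIdx 4 4)) p := by
  obtain ⟨-, h0, h1, h2, h3, h4⟩ := foldIdx_four_values
  funext k x
  ext i j
  fin_cases i <;> fin_cases j <;>
    simp [C21Q₁, genQ₁, cyc, Fields.fold_q, Fields.fold_e, h0, h1, h2, h3, h4]

theorem C21Q₂_eq (F : Fields) (p : ℂ) :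
    C21Q₂ F p = genQ₂ 4 (F.fold (foldIdx 4 4)) p := by
  obtain ⟨-, h0, h1, h2, h3, h4⟩ := foldIdx_four_values
  funext k x
  ext i j
  fin_cases i <;> fin_cases j <;>
    simp [C21Q₂, genQ₂, cyc, Fields.fold_q, Fields.fold_e, h0, h1, h2, h3, h4]

/-- The reflection fixes the indices 0 and 2, whose two neighbours coincide; hence the factors 2.
The equation at n = 3 mirrors the one at n = 1. -/
theorem C21System_iff (F : Fields) (p : ℂ) (x : ℝ) :
    C21System F p x ↔ ∀ n, SemiDiscreteEq (F.fold (foldIdx 4 4)) p n x := by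
  refine Iff.trans ?_ (foldIdx_four_forall (P := NeighbourEq F p x)).symm
  have hswap : ∀ a b c, NeighbourEq F p x a b c → NeighbourEq F p x c b a := fun a b c h => by
    unfold NeighbourEq at h ⊢
    convert h using 1
    ring
  unfold C21System
  rw [logDerivEq_iff (f := F.q p 0) (c := 1) (L' := F.u 1 x - 2 * F.u 0 x + F.u 1 x + F.q p 0 x -
    F.q p 1 x / F.e 1 0 x - F.q p 1 x / F.e 1 0 x) (by norm_num)
    (by ring)]
  rw [logDerivEq_iff (f := F.q p 1) (c := 1) (L' := F.u 2 x - 2 * F.u 1 x + F.u 0 x + F.q p 1 x -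
    F.q p 2 x / F.e 2 1 x - F.q p 0 x / F.e 0 1 x) (by norm_num)
    (by ring)]
  rw [logDerivEq_iff (f := F.q p 2) (c := 1) (L' := F.u 1 x - 2 * F.u 2 x + F.u 1 x + F.q p 2 x -
    F.q p 1 x / F.e 1 2 x - F.q p 1 x / F.e 1 2 x) (by norm_num)
    (by ring)]
  exact ⟨fun ⟨h0, h1, h2⟩ => ⟨h0, h1, h2, hswap _ _ _ h1⟩, fun ⟨h0, h1, h2, _⟩ => ⟨h0, h1, h2⟩⟩

theorem e_foldIdx_four_ne {F : Fields} {x : ℝ}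
    (h : ∀ b ∈ ({0, 1} : Set ℤ), F.e (b + 1) b x ≠ 0) (n : ℤ) :
    F.e (foldIdx 4 4 (n + 1)) (foldIdx 4 4 n) x ≠ 0 := by
  have h0 : F.e 1 0 x ≠ 0 := h 0 (by simp)
  have h1 : F.e 2 1 x ≠ 0 := h 1 (by simp)
  exact (foldIdx_four_forall (P := fun _ b c => F.e c b x ≠ 0)).2
    ⟨h0, h1, F.e_ne_zero h1, F.e_ne_zero h0⟩ n

theorem C21_hasGradedLaxPair :
    HasGradedLaxPair 4 {0, 1, 2} {0, 1} C21System C21P C21Q₁ C21Q₂ :=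
  hasGradedLaxPair_of_fold (by norm_num) (foldIdx_add 4 4)
    ((foldIdx_four_forall (P := fun _ b _ => b ∈ ({0, 1, 2} : Set ℤ))).2 (by simp))
    C21P_eq C21Q₁_eq C21Q₂_eq (fun _ _ h => e_foldIdx_four_ne h)
    fun F p x _ => C21System_iff F p x

theorem C21_explicit {p : ℂ} {S : Spectral} {m : ℤ} {J : Set ℝ} {u v : WaveFamily}
    (hp : p ≠ 0) (hJ : IsOpen J) (h : IsDLSolution .C 4 p S m J u v) :
    ExplicitSystem .C 4 p S m J u {0, 1} C21System C21Constraints C21P C21Q₁ C21Q₂ := by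
  intro F hF x hx hb
  have hF' : IsFieldsOf .C 4 p S m J u (F.fold (foldIdx 4 4)) :=
    hF.foldIdx h (h.symmetric (tauC_symm h.admissible)) (Or.inr (by norm_num))
  obtain ⟨hsd, hc₁, hc₂, hlax⟩ :=
    IsFieldsOf.folded_system hJ hp h hF' hx (e_foldIdx_four_ne hb)
  refine ⟨(C21System_iff F p x).2 hsd, ⟨?_, ?_⟩, fun k hk => ?_⟩
  · obtain ⟨-, h0, h1, h2, h3, h4⟩ := foldIdx_four_values
    unfold FirstConstraint at hc₁
    norm_num [Finset.sum_range_succ, Fields.fold_u, h0, h1, h2, h3, h4] at hc₁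
    refine (hc₁.congr_deriv ?_).congr_of_eventuallyEq (Filter.Eventually.of_forall fun y => ?_)
    · ring
    · ring
  · obtain ⟨-, h0, h1, h2, h3, h4⟩ := foldIdx_four_values
    unfold SecondConstraint at hc₂
    norm_num [Finset.prod_range_succ, Fields.fold_q, Fields.fold_e, Fields.e_self, h0, h1, h2, h3, h4] at hc₂
    rw [← hc₂]
    ring
  · rw [C21P_eq, C21Q₁_eq, C21Q₂_eq]
    exact hlax k hk

/-! ### Type D_3^(2): period 6 with reflection n ↦ 5 - n. -/

theorem foldIdx_six_values : foldIdx 6 5 (-1) = 0 ∧ foldIdx 6 5 0 = 0 ∧ foldIdx 6 5 1 = 1 ∧ foldIdx 6 5 2 = 2 ∧ foldIdx 6 5 3 = 2 ∧ foldIdx 6 5 4 = 1 ∧ foldIdx 6 5 5 = 0 ∧ foldIdx 6 5 6 = 0 := by decide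

theorem foldIdx_six_forall {P : ℤ → ℤ → ℤ → Prop} :
    (∀ n, P (foldIdx 6 5 (n - 1)) (foldIdx 6 5 n) (foldIdx 6 5 (n + 1))) ↔
      P 0 0 1 ∧ P 0 1 2 ∧ P 1 2 2 ∧ P 2 2 1 ∧ P 2 1 0 ∧ P 1 0 0 := by
  rw [foldIdx_forall (by norm_num)]
  constructor
  · exact fun h => ⟨h 0 (by norm_num) (by norm_num), h 1 (by norm_num) (by norm_num), h 2 (by norm_num) (by norm_num), h 3 (by norm_num) (by norm_num), h 4 (by norm_num) (by norm_num), h 5 (by norm_num) (by norm_num)⟩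
  · rintro ⟨h0, h1, h2, h3, h4, h5⟩ n hn hn'
    interval_cases n
    exacts [h0, h1, h2, h3, h4, h5]

theorem D32P_eq (u : ℤ → ℝ → ℂ) : D32P u = genP 6 fun n => u (foldIdx 6 5 n) := by
  obtain ⟨-, h0, h1, h2, h3, h4, h5, h6⟩ := foldIdx_six_values
  funext k x
  ext i j
  fin_cases i <;> fin_cases j <;> simp [D32P, genP, cyc, h0, h1, h2, h3, h4, h5, h6]

theorem D32Q₁_eq (F : Fields) (p : ℂ) :
    D32Q₁ F p = genQ₁ 6 (F.fold (foldIdx 6 5)) p := by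
  obtain ⟨-, h0, h1, h2, h3, h4, h5, h6⟩ := foldIdx_six_values
  funext k x
  ext i j
  fin_cases i <;> fin_cases j <;>
    simp [D32Q₁, genQ₁, cyc, Fields.fold_q, Fields.fold_e, Fields.e_self, h0, h1, h2, h3, h4, h5, h6]

theorem D32Q₂_eq (F : Fields) (p : ℂ) :
    D32Q₂ F p = genQ₂ 6 (F.fold (foldIdx 6 5)) p := by
  obtain ⟨-, h0, h1, h2, h3, h4, h5, h6⟩ := foldIdx_six_values
  funext k x
  ext i j
  fin_cases i <;> fin_cases j <;>
    simp [D32Q₂, genQ₂, cyc, Fields.fold_q, Fields.fold_e, Fields.e_self, h0, h1, h2, h3, h4, h5, h6]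

/-- Both ends are folds without a fixed index: u_0 and u_2 are their own neighbours, which accounts
for the coefficient 2 in the first and last equations. The other three of the six equations are
mirror images. -/
theorem D32System_iff (F : Fields) (p : ℂ) (x : ℝ) :
    D32System F p x ↔ ∀ n, SemiDiscreteEq (F.fold (foldIdx 6 5)) p n x := by
  refine Iff.trans ?_ (foldIdx_six_forall (P := NeighbourEq F p x)).symm
  have hswap : ∀ a b c, NeighbourEq F p x a b c → NeighbourEq F p x c b a := fun a b c h => by
    unfold NeighbourEq at h ⊢
    convert h using 1
    ring
  unfold D32System
  rw [logDerivEq_iff (f := F.q p 0) (c := 2) (L' := F.u 1 x - 2 * F.u 0 x + F.u 0 x + F.q p 0 x -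
    F.q p 1 x / F.e 1 0 x - F.q p 0 x / F.e 0 0 x) (by norm_num)
    (by simp only [F.e_self]; ring)]
  rw [logDerivEq_iff (f := F.q p 1) (c := 1) (L' := F.u 2 x - 2 * F.u 1 x + F.u 0 x + F.q p 1 x -
    F.q p 2 x / F.e 2 1 x - F.q p 0 x / F.e 0 1 x) (by norm_num)
    (by ring)]
  rw [logDerivEq_iff (f := F.q p 2) (c := 2) (L' := F.u 2 x - 2 * F.u 2 x + F.u 1 x + F.q p 2 x -
    F.q p 2 x / F.e 2 2 x - F.q p 1 x / F.e 1 2 x) (by norm_num)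
    (by simp only [F.e_self]; ring)]
  exact ⟨fun ⟨h0, h1, h2⟩ => ⟨h0, h1, h2, hswap _ _ _ h2, hswap _ _ _ h1, hswap _ _ _ h0⟩, fun ⟨h0, h1, h2, _, _, _⟩ => ⟨h0, h1, h2⟩⟩

theorem e_foldIdx_six_ne {F : Fields} {x : ℝ}
    (h : ∀ b ∈ ({0, 1} : Set ℤ), F.e (b + 1) b x ≠ 0) (n : ℤ) :
    F.e (foldIdx 6 5 (n + 1)) (foldIdx 6 5 n) x ≠ 0 := by
  have hs : ∀ a, F.e a a x ≠ 0 := fun a => by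
    rw [F.e_self]
    exact two_ne_zero
  have h0 : F.e 1 0 x ≠ 0 := h 0 (by simp)
  have h1 : F.e 2 1 x ≠ 0 := h 1 (by simp)
  exact (foldIdx_six_forall (P := fun _ b c => F.e c b x ≠ 0)).2
    ⟨h0, h1, hs _, F.e_ne_zero h1, F.e_ne_zero h0, hs _⟩ n

theorem D32_hasGradedLaxPair :
    HasGradedLaxPair 6 {0, 1, 2} {0, 1} D32System D32P D32Q₁ D32Q₂ :=
  hasGradedLaxPair_of_fold (by norm_num) (foldIdx_add 6 5)
    ((foldIdx_six_forall (P := fun _ b _ => b ∈ ({0, 1, 2} : Set ℤ))).2 (by simp))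
    D32P_eq D32Q₁_eq D32Q₂_eq (fun _ _ h => e_foldIdx_six_ne h)
    fun F p x _ => D32System_iff F p x

theorem D32_explicit {p : ℂ} {S : Spectral} {m : ℤ} {J : Set ℝ} {u v : WaveFamily}
    (hp : p ≠ 0) (hJ : IsOpen J) (h : IsDLSolution .B 6 p S m J u v) :
    ExplicitSystem .B 6 p S m J u {0, 1} D32System D32Constraints D32P D32Q₁ D32Q₂ := by
  intro F hF x hx hb
  have hF' : IsFieldsOf .B 6 p S m J u (F.fold (foldIdx 6 5)) :=
    hF.foldIdx h (h.symmetric (tauB_symm h.admissible)) (Or.inr (by norm_num))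
  obtain ⟨hsd, hc₁, hc₂, hlax⟩ :=
    IsFieldsOf.folded_system hJ hp h hF' hx (e_foldIdx_six_ne hb)
  refine ⟨(D32System_iff F p x).2 hsd, ⟨?_, ?_⟩, fun k hk => ?_⟩
  · obtain ⟨-, h0, h1, h2, h3, h4, h5, h6⟩ := foldIdx_six_values
    unfold FirstConstraint at hc₁
    norm_num [Finset.sum_range_succ, Fields.fold_u, h0, h1, h2, h3, h4, h5, h6] at hc₁
    refine (hc₁.congr_deriv ?_).congr_of_eventuallyEq (Filter.Eventually.of_forall fun y => ?_)
    · ring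
    · ring
  · obtain ⟨-, h0, h1, h2, h3, h4, h5, h6⟩ := foldIdx_six_values
    unfold SecondConstraint at hc₂
    norm_num [Finset.prod_range_succ, Fields.fold_q, Fields.fold_e, Fields.e_self, h0, h1, h2, h3, h4, h5, h6] at hc₂
    rw [← hc₂]
    ring
  · rw [D32P_eq, D32Q₁_eq, D32Q₂_eq]
    exact hlax k hk

end SemiDS

/-! ### The theorem -/

namespace SemiDS

/-- The two arguments add up to 2r + 1 = N, so the reflection about 0 followed by one period maps
one to the other. -/
theorem index_shift {N : ℕ} {r : ℕ} (hN : N = 2 * r + 1) {f : ℤ → ℂ} (h : ∀ n, f (n + N) = f n)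
    (h' : ∀ n, f (0 - n) = f n) (n : ℤ) : f ((-1 - n) + (r + 1)) = f (n + (r + 1)) := by
  rw [← h', ← h]
  congr 1
  rw [hN]
  push_cast
  ring

end SemiDS

end

theorem mainTheorem7 (p : ℂ) (hp : p ≠ 0) (m : ℤ) (J : Set ℝ) (hJ : IsOpen J)
    (hJ' : J.OrdConnected) (S : SemiDS.Spectral) (u v : SemiDS.WaveFamily) :
    -- the reductions of types A_r^(1), A_2r^(2), D_{r+1}^(2), C_r^(1), and A_2r^(2) once more
    (∀ r : ℕ, 1 ≤ r →
      (SemiDS.IsDLSolution .A (r + 1) p S m J u v →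
        SemiDS.PeriodicReduction .A (r + 1) p S m J u v ∧
        SemiDS.ReducedSystem .A (r + 1) p S m J u) ∧
      (SemiDS.IsDLSolution .B (2 * r + 1) p S m J u v →
        SemiDS.PeriodicReduction .B (2 * r + 1) p S m J u v ∧
        SemiDS.SymmetricReduction .B (2 * r + 1) (-1) p S m J u ∧
        SemiDS.ReducedSystem .B (2 * r + 1) p S m J u) ∧
      (SemiDS.IsDLSolution .B (2 * r + 2) p S m J u v →
        SemiDS.PeriodicReduction .B (2 * r + 2) p S m J u v ∧
        SemiDS.SymmetricReduction .B (2 * r + 2) (-1) p S m J u ∧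
        SemiDS.ReducedSystem .B (2 * r + 2) p S m J u) ∧
      (SemiDS.IsDLSolution .C (2 * r) p S m J u v →
        SemiDS.PeriodicReduction .C (2 * r) p S m J u v ∧
        SemiDS.SymmetricReduction .C (2 * r) 0 p S m J u ∧
        SemiDS.ReducedSystem .C (2 * r) p S m J u) ∧
      (SemiDS.IsDLSolution .C (2 * r + 1) p S m J u v →
        SemiDS.PeriodicReduction .C (2 * r + 1) p S m J u v ∧
        SemiDS.SymmetricReduction .C (2 * r + 1) 0 p S m J u ∧
        SemiDS.ReducedSystem .C (2 * r + 1) p S m J u ∧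
        -- the index shift by r + 1 turns these into the symmetries of type A_2r^(2)
        (∀ (n l : ℤ) (x : ℝ),
          SemiDS.tau (SemiDS.Kind.C.zeta (2 * r + 1) S) p ((-1 - n) + (r + 1)) l x =
            SemiDS.tau (SemiDS.Kind.C.zeta (2 * r + 1) S) p (n + (r + 1)) l x) ∧
        (∀ n : ℤ, ∀ l ∈ ({m, m + 1} : Set ℤ), ∀ x ∈ J,
          SemiDS.pot (SemiDS.Kind.C.zeta (2 * r + 1) S) p u ((-1 - n) + (r + 1)) l x =
            SemiDS.pot (SemiDS.Kind.C.zeta (2 * r + 1) S) p u (n + (r + 1)) l x))) ∧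
    -- the explicit systems A_1^(1), A_2^(2), C_2^(1), D_3^(2)
    (SemiDS.IsDLSolution .A 2 p S m J u v →
      SemiDS.ExplicitSystem .A 2 p S m J u {0} SemiDS.A11System SemiDS.A11Constraints
        SemiDS.A11P SemiDS.A11Q₁ SemiDS.A11Q₂) ∧
    (SemiDS.IsDLSolution .B 3 p S m J u v →
      SemiDS.ExplicitSystem .B 3 p S m J u {0} SemiDS.A22System SemiDS.A22Constraints
        SemiDS.A22P SemiDS.A22Q₁ SemiDS.A22Q₂) ∧
    (SemiDS.IsDLSolution .C 4 p S m J u v →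
      SemiDS.ExplicitSystem .C 4 p S m J u {0, 1} SemiDS.C21System SemiDS.C21Constraints
        SemiDS.C21P SemiDS.C21Q₁ SemiDS.C21Q₂) ∧
    (SemiDS.IsDLSolution .B 6 p S m J u v →
      SemiDS.ExplicitSystem .B 6 p S m J u {0, 1} SemiDS.D32System SemiDS.D32Constraints
        SemiDS.D32P SemiDS.D32Q₁ SemiDS.D32Q₂) ∧
    -- their graded Lax pairs
    SemiDS.HasGradedLaxPair 2 {0, 1} {0} SemiDS.A11System
      SemiDS.A11P SemiDS.A11Q₁ SemiDS.A11Q₂ ∧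
    SemiDS.HasGradedLaxPair 3 {0, 1} {0} SemiDS.A22System
      SemiDS.A22P SemiDS.A22Q₁ SemiDS.A22Q₂ ∧
    SemiDS.HasGradedLaxPair 4 {0, 1, 2} {0, 1} SemiDS.C21System
      SemiDS.C21P SemiDS.C21Q₁ SemiDS.C21Q₂ ∧
    SemiDS.HasGradedLaxPair 6 {0, 1, 2} {0, 1} SemiDS.D32System
      SemiDS.D32P SemiDS.D32Q₁ SemiDS.D32Q₂ := by
  refine ⟨fun r _ => ⟨fun h => ⟨h.periodic, h.reduced_system hp hJ hJ'⟩,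
    fun h => ⟨h.periodic, h.symmetric (SemiDS.tauB_symm h.admissible),
      h.reduced_system hp hJ hJ'⟩,
    fun h => ⟨h.periodic, h.symmetric (SemiDS.tauB_symm h.admissible),
      h.reduced_system hp hJ hJ'⟩,
    fun h => ⟨h.periodic, h.symmetric (SemiDS.tauC_symm h.admissible),
      h.reduced_system hp hJ hJ'⟩,
    fun h => ?_⟩, SemiDS.A11_explicit hp hJ, SemiDS.A22_explicit hp hJ,
    SemiDS.C21_explicit hp hJ, SemiDS.D32_explicit hp hJ, SemiDS.A11_hasGradedLaxPair,
    SemiDS.A22_hasGradedLaxPair, SemiDS.C21_hasGradedLaxPair, SemiDS.D32_hasGradedLaxPair⟩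
  have hs := h.symmetric (SemiDS.tauC_symm h.admissible)
  refine ⟨h.periodic, hs, h.reduced_system hp hJ hJ', fun n l x => ?_, fun n l hl x hx => ?_⟩
  · exact SemiDS.index_shift rfl (f := fun n => SemiDS.tau _ p n l x)
      (fun n => h.periodic.tau_eq n l x) (fun n => hs.tau_eq n l x) n
  · exact SemiDS.index_shift rfl (f := fun n => SemiDS.pot _ p u n l x)
      (fun n => h.periodic.pot_eq n l hl x hx) (fun n => hs.pot_eq n l hl x hx) n
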